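/- Let $N\ge 1$ be an integer, let $a\ge b\ge -\tfrac12$ be real, and put $\epsilon=\frac{a+b+1}{2}\ge 0$, $\widehat x=(x+\epsilon)^2$, $\mathbb Z_+^{\epsilon}=\{\widehat x: x=0,1,2,\dots\}$. Let $\mathcal Z\subset\mathbb C^2$ be the set of pairs $(z,z')$ such that one of the following holds: $z'=\overline z$ with $(z,z')\notin\mathbb R^2$; or $z,z'$ are real and $n<z,z'<n+1$ for some $n\in\mathbb Z$; or $z,z'$ are real and, for some integer $n\ge1$, $z=n,\ z'>n-1$ or $z'=n,\ z>n-1$. Let $(z,z')$ be admissible: $\Sigma:=z+z'+b$ satisfies $\Re\Sigma>-1$, and both $(z,z')$ and $(z+2\epsilon,z'+2\epsilon)$ lie in $\mathcal Z$ (so $\Sigma$ is real). For $x=0,1,2,\dots$ let $$W(\widehat x)=\frac{(x+\epsilon)\,\Gamma(x+2\epsilon)\Gamma(x+a+1)}{\Gamma(x+1)\Gamma(x+b+1)}\cdot\frac{1}{\Gamma(z-x+N)\Gamma(z'-x+N)\Gamma(z+x+N+2\epsilon)\Gamma(z'+x+N+2\epsilon)},$$ where $1/\Gamma$ is the entire function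 and, for $x=\epsilon=0$, $(x+\epsilon)\Gamma(x+2\epsilon)$ means $\tfrac12$. For integers $\lambda_1\ge\dots\ge\lambda_N\ge0$ put $l_i=\lambda_i+N-i$. Let $\mathcal O^{(N)}$ be the random subset $\{\widehat{l}_1,\dots,\widehat{l}_N\}$ of $\mathbb Z_+^{\epsilon}$, where $\lambda$ has probability proportional to $\prod_{i<j}(\widehat l_i-\widehat l_j)^2\prod_{i}W(\widehat l_i)$ (the BC type $z$-measure of level $N$). Write $(c)_k=c(c+1)\cdots(c+k-1)$ and ${}_4F_3(1)$ for the generalized hypergeometric series at $1$. Let $\mathfrak p_N$ and $\mathfrak p_{N-1}$ be the cases $n=N$ (for $\Sigma\ne0$) and $n=N-1$ of the polynomials in $\widehat x$ $$\mathfrak p_n(\widehat x)=\frac{(1+a)_n(1-z-N)_n(1-z'-N)_n}{(n+1-2N-\Sigma)_n}\;{}_4F_3\!\left[{-n,\ n+1-2N-\Sigma,\ x+2\epsilon,\ -x\atop 1+a,\ 1-z-N,\ 1-z'-N};1\right],$$ let $$h_{N-1}=\frac12\cdot\frac{\Gamma(N+a)\Gamma(N)\Gamma(\Sigma+1)\Gamma(\Sigma+2)}{\Gamma(N+\Sigma+a+1)\Gamma(N+\Sigma+1)\Gamma(1+z)\Gamma(1+z')\Gamma(1+z+b)\Gamma(1+z'+b)},$$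 and let $\widetilde{\mathfrak p}_N$ be the polynomial in $\widehat x$ whose values for integers $x\ge N$ are $$\widetilde{\mathfrak p}_N(\widehat x)=\frac{\Gamma(x+1)\Gamma(x+N+2\epsilon)}{\Gamma(x+2\epsilon)\Gamma(x-N+1)}\;{}_4F_3\!\left[{-N,\ -N-a,\ z,\ z'\atop \Sigma+1,\ x-N+1,\ -x-N-a-b};1\right].$$ Then: 1. $W$ is real and nonnegative on $\mathbb Z_+^{\epsilon}$, and $\mathcal O^{(N)}$ is a well-defined random configuration, an orthogonal polynomial ensemble with weight $W$: it has $N$ points almost surely, and for some constant $c>0$ every set of $N$ distinct points satisfies $\mathbb P(\mathcal O^{(N)}=\{\widehat x_1,\dots,\widehat x_N\})=c\prod_{i<j}|\widehat x_i-\widehat x_j|^2\prod_iW(\widehat x_i)$. 2. $\mathfrak p_{N-1}$ is the monic orthogonal polynomial of degree $N-1$ for the weight $W$ on $\mathbb Z_+^\epsilon$, with squared norm $\sum_{x\ge0}\mathfrak p_{N-1}(\widehat x)^2W(\widehat x)=h_{N-1}\neq0$; if $\Sigma>0$, then $\mathfrak p_N$ is the monic orthogonal polynomial of degree $N$. 3.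 If $\Sigma\ne0$, then $$K(\widehat x,\widehat y)=\frac{\sqrt{W(\widehat x)W(\widehat y)}}{h_{N-1}}\cdot\frac{\mathfrak p_N(\widehat x)\mathfrak p_{N-1}(\widehat y)-\mathfrak p_{N-1}(\widehat x)\mathfrak p_N(\widehat y)}{\widehat x-\widehat y}\qquad(\widehat x,\widehat y\in\mathbb Z_+^\epsilon)$$ (with the limit value of the polynomial quotient for $\widehat x=\widehat y$) is a correlation kernel of $\mathcal O^{(N)}$: for all $m$ and all distinct $\widehat x_1,\dots,\widehat x_m\in\mathbb Z_+^\epsilon$, $\mathbb P(\{\widehat x_1,\dots,\widehat x_m\}\subseteq\mathcal O^{(N)})=\det[K(\widehat x_i,\widehat x_j)]_{i,j=1}^m$. 4. For every admissible $(z,z')$, including those with $\Sigma=0$, the same formula with $\widetilde{\mathfrak p}_N$ in place of $\mathfrak p_N$ is a real-valued correlation kernel of $\mathcal O^{(N)}$, and for $\Sigma\neq0$ it equals $K$. -/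

import Mathlib

open MeasureTheory Polynomial

namespace ZMeas

noncomputable section

/-! ### Parameters -/

/-- `ε = (a + b + 1) / 2`. -/
def eps (a b : ℝ) : ℝ := (a + b + 1) / 2

/-- `Σ = z + z' + b`. -/
def sig (z z' : ℂ) (b : ℝ) : ℂ := z + z' + b

/-- Principal series: non-real pairs of complex conjugates. -/
def Zprinc : Set (ℂ × ℂ) :=
  {p | ¬ (p.1.im = 0 ∧ p.2.im = 0) ∧ p.2 = (starRingEnd ℂ) p.1}

/-- Complementary series: real pairs lying in a common open interval `(n, n + 1)`. -/
def Zcompl : Set (ℂ × ℂ) :=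
  {p | p.1.im = 0 ∧ p.2.im = 0 ∧
    ∃ n : ℤ, (n : ℝ) < p.1.re ∧ p.1.re < n + 1 ∧ (n : ℝ) < p.2.re ∧ p.2.re < n + 1}

/-- Degenerate series: real pairs, one entry being an integer `n ≥ 1`, the other one `> n - 1`. -/
def Zdegen : Set (ℂ × ℂ) :=
  {p | p.1.im = 0 ∧ p.2.im = 0 ∧
    ∃ n : ℕ, 1 ≤ n ∧
      ((p.1.re = n ∧ (n : ℝ) - 1 < p.2.re) ∨ (p.2.re = n ∧ (n : ℝ) - 1 < p.1.re))}

/-- Admissible pairs `(z, z')`. -/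
def Admissible (z z' : ℂ) (a b : ℝ) : Prop :=
  -1 < (sig z z' b).re ∧
  (z, z') ∈ Zprinc ∪ Zcompl ∪ Zdegen ∧
  (z + 2 * (eps a b : ℂ), z' + 2 * (eps a b : ℂ)) ∈ Zprinc ∪ Zcompl ∪ Zdegen

/-! ### The quadratic half-lattice and the weight -/

/-- `x̂ = (x + ε)²`. -/
def hat (a b : ℝ) (x : ℕ) : ℝ := ((x : ℝ) + eps a b) ^ 2

/-- The quadratic half-lattice `{(n + ε)² : n = 0, 1, 2, …}`. -/
def HalfLattice (a b : ℝ) : Set ℝ := Set.range (hat a b)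

/-- The point of the half-lattice with label `x`. -/
def pt (a b : ℝ) (x : ℕ) : HalfLattice a b := ⟨hat a b x, x, rfl⟩

/-- For `ε ≥ 0` the labelling of the lattice points by nonnegative integers is bijective. -/
lemma pt_bijective {a b : ℝ} (h : 0 ≤ eps a b) : Function.Bijective (pt a b) := by
  constructor
  · intro x y hxy
    have h1 : hat a b x = hat a b y := congrArg Subtype.val hxy
    unfold hat at h1
    have hx : (0 : ℝ) ≤ (x : ℝ) + eps a b := by positivity
    have hy : (0 : ℝ) ≤ (y : ℝ) + eps a b := by positivity
    have h2 := (pow_left_inj₀ hx hy two_ne_zero).1 h1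
    exact_mod_cast add_right_cancel h2
  · rintro ⟨_, x, rfl⟩
    exact ⟨x, rfl⟩

/-- The factor `(x + ε) Γ(x + 2ε)`; at `x = 0` it is `ε Γ(2ε) = Γ(2ε + 1) / 2`, which also is the
value by continuity when `ε = 0`. -/
def leadFactor (a b : ℝ) (x : ℕ) : ℝ :=
  if x = 0 then Real.Gamma (2 * eps a b + 1) / 2
  else ((x : ℝ) + eps a b) * Real.Gamma (x + 2 * eps a b)

lemma leadFactor_eq {a b : ℝ} (x : ℕ) (h : x ≠ 0 ∨ eps a b ≠ 0) :
    leadFactor a b x = ((x : ℝ) + eps a b) * Real.Gamma (x + 2 * eps a b) := by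
  unfold leadFactor
  split_ifs with hx
  · subst hx
    have he : eps a b ≠ 0 := by simpa using h
    rw [Real.Gamma_add_one (mul_ne_zero two_ne_zero he)]
    push_cast
    rw [zero_add, zero_add]
    ring
  · rfl

/-- The right-hand side of the formula for the weight `W(x̂)`, a priori a complex number. In Mathlib
`Complex.Gamma` vanishes at its poles, so that the inverses below are the values of the entire
function `1 / Γ`. -/
def weightC (z z' : ℂ) (a b : ℝ) (N x : ℕ) : ℂ :=
  ((leadFactor a b x * Real.Gamma (x + a + 1) /
      (Real.Gamma (x + 1) * Real.Gamma (x + b + 1)) : ℝ) : ℂ) *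
    (Complex.Gamma (z - x + N) * Complex.Gamma (z' - x + N) *
      Complex.Gamma (z + x + N + 2 * (eps a b : ℂ)) *
      Complex.Gamma (z' + x + N + 2 * (eps a b : ℂ)))⁻¹

/-- The weight `W(x̂)` as a real number. -/
def weight (z z' : ℂ) (a b : ℝ) (N x : ℕ) : ℝ := (weightC z z' a b N x).re

/-! ### The z-measure of level `N` and the point process `O^(N)` -/

/-- Positive signatures `λ₁ ≥ … ≥ λ_N ≥ 0` of length `N`. -/
abbrev Signature (N : ℕ) : Type := {lam : Fin N → ℕ // Antitone lam}

/-- Shifted coordinates `l_i = λ_i + N - i`, `1 ≤ i ≤ N` (the index `i : Fin N` starts at `0`). -/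
def shifted {N : ℕ} (lam : Signature N) (i : Fin N) : ℕ := lam.1 i + (N - 1 - (i : ℕ))

/-- Vandermonde product `∏_{i < j} (x_i - x_j)`. -/
def vandermonde {N : ℕ} (x : Fin N → ℝ) : ℝ := ∏ i, ∏ j ∈ Finset.Ioi i, (x i - x j)

/-- The unnormalized z-measure of level `N`. -/
def zWeight (z z' : ℂ) (a b : ℝ) (N : ℕ) (lam : Signature N) : ℝ :=
  vandermonde (fun i => hat a b (shifted lam i)) ^ 2 *
    ∏ i, weight z z' a b N (shifted lam i)

/-- The z-measure of level `N`: the normalization of `zWeight` by its total mass. -/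
def zMeasure (z z' : ℂ) (a b : ℝ) (N : ℕ) : Measure (Signature N) :=
  Measure.sum fun lam =>
    ENNReal.ofReal (zWeight z z' a b N lam / ∑' mu, zWeight z z' a b N mu) • Measure.dirac lam

/-- Simple finite point configurations on the half-lattice. -/
abbrev Conf (a b : ℝ) : Type := Finset (HalfLattice a b)

/-- The map `λ ↦ {l̂₁ > … > l̂_N}`. -/
def configO (a b : ℝ) {N : ℕ} (lam : Signature N) : Conf a b :=
  (Set.finite_range fun i => pt a b (shifted lam i)).toFinset

/-- The point process `O^(N)` on the half-lattice, as a law on configurations. -/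
def processO (z z' : ℂ) (a b : ℝ) (N : ℕ) : Measure (Conf a b) :=
  (zMeasure z z' a b N).map (configO a b)

/-! ### Orthogonal polynomial ensembles and correlation kernels on the half-lattice
Points of the half-lattice are referred to by their labels. -/

/-- `μ` is the `N`-point orthogonal polynomial ensemble with weight `W`: a configuration almost
surely has `N` points, and each set of `N` distinct points has probability
`const · |Δ_N|² · ∏ W`. -/
def IsOrthPolyEnsemble (a b : ℝ) (N : ℕ) (W : ℕ → ℝ) (μ : Measure (Conf a b)) : Prop :=
  (∀ᵐ X ∂μ, X.card = N) ∧
  ∃ c : ℝ, 0 < c ∧ ∀ x : Fin N → ℕ, Function.Injective x →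
    μ.real {X | (X : Set (HalfLattice a b)) = Set.range fun i => pt a b (x i)} =
      c * |vandermonde fun i => hat a b (x i)| ^ 2 * ∏ i, W (x i)

/-- `K` is a correlation kernel of `μ`: for all `m` and all distinct points `x̂₁, …, x̂_m`, the
probability that a configuration contains them all is `det [K(x̂_i, x̂_j)]`. -/
def IsCorrelationKernel (a b : ℝ) (K : ℕ → ℕ → ℂ) (μ : Measure (Conf a b)) : Prop :=
  ∀ (m : ℕ) (x : Fin m → ℕ), Function.Injective x →
    ((μ.real {X | ∀ i, pt a b (x i) ∈ X} : ℝ) : ℂ) =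
      Matrix.det (Matrix.of fun i j : Fin m => K (x i) (x j))

/-! ### Hypergeometric polynomials -/

/-- The Pochhammer symbol `(c)_n = c (c + 1) ⋯ (c + n - 1)`. -/
def poch (c : ℂ) (n : ℕ) : ℂ := (ascPochhammer ℂ n).eval c

lemma poch_succ (c : ℂ) (n : ℕ) : poch c (n + 1) = poch c n * (c + n) :=
  ascPochhammer_succ_eval n c

/-- Off the poles, the Pochhammer symbol is the quotient `Γ(c + n) / Γ(c)`. -/
lemma poch_eq_Gamma_div (c : ℂ) (n : ℕ) (hc : ∀ m : ℕ, c ≠ -m) :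
    poch c n = Complex.Gamma (c + n) / Complex.Gamma c := by
  have h0 : Complex.Gamma c ≠ 0 := Complex.Gamma_ne_zero hc
  rw [eq_div_iff h0]
  induction n with
  | zero => simp [poch]
  | succ n ih =>
    have hn : c + n ≠ 0 := fun h => hc n (eq_neg_of_add_eq_zero_left h)
    have e : c + ((n + 1 : ℕ) : ℂ) = (c + n) + 1 := by push_cast; ring
    rw [e, Complex.Gamma_add_one _ hn, ← ih, poch_succ]
    ring

/-- The value at `u` of the series `₄F₃(a₁, a₂, a₃, a₄; b₁, b₂, b₃; u)`. -/
def hyp4F3 (a₁ a₂ a₃ a₄ b₁ b₂ b₃ u : ℂ) : ℂ :=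
  ∑' k : ℕ, poch a₁ k * poch a₂ k * poch a₃ k * poch a₄ k /
    (poch b₁ k * poch b₂ k * poch b₃ k) * (u ^ k / (k.factorial : ℂ))

lemma poch_neg_nat {n k : ℕ} (h : n < k) : poch (-(n : ℂ)) k = 0 :=
  ascPochhammer_eval_neg_coe_nat_of_lt h

lemma hyp4F3_terminating (n : ℕ) (a₂ a₃ a₄ b₁ b₂ b₃ : ℂ) :
    hyp4F3 (-(n : ℂ)) a₂ a₃ a₄ b₁ b₂ b₃ 1 =
      ∑ k ∈ Finset.range (n + 1), poch (-(n : ℂ)) k * poch a₂ k * poch a₃ k * poch a₄ k /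
        (poch b₁ k * poch b₂ k * poch b₃ k) * (1 ^ k / (k.factorial : ℂ)) := by
  unfold hyp4F3
  refine tsum_eq_sum fun k hk => ?_
  have : n < k := by simpa [Nat.lt_succ_iff] using hk
  simp [poch_neg_nat this]

/-- The polynomial `∏_{j < k} ((j + ε)² - u)` in `u`; its value at `u = x̂` is
`(x + 2ε)_k (-x)_k`. -/
def latticePoly (a b : ℝ) (k : ℕ) : ℂ[X] :=
  ∏ j ∈ Finset.range k, (C (((j : ℂ) + (eps a b : ℂ)) ^ 2) - X)

lemma latticePoly_eval (a b : ℝ) (k : ℕ) (x : ℂ) :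
    (latticePoly a b k).eval ((x + (eps a b : ℂ)) ^ 2) =
      poch (x + 2 * (eps a b : ℂ)) k * poch (-x) k := by
  induction k with
  | zero => simp [latticePoly, poch]
  | succ k ih =>
    rw [poch_succ, poch_succ, latticePoly, Finset.prod_range_succ, ← latticePoly, eval_mul, ih]
    simp only [eval_sub, eval_C, eval_X]
    ring

/-- The monic Wilson–Neretin polynomial `𝔭_n`, as a polynomial in the variable `x̂`; see
`neretin_eval`. The prefactor is
`Γ[1+a+n, 1-z-N+n, 1-z'-N+n, n+1-2N-Σ] / Γ[1+a, 1-z-N, 1-z'-N, 2n+1-2N-Σ]`,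
each quotient of Gamma values being understood as a Pochhammer symbol. -/
def neretin (z z' : ℂ) (a b : ℝ) (N n : ℕ) : ℂ[X] :=
  C (poch (1 + a) n * poch (1 - z - N) n * poch (1 - z' - N) n /
      poch (n + 1 - 2 * N - sig z z' b) n) *
  ∑ k ∈ Finset.range (n + 1),
    C (poch (-(n : ℂ)) k * poch (n + 1 - 2 * N - sig z z' b) k /
        (poch (1 + a) k * poch (1 - z - N) k * poch (1 - z' - N) k * (k.factorial : ℂ))) *
      latticePoly a b k

/-- `𝔭_n(x̂)` is the stated multiple of a terminating `₄F₃(1)`. -/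
lemma neretin_eval (z z' : ℂ) (a b : ℝ) (N n : ℕ) (x : ℂ) :
    (neretin z z' a b N n).eval ((x + (eps a b : ℂ)) ^ 2) =
      poch (1 + a) n * poch (1 - z - N) n * poch (1 - z' - N) n /
        poch (n + 1 - 2 * N - sig z z' b) n *
      hyp4F3 (-(n : ℂ)) (n + 1 - 2 * N - sig z z' b) (x + 2 * (eps a b : ℂ)) (-x)
        (1 + a) (1 - z - N) (1 - z' - N) 1 := by
  rw [hyp4F3_terminating, neretin, eval_mul, eval_C, eval_finsetSum]
  congr 1
  refine Finset.sum_congr rfl fun k _ => ?_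
  rw [eval_mul, eval_C, latticePoly_eval, one_pow]
  simp only [div_eq_mul_inv, mul_inv]
  ring

/-- The polynomial `𝔭̃_N` in the variable `x̂`: the polynomial whose value at `x̂` is
`Γ[x+1, x+N+2ε] / Γ[x+2ε, x-N+1] · ₄F₃(-N, -N-a, z, z'; Σ+1, x-N+1, -x-N-a-b; 1)` for all
integers `x ≥ N`, see `neretinTilde_eval`. For `x < N` the Gamma quotient vanishes while terms of
the series are singular, and the product is understood by continuity in `x`, that is, as the value
of this polynomial. -/
def neretinTilde (z z' : ℂ) (a b : ℝ) (N : ℕ) : ℂ[X] :=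
  ∑ k ∈ Finset.range (N + 1),
    C (poch (-(N : ℂ)) k * poch (-(N : ℂ) - a) k * poch z k * poch z' k /
        (poch (sig z z' b + 1) k * (k.factorial : ℂ)) * (-1) ^ N) *
      latticePoly a b (N - k)

lemma poch_add (c : ℂ) (m n : ℕ) : poch c (m + n) = poch c m * poch (c + m) n := by
  induction n with
  | zero => simp [poch]
  | succ n ih =>
    rw [← add_assoc, poch_succ, ih, poch_succ]
    push_cast
    ring

lemma poch_reflect (m : ℕ) : ∀ c : ℂ, poch (1 - c - m) m = (-1) ^ m * poch c m := by
  induction m with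
  | zero => simp [poch]
  | succ m ih =>
    intro c
    have h1 : poch (1 - c - ((m + 1 : ℕ) : ℂ)) (m + 1) = (-c - m) * poch (1 - c - m) m := by
      have h := poch_add (1 - c - ((m + 1 : ℕ) : ℂ)) 1 m
      have e1 : poch (1 - c - ((m + 1 : ℕ) : ℂ)) 1 = -c - m := by
        simp [poch]; ring
      have e2 : (1 - c - ((m + 1 : ℕ) : ℂ)) + ((1 : ℕ) : ℂ) = 1 - c - m := by push_cast; ring
      rw [e1, e2] at h
      rw [← h, add_comm 1 m]
    rw [h1, ih, poch_succ]
    ring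

lemma poch_ne_zero (c : ℂ) (n : ℕ) (hc : ∀ m : ℕ, c ≠ -m) : poch c n ≠ 0 := by
  rw [poch_eq_Gamma_div c n hc]
  refine div_ne_zero (Complex.Gamma_ne_zero fun m h => hc (n + m) ?_) (Complex.Gamma_ne_zero hc)
  push_cast
  linear_combination h

lemma ne_neg_of_pos {r : ℝ} (hr : 0 < r) (m : ℕ) : (r : ℂ) ≠ -m := by
  intro h
  have h' : r = -(m : ℝ) := by exact_mod_cast h
  have : (0 : ℝ) ≤ m := Nat.cast_nonneg m
  linarith

/-- `𝔭̃_N(x̂)` is the stated multiple of a terminating `₄F₃(1)` for all integers `x ≥ N`. -/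
lemma neretinTilde_eval (z z' : ℂ) {a b : ℝ} (h : 0 ≤ eps a b) {N x : ℕ} (hN : 1 ≤ N)
    (hx : N ≤ x) :
    (neretinTilde z z' a b N).eval (hat a b x : ℂ) =
      Complex.Gamma (x + 1) * Complex.Gamma (x + N + 2 * (eps a b : ℂ)) /
        (Complex.Gamma (x + 2 * (eps a b : ℂ)) * Complex.Gamma (x - N + 1)) *
      hyp4F3 (-(N : ℂ)) (-(N : ℂ) - a) z z' (sig z z' b + 1) (x - N + 1) (-x - N - a - b) 1 := by
  have hx1 : (1 : ℝ) ≤ x := by exact_mod_cast hN.trans hx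
  have hxN : (N : ℝ) ≤ x := by exact_mod_cast hx
  have hc : ∀ m : ℕ, (x : ℂ) + 2 * (eps a b : ℂ) ≠ -m := by
    have := ne_neg_of_pos (r := x + 2 * eps a b) (by linarith)
    simpa using this
  have hd : ∀ m : ℕ, (x : ℂ) - N + 1 ≠ -m := by
    have := ne_neg_of_pos (r := x - N + 1) (by linarith)
    simpa using this
  have hG : Complex.Gamma (x + 1) * Complex.Gamma (x + N + 2 * (eps a b : ℂ)) /
        (Complex.Gamma (x + 2 * (eps a b : ℂ)) * Complex.Gamma (x - N + 1)) =
      poch (x + 2 * (eps a b : ℂ)) N * poch (x - N + 1) N := by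
    rw [poch_eq_Gamma_div _ _ hc, poch_eq_Gamma_div _ _ hd, div_mul_div_comm]
    congr 1
    rw [mul_comm]
    congr 2 <;> ring
  have hhat : (hat a b x : ℂ) = ((x : ℂ) + (eps a b : ℂ)) ^ 2 := by simp [hat]
  rw [hG, hyp4F3_terminating, neretinTilde, eval_finsetSum, Finset.mul_sum]
  refine Finset.sum_congr rfl fun k hk => ?_
  obtain ⟨m, rfl⟩ : ∃ m, N = k + m := Nat.exists_eq_add_of_le (by simpa [Nat.lt_succ_iff] using hk)
  have e0 : k + m - k = m := by omega
  rw [eval_mul, eval_C, hhat, latticePoly_eval, one_pow, e0]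
  have e1 : poch ((x : ℂ) + 2 * (eps a b : ℂ)) (k + m) =
      poch ((x : ℂ) + 2 * (eps a b : ℂ)) m * poch ((x : ℂ) + 2 * (eps a b : ℂ) + m) k := by
    rw [add_comm k m, poch_add]
  have e2 := poch_add ((x : ℂ) - ((k + m : ℕ) : ℂ) + 1) k m
  have e3 : poch (-(x : ℂ) - ((k + m : ℕ) : ℂ) - a - b) k =
      (-1) ^ k * poch ((x : ℂ) + 2 * (eps a b : ℂ) + m) k := by
    rw [← poch_reflect]
    congr 1
    simp only [eps]
    push_cast
    ring
  have e4 : poch (-(x : ℂ)) m =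
      (-1) ^ m * poch ((x : ℂ) - ((k + m : ℕ) : ℂ) + 1 + k) m := by
    rw [← poch_reflect]
    congr 1
    push_cast
    ring
  have n1 : poch ((x : ℂ) - ((k + m : ℕ) : ℂ) + 1) k ≠ 0 := poch_ne_zero _ _ hd
  have n2 : poch ((x : ℂ) + 2 * (eps a b : ℂ) + m) k ≠ 0 := by
    refine poch_ne_zero _ _ fun j hj => hc (m + j) ?_
    push_cast
    linear_combination hj
  have s1 : ((-1 : ℂ) ^ k) * (-1) ^ k = 1 := by rw [← mul_pow]; simp
  have s2 : ((-1 : ℂ) ^ m) * (-1) ^ m = 1 := by rw [← mul_pow]; simp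
  have s3 : ((-1 : ℂ) ^ k)⁻¹ = (-1) ^ k := inv_eq_of_mul_eq_one_right s1
  rw [e1, e2, e3, e4, pow_add]
  simp only [div_eq_mul_inv, mul_inv, s3]
  field_simp
  linear_combination (poch (-((k + m : ℕ) : ℂ)) k * poch (-((k + m : ℕ) : ℂ) - a) k * poch z k *
    poch z' k * poch ((x : ℂ) + 2 * (eps a b : ℂ)) m *
    poch ((x : ℂ) - ((k + m : ℕ) : ℂ) + 1 + k) m * (poch (sig z z' b + 1) k)⁻¹ *
    (k.factorial : ℂ)⁻¹) * s2

/-- The formula for the norm `h_{N-1}`. -/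
def normTop (z z' : ℂ) (a b : ℝ) (N : ℕ) : ℂ :=
  1 / 2 * (Complex.Gamma (N + a) * Complex.Gamma N * Complex.Gamma (sig z z' b + 1) *
      Complex.Gamma (sig z z' b + 2)) /
    (Complex.Gamma (N + sig z z' b + a + 1) * Complex.Gamma (N + sig z z' b + 1) *
      Complex.Gamma (1 + z) * Complex.Gamma (1 + z') *
      Complex.Gamma (1 + z + b) * Complex.Gamma (1 + z' + b))

/-- `p` is the monic orthogonal polynomial of degree `n` for the weight `W` on the half-lattice:
it is orthogonal to all polynomials of lower degree, with absolutely convergent pairings. -/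
def IsMonicOrthPoly (a b : ℝ) (W : ℕ → ℝ) (n : ℕ) (p : ℂ[X]) : Prop :=
  p.Monic ∧ p.natDegree = n ∧
  ∀ q : ℂ[X], q.degree < n →
    HasSum (fun x : ℕ => p.eval (hat a b x : ℂ) * q.eval (hat a b x : ℂ) * (W x : ℂ)) 0

/-- `(p(u) q(v) - q(u) p(v)) / (u - v)`, with its limit value for `u = v`. -/
def cdQuotient (p q : ℂ[X]) (u v : ℂ) : ℂ :=
  if u = v then p.derivative.eval u * q.eval u - q.derivative.eval u * p.eval u
  else (p.eval u * q.eval v - q.eval u * p.eval v) / (u - v)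

/-- `√(W(x̂) W(ŷ)) / h_{N-1} · (p(x̂) 𝔭_{N-1}(ŷ) - 𝔭_{N-1}(x̂) p(ŷ)) / (x̂ - ŷ)`. -/
def cdKernel (z z' : ℂ) (a b : ℝ) (N : ℕ) (p : ℂ[X]) (x y : ℕ) : ℂ :=
  (Real.sqrt (weight z z' a b N x * weight z z' a b N y) : ℂ) / normTop z z' a b N *
    cdQuotient p (neretin z z' a b N (N - 1)) (hat a b x : ℂ) (hat a b y : ℂ)

end

end ZMeas

namespace ZMeas

open Filter Asymptotics Topology

/-! ### Growth of Gamma values along the integers -/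

/-! Everything rests on one summation. With A = 2ε, B = a + 1, P = z + N, Q = z' + N the weight is
the summand `wpTerm` of a very well-poised series, and Dougall's theorem `wpTerm_hasSum` sums it in
closed form as soon as s = A - 1 - B + P + Q = Σ + 2N - 1 has positive real part. The polynomials
φ_k(x̂) = (x + A)_k (-x)_k (`latticePoly`) and ψ_j(x̂) = (x + 1 - Q)_j (1 - Q - A - x)_j
(`dualPoly`) are absorbed by the weight: multiplying by them only shifts A, B, P, Q. All pairings
⟨φ_k, ψ_j⟩ are therefore explicit (`latticePoly_pairing`).

Expand 𝔭_n in the φ_k. Its coefficients cancel the Pochhammer symbols of the pairings, and for j < n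
the pairing ⟨𝔭_n, ψ_j⟩ becomes a multiple of the sum of (-n)_k / k! · R(k) with a polynomial R of
degree less than n, that is, an n-th finite difference, which vanishes. For j = n the factor R(k)
acquires a simple pole and the sum gives the squared norm. The same mechanism makes 𝔭̃_N orthogonal
to ψ_j for j ≤ N - 2, and there Σ > -1 is the only restriction.

On the probabilistic side, admissibility gives W ≥ 0, with W > 0 at the first N points, so the N × N
moment matrix M is invertible. The kernel √(W(x̂)W(ŷ)) · ∑ x̂^i (M⁻¹)_{ij} ŷ^j (`reproKernel`) is a
projection kernel of rank N, and its N × N determinants are proportional to the squared Vandermonde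
product times the weights. Summing out one point at a time shows that it is a correlation kernel
(`isCorrelationKernel_of_projection`).

The two sides meet in the Christoffel–Darboux quotient. Its numerator is antisymmetric, so adding a
multiple of 𝔭_{N-1} to the polynomial of degree N changes nothing; orthogonality of that polynomial
to degrees below N - 1 is enough (`cdQuotient_reproducing`). This needs only moments up to order 2N
- 2, which exist for Σ > -1, whereas ⟨𝔭_N, 𝔭_{N-1}⟩ need not converge when Σ ≤ 0. Both 𝔭_N (for Σ ≠
0) and 𝔭̃_N qualify, so both give `reproKernel`; it is real because M is. -/

lemma poch_eq_prod (c : ℂ) (n : ℕ) : poch c n = ∏ j ∈ Finset.range n, (c + j) := by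
  induction n with
  | zero => simp [poch]
  | succ n ih => rw [poch_succ, ih, Finset.prod_range_succ]

/-- No pole has to be excluded: Γ takes the value 0 at its poles, so its inverse is the entire
function 1/Γ, for which the recurrence holds everywhere. -/
lemma inv_Gamma_eq_poch_mul (c : ℂ) (n : ℕ) :
    (Complex.Gamma c)⁻¹ = poch c n * (Complex.Gamma (c + n))⁻¹ := by
  induction n with
  | zero => simp [poch]
  | succ n ih =>
    rw [ih, poch_succ, Complex.one_div_Gamma_eq_self_mul_one_div_Gamma_add_one (c + n)]
    push_cast
    ring_nf

lemma inv_Gamma_sub_nat (c : ℂ) (n : ℕ) :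
    (Complex.Gamma (c - n))⁻¹ = (-1) ^ n * poch (1 - c) n * (Complex.Gamma c)⁻¹ := by
  have h := poch_reflect n (1 - c)
  rw [inv_Gamma_eq_poch_mul (c - n) n, ← h]
  ring_nf

/-- Euler's limit formula for Γ(c), read as an asymptotic for Γ(n + c) = (c)_n Γ(c). -/
lemma Gamma_add_nat_tendsto (c : ℂ) (hc : ∀ m : ℕ, c ≠ -m) :
    Tendsto (fun n : ℕ => Complex.Gamma (n + c) * (n : ℂ) ^ (1 - c) / (n.factorial : ℂ))
      atTop (𝓝 1) := by
  have hG : Complex.Gamma c ≠ 0 := Complex.Gamma_ne_zero hc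
  have h1 : Tendsto (fun n : ℕ => Complex.Gamma c * ((1 + c / n)⁻¹ * (Complex.GammaSeq c n)⁻¹))
      atTop (𝓝 1) := by
    have h2 : Tendsto (fun n : ℕ => (1 + c / (n : ℂ))⁻¹) atTop (𝓝 1) := by
      have : Tendsto (fun n : ℕ => 1 + c / (n : ℂ)) atTop (𝓝 (1 + 0)) :=
        tendsto_const_nhds.add (tendsto_const_div_atTop_nhds_zero_nat c)
      simpa using this.inv₀ (by simp)
    have := (h2.mul ((Complex.GammaSeq_tendsto_Gamma c).inv₀ hG)).const_mul (Complex.Gamma c)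
    simpa [hG] using this
  refine h1.congr' ?_
  filter_upwards [eventually_ne_atTop 0] with n hn
  have hn' : (n : ℂ) ≠ 0 := Nat.cast_ne_zero.2 hn
  have hcn : c + n ≠ 0 := fun h => hc n (eq_neg_of_add_eq_zero_left h)
  have hp := poch_eq_Gamma_div c n hc
  have hp0 := poch_ne_zero c n hc
  have hf : (n.factorial : ℂ) ≠ 0 := Nat.cast_ne_zero.2 n.factorial_ne_zero
  have hpow : (n : ℂ) ^ c ≠ 0 := by simp [Complex.cpow_eq_zero_iff, hn']
  rw [Complex.GammaSeq, ← poch_eq_prod, poch_succ, add_comm (n : ℂ) c,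
    Complex.cpow_sub _ _ hn', Complex.cpow_one]
  rw [eq_div_iff hG] at hp
  rw [← hp]
  have h3 : (1 + c / (n : ℂ)) = (c + n) / n := by field_simp; ring
  rw [h3]
  field_simp


lemma Gamma_add_nat_isBigO (c : ℂ) (hc : ∀ m : ℕ, c ≠ -m) :
    (fun n : ℕ => Complex.Gamma (n + c)) =O[atTop]
      fun n : ℕ => (n.factorial : ℝ) * (n : ℝ) ^ (c.re - 1) := by
  have h := ((Gamma_add_nat_tendsto c hc).isBigO_one ℝ).norm_left
  have h2 := h.mul (isBigO_refl (fun n : ℕ => (n.factorial : ℝ) * (n : ℝ) ^ (c.re - 1)) atTop)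
  simp only [one_mul] at h2
  refine IsBigO.of_norm_left (EventuallyEq.trans_isBigO ?_ h2)
  filter_upwards [eventually_gt_atTop 0] with n hn
  have hn' : (0 : ℝ) < n := Nat.cast_pos.2 hn
  have hf : (0 : ℝ) < n.factorial := Nat.cast_pos.2 n.factorial_pos
  rw [norm_div, norm_mul, Complex.norm_natCast_cpow_of_pos hn, Complex.norm_natCast]
  have : (n : ℝ) ^ (1 - c.re) * (n : ℝ) ^ (c.re - 1) = 1 := by
    rw [← Real.rpow_add hn']; simp
  simp only [Complex.sub_re, Complex.one_re]
  field_simp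
  rw [mul_assoc, this, mul_one]

lemma natCast_add_isBigO (c : ℂ) : (fun n : ℕ => (n : ℂ) + c) =O[atTop] fun n : ℕ => (n : ℝ) := by
  refine IsBigO.add (isBigO_of_le _ fun n => by simp) ?_
  refine IsBigO.of_bound ‖c‖ ?_
  filter_upwards [eventually_ge_atTop 1] with n hn
  have : (1 : ℝ) ≤ n := by exact_mod_cast hn
  rw [Real.norm_of_nonneg (by positivity)]
  exact le_mul_of_one_le_right (norm_nonneg c) this

lemma inv_Gamma_add_nat_isBigO_of_re_pos (c : ℂ) (hc : 0 < c.re) :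
    (fun n : ℕ => (Complex.Gamma (n + c))⁻¹) =O[atTop]
      fun n : ℕ => (n : ℝ) ^ (1 - c.re) / (n.factorial : ℝ) := by
  have hc' : ∀ m : ℕ, c ≠ -m := fun m h => by
    have := congrArg Complex.re h
    have h0 : (0 : ℝ) ≤ m := m.cast_nonneg
    simp only [Complex.neg_re, Complex.natCast_re] at this
    linarith
  have h := (((Gamma_add_nat_tendsto c hc').inv₀ one_ne_zero).isBigO_one ℝ).norm_left
  have h2 := h.mul (isBigO_refl (fun n : ℕ => (n : ℝ) ^ (1 - c.re) / (n.factorial : ℝ)) atTop)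
  simp only [one_mul] at h2
  refine IsBigO.of_norm_left (EventuallyEq.trans_isBigO ?_ h2)
  filter_upwards [eventually_gt_atTop 0] with n hn
  have hn' : (0 : ℝ) < n := Nat.cast_pos.2 hn
  have hf : (0 : ℝ) < n.factorial := Nat.cast_pos.2 n.factorial_pos
  have hp : (0 : ℝ) < (n : ℝ) ^ (1 - c.re) := Real.rpow_pos_of_pos hn' _
  have hG : ‖Complex.Gamma (n + c)‖ ≠ 0 := by
    refine norm_ne_zero_iff.2 (Complex.Gamma_ne_zero_of_re_pos ?_)
    simp only [Complex.add_re, Complex.natCast_re]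
    linarith
  rw [norm_inv, norm_inv, norm_div, norm_mul, Complex.norm_natCast_cpow_of_pos hn,
    Complex.norm_natCast]
  simp only [Complex.sub_re, Complex.one_re]
  field_simp

/-- The recurrence moves c to the right until its real part is positive; each step costs a factor n
+ c, which matches the change of exponent. -/
lemma inv_Gamma_add_nat_isBigO (c : ℂ) :
    (fun n : ℕ => (Complex.Gamma (n + c))⁻¹) =O[atTop]
      fun n : ℕ => (n : ℝ) ^ (1 - c.re) / (n.factorial : ℝ) := by
  obtain ⟨k, hk⟩ := exists_nat_gt (-c.re)
  induction k generalizing c with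
  | zero => exact inv_Gamma_add_nat_isBigO_of_re_pos c (by simpa using hk)
  | succ k ih =>
    have h := (natCast_add_isBigO c).mul (ih (c + 1) (by
      push_cast at hk
      simp only [Complex.add_re, Complex.one_re]
      linarith))
    refine (h.congr_left fun n => ?_).trans (EventuallyEq.isBigO ?_)
    · rw [Complex.one_div_Gamma_eq_self_mul_one_div_Gamma_add_one (n + c), add_assoc]
    · filter_upwards [eventually_gt_atTop 0] with n hn
      have hn' : (0 : ℝ) < n := Nat.cast_pos.2 hn
      have : (n : ℝ) ^ (1 - c.re) = n * (n : ℝ) ^ (1 - (c + 1).re) := by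
        nth_rewrite 2 [← Real.rpow_one (n : ℝ)]
        rw [← Real.rpow_add hn']
        simp only [Complex.add_re, Complex.one_re]
        ring_nf
      rw [this]
      ring

/-- By reflection the left side is, up to a sign, a constant times (1 - c)_n. This is eventually
zero when c is a positive integer and grows like Γ(n + 1 - c) otherwise. -/
lemma inv_Gamma_sub_nat_isBigO (c : ℂ) :
    (fun n : ℕ => (Complex.Gamma (c - n))⁻¹) =O[atTop]
      fun n : ℕ => (n.factorial : ℝ) * (n : ℝ) ^ (-c.re) := by
  by_cases hc : ∃ m : ℕ, 1 - c = -m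
  · obtain ⟨m, hm⟩ := hc
    refine EventuallyEq.trans_isBigO ?_ (isBigO_zero _ _)
    filter_upwards [eventually_gt_atTop m] with n hn
    rw [inv_Gamma_sub_nat, hm, poch_neg_nat hn]
    simp
  · push Not at hc
    have h := (Gamma_add_nat_isBigO (1 - c) hc).const_mul_left
      ((Complex.Gamma (1 - c))⁻¹ * (Complex.Gamma c)⁻¹)
    have e : (1 - c).re - 1 = -c.re := by simp
    rw [e] at h
    refine IsBigO.of_norm_left (h.norm_left.congr_left fun n => ?_)
    rw [inv_Gamma_sub_nat, poch_eq_Gamma_div _ _ hc]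
    simp only [norm_mul, norm_inv, norm_div, norm_pow, norm_neg, norm_one, one_pow]
    rw [add_comm (n : ℂ)]
    ring

end ZMeas

namespace ZMeas

open Filter Asymptotics Topology

/-! ### The very well-poised series `₅F₄(1)` -/

/-- The factor `(x + A / 2) Γ(x + A)`, continued to `x = A = 0`. -/
noncomputable def wpLead (A : ℝ) (x : ℕ) : ℝ :=
  if x = 0 then Real.Gamma (A + 1) / 2 else ((x : ℝ) + A / 2) * Real.Gamma (x + A)

/-- The real part of the summand `wpTerm`. -/
noncomputable def wpCore (A B : ℝ) (x : ℕ) : ℝ :=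
  wpLead A x * Real.Gamma (x + B) / (Real.Gamma (x + 1) * Real.Gamma (x + 1 + A - B))

/-- The summand of a very well-poised `₅F₄(1)` with parameters `A, B, 1 - P, 1 - Q`. -/
noncomputable def wpTerm (A B : ℝ) (P Q : ℂ) (x : ℕ) : ℂ :=
  (wpCore A B x : ℂ) * (Complex.Gamma (P - x) * Complex.Gamma (Q - x) *
    Complex.Gamma (P + A + x) * Complex.Gamma (Q + A + x))⁻¹

/-- The value of Dougall's `₅F₄` sum with summand `wpTerm`. -/
noncomputable def wpSum (A B : ℝ) (P Q : ℂ) : ℂ :=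
  1 / 2 * Complex.Gamma B * Complex.Gamma (A - 1 - B + P + Q) *
    (Complex.Gamma P * Complex.Gamma Q * Complex.Gamma (A - B + P) *
      Complex.Gamma (A - B + Q) * Complex.Gamma (A - 1 + P + Q))⁻¹

lemma wpTerm_comm (A B : ℝ) (P Q : ℂ) (x : ℕ) : wpTerm A B P Q x = wpTerm A B Q P x := by
  unfold wpTerm
  ring_nf

lemma wpSum_comm (A B : ℝ) (P Q : ℂ) : wpSum A B P Q = wpSum A B Q P := by
  unfold wpSum
  ring_nf

lemma wpLead_nonneg {A : ℝ} (hA : 0 ≤ A) (x : ℕ) : 0 ≤ wpLead A x := by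
  unfold wpLead
  split_ifs
  · have := Real.Gamma_pos_of_pos (show 0 < A + 1 by linarith)
    positivity
  · exact mul_nonneg (by positivity) (Real.Gamma_nonneg_of_nonneg (by positivity))

lemma wpLead_mul {A : ℝ} (hA : 0 ≤ A) (x : ℕ) :
    wpLead A x * (x + A) = (x + A / 2) * Real.Gamma (x + A + 1) := by
  unfold wpLead
  split_ifs with hx
  · subst hx
    simp
    ring
  · have hx' : (0 : ℝ) < x := Nat.cast_pos.2 (Nat.pos_of_ne_zero hx)
    rw [Real.Gamma_add_one (by positivity)]
    ring

lemma wpLead_le {A : ℝ} (hA : 0 ≤ A) (x : ℕ) : wpLead A x ≤ Real.Gamma (x + A + 1) := by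
  unfold wpLead
  split_ifs with hx
  · subst hx
    have := Real.Gamma_pos_of_pos (show 0 < A + 1 by linarith)
    simp
    linarith
  · have hx' : (0 : ℝ) < x := Nat.cast_pos.2 (Nat.pos_of_ne_zero hx)
    rw [Real.Gamma_add_one (by positivity)]
    have := Real.Gamma_pos_of_pos (show 0 < (x : ℝ) + A by positivity)
    gcongr
    linarith

lemma Gamma_ratio_le {A : ℝ} (hA : 0 ≤ A) (x : ℕ) :
    Real.Gamma (x + A) / Real.Gamma x ≤ Real.Gamma (x + A + 1) / (x.factorial : ℝ) := by
  rcases Nat.eq_zero_or_pos x with rfl | hx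
  · have := Real.Gamma_pos_of_pos (show 0 < A + 1 by linarith)
    simp
    positivity
  · have hx' : (0 : ℝ) < x := Nat.cast_pos.2 hx
    have h1 := Real.Gamma_pos_of_pos (show 0 < (x : ℝ) + A by positivity)
    have h2 := Real.Gamma_pos_of_pos hx'
    rw [← Real.Gamma_nat_eq_factorial, Real.Gamma_add_one (by positivity),
      Real.Gamma_add_one hx'.ne', div_le_div_iff₀ h2 (by positivity)]
    have : Real.Gamma (x + A) * (x * Real.Gamma x) ≤
      Real.Gamma (x + A) * ((x + A) * Real.Gamma x) := by gcongr; linarith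
    linarith

lemma Gamma_ratio_nonneg {A : ℝ} (hA : 0 ≤ A) (x : ℕ) :
    0 ≤ Real.Gamma (x + A) / Real.Gamma x :=
  div_nonneg (Real.Gamma_nonneg_of_nonneg (by positivity))
    (Real.Gamma_nonneg_of_nonneg (by positivity))

lemma real_Gamma_add_nat_isBigO {c : ℝ} (hc : 0 < c) :
    (fun n : ℕ => Real.Gamma (n + c)) =O[atTop]
      fun n : ℕ => (n.factorial : ℝ) * (n : ℝ) ^ (c - 1) := by
  have h := (Gamma_add_nat_isBigO (c : ℂ) (ne_neg_of_pos hc)).norm_left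
  refine IsBigO.of_norm_left (h.congr_left fun n => ?_)
  rw [← Complex.norm_real, ← Complex.Gamma_ofReal]
  push_cast
  rfl

lemma real_inv_Gamma_add_nat_isBigO (c : ℝ) :
    (fun n : ℕ => (Real.Gamma (n + c))⁻¹) =O[atTop]
      fun n : ℕ => (n : ℝ) ^ (1 - c) / (n.factorial : ℝ) := by
  have h := (inv_Gamma_add_nat_isBigO (c : ℂ)).norm_left
  refine IsBigO.of_norm_left (h.congr_left fun n => ?_)
  rw [← Complex.norm_real, Complex.ofReal_inv, ← Complex.Gamma_ofReal]
  push_cast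
  rfl

lemma wpCore_isBigO {A B : ℝ} (hA : 0 ≤ A) (hB : 0 < B) :
    wpCore A B =O[atTop] fun n : ℕ => (n : ℝ) ^ (2 * B - 1) := by
  have h1 : wpLead A =O[atTop] fun n : ℕ => (n.factorial : ℝ) * (n : ℝ) ^ A := by
    have := real_Gamma_add_nat_isBigO (show 0 < A + 1 by linarith)
    rw [add_sub_cancel_right] at this
    refine IsBigO.trans (isBigO_of_le _ fun n => ?_) this
    rw [Real.norm_of_nonneg (wpLead_nonneg hA n), ← add_assoc]
    exact (wpLead_le hA n).trans (le_abs_self _)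
  have h2 := real_Gamma_add_nat_isBigO hB
  have h3 := real_inv_Gamma_add_nat_isBigO 1
  have h4 := real_inv_Gamma_add_nat_isBigO (1 + A - B)
  refine (((h1.mul h2).mul (h3.mul h4)).congr_left fun n => ?_).trans (EventuallyEq.isBigO ?_)
  · unfold wpCore
    rw [div_eq_mul_inv, mul_inv]
    ring_nf
  · filter_upwards [eventually_gt_atTop 0] with n hn
    have hn' : (0 : ℝ) < n := Nat.cast_pos.2 hn
    have hf : (n.factorial : ℝ) ≠ 0 := Nat.cast_ne_zero.2 n.factorial_ne_zero
    have e : (n : ℝ) ^ (2 * B - 1) =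
        (n : ℝ) ^ A * (n : ℝ) ^ (B - 1) * (n : ℝ) ^ (1 - 1 : ℝ) * (n : ℝ) ^ (1 - (1 + A - B)) := by
      rw [← Real.rpow_add hn', ← Real.rpow_add hn', ← Real.rpow_add hn']
      ring_nf
    rw [e]
    field_simp

/-- The factorial growth of 1/Γ(c - n) cancels the factorial decay of 1/Γ(d + n), leaving a pure
power. -/
lemma inv_Gamma_pair_isBigO (c d : ℂ) :
    (fun n : ℕ => (Complex.Gamma (c - n) * Complex.Gamma (d + n))⁻¹) =O[atTop]
      fun n : ℕ => (n : ℝ) ^ (1 - c.re - d.re) := by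
  refine (((inv_Gamma_sub_nat_isBigO c).mul (inv_Gamma_add_nat_isBigO d)).congr_left
    fun n => ?_).trans (EventuallyEq.isBigO ?_)
  · rw [mul_inv, add_comm d]
  · filter_upwards [eventually_gt_atTop 0] with n hn
    have hn' : (0 : ℝ) < n := Nat.cast_pos.2 hn
    have hf : (n.factorial : ℝ) ≠ 0 := Nat.cast_ne_zero.2 n.factorial_ne_zero
    have e : (n : ℝ) ^ (1 - c.re - d.re) = (n : ℝ) ^ (-c.re) * (n : ℝ) ^ (1 - d.re) := by
      rw [← Real.rpow_add hn']
      ring_nf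
    rw [e]
    field_simp

lemma isBigO_ofReal_left {f : ℕ → ℝ} {g : ℕ → ℝ} (h : f =O[atTop] g) :
    (fun n => (f n : ℂ)) =O[atTop] g :=
  IsBigO.of_norm_left (h.norm_left.congr_left fun _ => (Complex.norm_real _).symm)

/-- Each parameter pair contributes a power of n. The real part of s = A - 1 - B + P + Q governs
convergence from here on: the terms are O(n^(-1-2 Re s)). -/
lemma wpTerm_isBigO {A B : ℝ} (hA : 0 ≤ A) (hB : 0 < B) (P Q : ℂ) :
    wpTerm A B P Q =O[atTop]
      fun n : ℕ => (n : ℝ) ^ (-1 - 2 * (A - 1 - B + P.re + Q.re)) := by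
  refine (((isBigO_ofReal_left (wpCore_isBigO hA hB)).mul
    ((inv_Gamma_pair_isBigO P (P + A)).mul (inv_Gamma_pair_isBigO Q (Q + A)))).congr_left
    fun n => ?_).trans (EventuallyEq.isBigO ?_)
  · unfold wpTerm
    rw [← mul_inv]
    ring_nf
  · filter_upwards [eventually_gt_atTop 0] with n hn
    have hn' : (0 : ℝ) < n := Nat.cast_pos.2 hn
    rw [← Real.rpow_add hn', ← Real.rpow_add hn']
    simp only [Complex.add_re, Complex.ofReal_re]
    ring_nf

lemma wpTerm_summable {A B : ℝ} (hA : 0 ≤ A) (hB : 0 < B) {P Q : ℂ}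
    (hs : 0 < A - 1 - B + P.re + Q.re) : Summable (wpTerm A B P Q) :=
  summable_of_isBigO_nat (Real.summable_nat_rpow.2 (by linarith)) (wpTerm_isBigO hA hB P Q)

/-- The telescoping certificate for the contiguous relation `wpTerm_contiguous`. -/
noncomputable def wpCert (A B : ℝ) (P Q : ℂ) (x : ℕ) : ℂ :=
  -(1 / 2) * ((Real.Gamma (x + A) / Real.Gamma x * Real.Gamma (x + B) *
      (Real.Gamma (x + (A - B)))⁻¹ : ℝ) : ℂ) *
    ((Complex.Gamma (P - x) * Complex.Gamma (P + A - 1 + x))⁻¹ *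
      (Complex.Gamma (Q + 1 - x) * Complex.Gamma (Q + A + x))⁻¹)

/-- The factor 1/Γ(x) vanishes at x = 0, so the telescoping has no lower boundary term. -/
lemma wpCert_zero (A B : ℝ) (P Q : ℂ) : wpCert A B P Q 0 = 0 := by
  simp [wpCert, Real.Gamma_zero]

lemma wpCert_tendsto {A B : ℝ} (hA : 0 ≤ A) (hB : 0 < B) {P Q : ℂ}
    (hs : 0 < A - 1 - B + P.re + Q.re) : Tendsto (wpCert A B P Q) atTop (𝓝 0) := by
  have h1 : (fun n : ℕ => Real.Gamma (n + A) / Real.Gamma n) =O[atTop]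
      fun n : ℕ => (n : ℝ) ^ A := by
    have := (real_Gamma_add_nat_isBigO (show 0 < A + 1 by linarith)).mul
      (isBigO_refl (fun n : ℕ => (n.factorial : ℝ)⁻¹) atTop)
    rw [add_sub_cancel_right] at this
    refine IsBigO.trans (isBigO_of_le _ fun n => ?_) (this.trans (EventuallyEq.isBigO ?_))
    · rw [Real.norm_of_nonneg (Gamma_ratio_nonneg hA n), ← add_assoc]
      exact (Gamma_ratio_le hA n).trans (le_abs_self _)
    · refine .of_forall fun n => ?_
      have hf : (n.factorial : ℝ) ≠ 0 := Nat.cast_ne_zero.2 n.factorial_ne_zero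
      field_simp
  have h2 := (h1.mul (real_Gamma_add_nat_isBigO hB)).mul
    (real_inv_Gamma_add_nat_isBigO (A - B))
  have h3 := (isBigO_ofReal_left h2).mul
    ((inv_Gamma_pair_isBigO P (P + A - 1)).mul (inv_Gamma_pair_isBigO (Q + 1) (Q + A)))
  have h4 : wpCert A B P Q =O[atTop]
      fun n : ℕ => (n : ℝ) ^ (-(2 * (A - 1 - B + P.re + Q.re))) := by
    refine ((h3.const_mul_left (-(1 / 2))).congr_left fun n => ?_).trans (EventuallyEq.isBigO ?_)
    · exact (mul_assoc _ _ _).symm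
    · filter_upwards [eventually_gt_atTop 0] with n hn
      have hn' : (0 : ℝ) < n := Nat.cast_pos.2 hn
      have hf : (n.factorial : ℝ) ≠ 0 := Nat.cast_ne_zero.2 n.factorial_ne_zero
      have e : (n : ℝ) ^ (-(2 * (A - 1 - B + P.re + Q.re))) = (n : ℝ) ^ A * (n : ℝ) ^ (B - 1) *
          (n : ℝ) ^ (1 - (A - B)) * (n : ℝ) ^ (1 - P.re - (P + A - 1).re) *
            (n : ℝ) ^ (1 - (Q + 1).re - (Q + A).re) := by
        rw [← Real.rpow_add hn', ← Real.rpow_add hn', ← Real.rpow_add hn', ← Real.rpow_add hn']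
        simp only [Complex.add_re, Complex.sub_re, Complex.one_re, Complex.ofReal_re]
        ring_nf
      rw [e]
      field_simp
  exact h4.trans_tendsto
    ((tendsto_rpow_neg_atTop (by linarith)).comp tendsto_natCast_atTop_atTop)

lemma inv_Gamma_step (s t : ℂ) (h : t = s + 1) :
    (Complex.Gamma s)⁻¹ = s * (Complex.Gamma t)⁻¹ := by
  rw [h, Complex.one_div_Gamma_eq_self_mul_one_div_Gamma_add_one]

lemma real_inv_Gamma_step (s t : ℝ) (h : t = s + 1) :
    (Real.Gamma s)⁻¹ = s * (Real.Gamma t)⁻¹ := by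
  have := inv_Gamma_step (s : ℂ) (t : ℂ) (by rw [h]; push_cast; rfl)
  rw [Complex.Gamma_ofReal, Complex.Gamma_ofReal] at this
  exact_mod_cast this

/-- After every Gamma value is rewritten through the same few values by its recurrence, this is an
identity of polynomials in x and the parameters. -/
lemma wpTerm_contiguous {A B : ℝ} (hA : 0 ≤ A) (hB : 0 < B) (P Q : ℂ) (x : ℕ) :
    Q * (A - B + Q) * (A - 1 + P + Q) * wpTerm A B P (Q + 1) x -
      (A - 1 - B + P + Q) * wpTerm A B P Q x = wpCert A B P Q (x + 1) - wpCert A B P Q x := by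
  have hf : (x.factorial : ℂ) ≠ 0 := Nat.cast_ne_zero.2 x.factorial_ne_zero
  set γ : ℝ := Real.Gamma (x + A + 1) / x.factorial with hγ
  set μ : ℝ := Real.Gamma (x + A) / Real.Gamma x with hμ
  set lam : ℝ := wpLead A x / x.factorial with hlam
  set β : ℝ := Real.Gamma (x + B)
  set δ : ℝ := (Real.Gamma (x + 1 + A - B))⁻¹
  set p := (Complex.Gamma (P - x))⁻¹ with hp
  set q := (Complex.Gamma (Q + 1 - x))⁻¹ with hq
  set p' := (Complex.Gamma (P + A + x))⁻¹ with hp'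
  set q' := (Complex.Gamma (Q + 1 + A + x))⁻¹ with hq'
  have e1 : wpTerm A B P (Q + 1) x = lam * β * δ * (p * q * p' * q') := by
    simp only [wpTerm, wpCore, Real.Gamma_nat_eq_factorial, hlam, β, δ, p, q, p', q']
    push_cast
    simp only [mul_inv, div_eq_mul_inv]
    ring
  have e2 : wpTerm A B P Q x =
      lam * β * δ * (p * ((Q - x) * q) * p' * ((Q + A + x) * q')) := by
    rw [hq, hq', ← inv_Gamma_step (Q - x) (Q + 1 - x) (by ring),
      ← inv_Gamma_step (Q + A + x) (Q + 1 + A + x) (by ring)]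
    simp only [wpTerm, wpCore, Real.Gamma_nat_eq_factorial, hlam, β, δ, p, p']
    push_cast
    simp only [mul_inv, div_eq_mul_inv]
    ring
  have e3 : wpCert A B P Q x = -(1 / 2) * (μ * β * ((x + (A - B)) * δ)) *
      (p * ((P + A - 1 + x) * p') * (q * ((Q + A + x) * q'))) := by
    rw [hp', hq', ← inv_Gamma_step (P + A - 1 + x) (P + A + x) (by ring),
      ← inv_Gamma_step (Q + A + x) (Q + 1 + A + x) (by ring)]
    simp only [wpCert, hμ, β, δ, p, q]
    rw [real_inv_Gamma_step (x + (A - B)) (x + 1 + A - B) (by ring)]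
    push_cast
    simp only [mul_inv]
  have hβ : Real.Gamma (((x + 1 : ℕ) : ℝ) + B) = (x + B) * β := by
    rw [← Real.Gamma_add_one (by positivity)]
    push_cast
    ring_nf
  have e4 : wpCert A B P Q (x + 1) = -(1 / 2) * (γ * ((x + B) * β) * δ) *
      (((P - x - 1) * p) * p' * (((Q - x) * q) * q')) := by
    rw [hp, hq, ← inv_Gamma_step (Q - x) (Q + 1 - x) (by ring),
      ← inv_Gamma_step (P - x - 1) (P - x) (by ring)]
    have h1 : Real.Gamma (((x + 1 : ℕ) : ℝ) + A) / Real.Gamma ((x + 1 : ℕ) : ℝ) = γ := by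
      rw [hγ, ← Real.Gamma_nat_eq_factorial]
      push_cast
      ring_nf
    have h2 : (Real.Gamma (((x + 1 : ℕ) : ℝ) + (A - B)))⁻¹ = δ := by
      simp only [δ]
      push_cast
      ring_nf
    simp only [wpCert, h1, h2, hβ, p', q']
    push_cast
    simp only [mul_inv]
    ring_nf
  rw [e1, e2, e3, e4]
  have key : (Q * (A - B + Q) * (A - 1 + P + Q) - (A - 1 - B + P + Q) * (Q - x) * (Q + A + x)) *
      lam = -(1 / 2) * (γ * (x + B) * (P - x - 1) * (Q - x) -
        μ * (x + (A - B)) * (P + A - 1 + x) * (Q + A + x)) := by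
    -- At x = A = 0 the relations obtained by multiplying with x + A carry no information, so the
    -- continued value 1/2 of the leading factor is inserted directly.
    by_cases h0 : (x : ℝ) + A = 0
    · have hx0 : (x : ℝ) = 0 := le_antisymm (by linarith) (Nat.cast_nonneg x)
      have hA0 : A = 0 := by linarith
      obtain rfl : x = 0 := by exact_mod_cast hx0
      subst hA0
      simp only [hγ, hμ, hlam, wpLead]
      simp [Real.Gamma_zero]
      ring
    · have h0' : (x : ℂ) + A ≠ 0 := by exact_mod_cast h0
      have hl : (lam : ℂ) * (x + A) = (x + A / 2) * γ := by
        have := wpLead_mul hA x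
        have h2 : lam * (x + A) = (x + A / 2) * γ := by
          rw [hlam, hγ, div_mul_eq_mul_div, this, mul_div_assoc]
        exact_mod_cast h2
      have hm : (μ : ℂ) * (x + A) = x * γ := by
        have h2 : μ * (x + A) = x * γ := by
          rw [hμ, hγ]
          rcases Nat.eq_zero_or_pos x with rfl | hx
          · simp [Real.Gamma_zero]
          · have hx' : (0 : ℝ) < x := Nat.cast_pos.2 hx
            have h2 := Real.Gamma_pos_of_pos hx'
            rw [← Real.Gamma_nat_eq_factorial, Real.Gamma_add_one h0,
              Real.Gamma_add_one hx'.ne']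
            field_simp
        exact_mod_cast h2
      apply mul_right_cancel₀ h0'
      linear_combination (Q * (A - B + Q) * (A - 1 + P + Q) -
        (A - 1 - B + P + Q) * (Q - x) * (Q + A + x)) * hl -
        (1 / 2) * (x + (A - B)) * (P + A - 1 + x) * (Q + A + x) * hm
  linear_combination (β * δ * (p * q * p' * q')) * key

/-- The contiguous relation telescopes: the certificate vanishes at 0 and tends to 0 at infinity
when Re s > 0. -/
lemma wpTerm_tsum_contiguous {A B : ℝ} (hA : 0 ≤ A) (hB : 0 < B) {P Q : ℂ}
    (hs : 0 < A - 1 - B + P.re + Q.re) :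
    Q * (A - B + Q) * (A - 1 + P + Q) * ∑' x, wpTerm A B P (Q + 1) x =
      (A - 1 - B + P + Q) * ∑' x, wpTerm A B P Q x := by
  have h1 := (wpTerm_summable hA hB (P := P) (Q := Q + 1) (by
    simp only [Complex.add_re, Complex.one_re]; linarith)).hasSum.mul_left
      (Q * (A - B + Q) * (A - 1 + P + Q))
  have h2 := (wpTerm_summable hA hB hs).hasSum.mul_left (A - 1 - B + P + Q)
  have h3 := (h1.sub h2).tendsto_sum_nat
  simp only [wpTerm_contiguous hA hB, Finset.sum_range_sub, wpCert_zero, sub_zero] at h3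
  exact sub_eq_zero.1 (tendsto_nhds_unique h3 (wpCert_tendsto hA hB hs))

lemma wpSum_contiguous {A B : ℝ} {P Q : ℂ} (hs : A - 1 - B + P + Q ≠ 0) :
    Q * (A - B + Q) * (A - 1 + P + Q) * wpSum A B P (Q + 1) =
      (A - 1 - B + P + Q) * wpSum A B P Q := by
  unfold wpSum
  simp only [mul_inv]
  rw [inv_Gamma_step Q (Q + 1) rfl, inv_Gamma_step (A - B + Q) (A - B + (Q + 1)) (by ring),
    inv_Gamma_step (A - 1 + P + Q) (A - 1 + P + (Q + 1)) (by ring),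
    ← add_assoc (A - 1 - B + P : ℂ) Q 1, Complex.Gamma_add_one _ hs]
  ring

end ZMeas

namespace ZMeas

open Filter Asymptotics Topology

/-! ### Dougall's summation: the limit in `Q` and the descent in both parameters -/

lemma tendsto_add_nat_div_add_nat (c d : ℂ) :
    Tendsto (fun n : ℕ => (c + n) / (d + n)) atTop (𝓝 1) := by
  have h : ∀ c : ℂ, Tendsto (fun n : ℕ => c / (n : ℂ) + 1) atTop (𝓝 1) := fun c => by
    simpa using (tendsto_const_div_atTop_nhds_zero_nat c).add_const 1
  have h2 := (h c).div (h d) one_ne_zero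
  rw [div_one] at h2
  refine h2.congr' ?_
  filter_upwards [eventually_ne_atTop 0] with n hn
  have hn' : (n : ℂ) ≠ 0 := Nat.cast_ne_zero.2 hn
  rw [Pi.div_apply, div_add_one hn', div_add_one hn', div_div_div_cancel_right₀ hn']

/-- `Γ(Q) Γ(Q + A) / (Γ(Q - x) Γ(Q + A + x))`. -/
noncomputable def gammaQuot (A : ℝ) (Q : ℂ) (x : ℕ) : ℂ :=
  Complex.Gamma Q * Complex.Gamma (Q + A) *
    (Complex.Gamma (Q - x) * Complex.Gamma (Q + A + x))⁻¹

lemma gammaQuot_zero {A : ℝ} (hA : 0 ≤ A) {Q : ℂ} (hQ : 0 < Q.re) : gammaQuot A Q 0 = 1 := by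
  have h1 := Complex.Gamma_ne_zero_of_re_pos hQ
  have h2 : Complex.Gamma (Q + A) ≠ 0 := Complex.Gamma_ne_zero_of_re_pos (by
    simp only [Complex.add_re, Complex.ofReal_re]; linarith)
  simp only [gammaQuot, Nat.cast_zero, sub_zero, add_zero]
  exact mul_inv_cancel₀ (mul_ne_zero h1 h2)

lemma gammaQuot_succ {A : ℝ} (hA : 0 ≤ A) {Q : ℂ} (hQ : 0 < Q.re) (x : ℕ) :
    gammaQuot A Q (x + 1) = gammaQuot A Q x * ((Q - x - 1) / (Q + A + x)) := by
  have h : Q + A + x ≠ 0 := fun h => by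
    have := congrArg Complex.re h
    simp only [Complex.add_re, Complex.ofReal_re, Complex.natCast_re, Complex.zero_re] at this
    have h0 : (0 : ℝ) ≤ x := x.cast_nonneg
    linarith
  unfold gammaQuot
  simp only [mul_inv]
  rw [inv_Gamma_step (Q - (x + 1 : ℕ)) (Q - x) (by push_cast; ring),
    inv_Gamma_step (Q + A + x) (Q + A + (x + 1 : ℕ)) (by push_cast; ring)]
  push_cast
  field_simp
  ring

/-- Consecutive values have ratio (Q - x - 1)/(Q + A + x). Its modulus is at most 1, since the
difference of the squared moduli of denominator and numerator is (2 Re Q - 1 + A)(A + 2x + 1). This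
uniform bound is the domination needed for the limit Q → ∞. -/
lemma norm_gammaQuot_le {A : ℝ} (hA : 0 ≤ A) {Q : ℂ} (hQ : 1 / 2 ≤ Q.re) (x : ℕ) :
    ‖gammaQuot A Q x‖ ≤ 1 := by
  have hQ0 : 0 < Q.re := by linarith
  induction x with
  | zero => simp [gammaQuot_zero hA hQ0]
  | succ x ih =>
    rw [gammaQuot_succ hA hQ0, norm_mul, norm_div]
    have h0 : (0 : ℝ) ≤ x := x.cast_nonneg
    refine mul_le_one₀ ih (by positivity) (div_le_one_of_le₀ ?_ (norm_nonneg _))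
    rw [← sq_le_sq₀ (norm_nonneg _) (norm_nonneg _), Complex.sq_norm, Complex.sq_norm,
      Complex.normSq_apply, Complex.normSq_apply]
    simp only [Complex.sub_re, Complex.add_re, Complex.ofReal_re, Complex.natCast_re,
      Complex.one_re, Complex.sub_im, Complex.add_im, Complex.ofReal_im, Complex.natCast_im,
      Complex.one_im]
    nlinarith [mul_nonneg (show 0 ≤ 2 * Q.re - 1 + A by linarith) (show 0 ≤ A + 2 * x + 1 by linarith)]

lemma gammaQuot_tendsto {A : ℝ} (hA : 0 ≤ A) {Q : ℂ} (hQ : 0 < Q.re) (x : ℕ) :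
    Tendsto (fun M : ℕ => gammaQuot A (Q + M) x) atTop (𝓝 1) := by
  have hQM : ∀ M : ℕ, 0 < (Q + M).re := fun M => by
    simp only [Complex.add_re, Complex.natCast_re]; positivity
  induction x with
  | zero => simp [gammaQuot_zero hA (hQM _)]
  | succ x ih =>
    have h := ih.mul (tendsto_add_nat_div_add_nat (Q - x - 1) (Q + A + x))
    rw [one_mul] at h
    refine h.congr fun M => ?_
    rw [gammaQuot_succ hA (hQM M)]
    congr 2 <;> ring

/-- Four-fold Gamma quotients with balanced parameters tend to `1`. -/
lemma Gamma_quot_tendsto {c₁ c₂ d₁ d₂ : ℂ} (h : c₁ + c₂ = d₁ + d₂) (hc₁ : 0 < c₁.re)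
    (hc₂ : 0 < c₂.re) (hd₁ : 0 < d₁.re) (hd₂ : 0 < d₂.re) :
    Tendsto (fun n : ℕ => Complex.Gamma (n + c₁) * Complex.Gamma (n + c₂) *
      (Complex.Gamma (n + d₁) * Complex.Gamma (n + d₂))⁻¹) atTop (𝓝 1) := by
  have key : ∀ c : ℂ, 0 < c.re → ∀ m : ℕ, c ≠ -m := fun c hc m h => by
    have := congrArg Complex.re h
    have h0 : (0 : ℝ) ≤ m := m.cast_nonneg
    simp only [Complex.neg_re, Complex.natCast_re] at this
    linarith
  have hG : ∀ c : ℂ, 0 < c.re → ∀ n : ℕ, Complex.Gamma (n + c) ≠ 0 := fun c hc n =>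
    Complex.Gamma_ne_zero_of_re_pos (by
      simp only [Complex.add_re, Complex.natCast_re]; positivity)
  have h1 := ((Gamma_add_nat_tendsto c₁ (key _ hc₁)).mul (Gamma_add_nat_tendsto c₂ (key _ hc₂))).div
    ((Gamma_add_nat_tendsto d₁ (key _ hd₁)).mul (Gamma_add_nat_tendsto d₂ (key _ hd₂))) (by simp)
  simp only [mul_one, div_one] at h1
  refine h1.congr' ?_
  filter_upwards [eventually_ne_atTop 0] with n hn
  have hn' : (n : ℂ) ≠ 0 := Nat.cast_ne_zero.2 hn
  have hf : (n.factorial : ℂ) ≠ 0 := Nat.cast_ne_zero.2 n.factorial_ne_zero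
  have hp : ∀ r : ℂ, (n : ℂ) ^ r ≠ 0 := fun r => by simp [Complex.cpow_eq_zero_iff, hn']
  have hpow : (n : ℂ) ^ (1 - c₁) * (n : ℂ) ^ (1 - c₂) = (n : ℂ) ^ (1 - d₁) * (n : ℂ) ^ (1 - d₂) := by
    rw [← Complex.cpow_add _ _ hn', ← Complex.cpow_add _ _ hn']
    congr 1
    linear_combination -h
  have g1 := hG d₁ hd₁ n
  have g2 := hG d₂ hd₂ n
  have p1 := hp (1 - d₁)
  have p2 := hp (1 - d₂)
  simp only [Pi.div_apply]
  field_simp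
  linear_combination Complex.Gamma (n + c₁) * Complex.Gamma (n + c₂) * hpow

/-- At Q = 1 the factor 1/Γ(1 - x) kills every term except x = 0. -/
lemma tsum_wpTerm_one (A B : ℝ) {P : ℂ} (hA : 0 ≤ A) (hP : Complex.Gamma (A - B + P) ≠ 0) :
    ∑' x, wpTerm A B P 1 x = wpSum A B P 1 := by
  rw [tsum_eq_single 0]
  · have h1 : (Real.Gamma (A + 1) : ℂ) ≠ 0 :=
      Complex.ofReal_ne_zero.2 (Real.Gamma_pos_of_pos (by linarith)).ne'
    simp only [wpTerm, wpCore, wpLead, wpSum, if_true, Nat.cast_zero, zero_add, sub_zero, add_zero,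
      Complex.Gamma_one, Real.Gamma_one]
    rw [show (A - 1 - B + P + 1 : ℂ) = A - B + P by ring, show (A - 1 + P + 1 : ℂ) = P + A by ring,
      show (1 + A : ℂ) = (A + 1 : ℝ) by push_cast; ring,
      show (A - B + 1 : ℂ) = (1 + A - B : ℝ) by push_cast; ring, Complex.Gamma_ofReal,
      Complex.Gamma_ofReal, Complex.Gamma_ofReal]
    push_cast
    simp only [mul_inv, div_eq_mul_inv]
    field_simp
  · intro x hx
    obtain ⟨y, rfl⟩ := Nat.exists_eq_succ_of_ne_zero hx
    have : Complex.Gamma (1 - ((y + 1 : ℕ) : ℂ)) = 0 :=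
      Complex.Gamma_eq_zero_iff _ |>.2 ⟨y, by push_cast; ring⟩
    rw [wpTerm, this, mul_zero, zero_mul, zero_mul, inv_zero, mul_zero]

lemma re_ge_add_nat {Q : ℂ} (hQ : 1 ≤ Q.re) (M : ℕ) : 1 ≤ (Q + M).re := by
  have : (0 : ℝ) ≤ M := M.cast_nonneg
  simp only [Complex.add_re, Complex.natCast_re]
  linarith

/-- Series and closed form obey the same recurrence in Q, so their ratio at Q equals their ratio at
Q + M. As M → ∞, after normalization, the ratio tends to a constant independent of Q, and that
constant is found at Q = 1. The condition `hP'` makes the limiting series `v` summable. -/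
lemma wp_tsum_of_large {A B : ℝ} (hA : 0 ≤ A) (hB : 0 < B) (hAB : B < 1 + A) {P Q : ℂ}
    (hP : 1 ≤ P.re) (hP' : 2 * B - A + 1 < 2 * P.re) (hQ : 1 ≤ Q.re) :
    ∑' x, wpTerm A B P Q x = wpSum A B P Q := by
  have hAP : Complex.Gamma (A - B + P) ≠ 0 := Complex.Gamma_ne_zero_of_re_pos (by
    simp only [Complex.add_re, Complex.sub_re, Complex.ofReal_re]; linarith)
  have hPG : Complex.Gamma P ≠ 0 := Complex.Gamma_ne_zero_of_re_pos (by linarith)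
  have hBG : Complex.Gamma B ≠ 0 := Complex.Gamma_ne_zero_of_re_pos (by simpa using hB)
  have hpos : ∀ Q : ℂ, 1 ≤ Q.re → 0 < A - 1 - B + P.re + Q.re := fun Q hQ => by linarith
  set v : ℕ → ℂ := fun x => (wpCore A B x : ℂ) *
    (Complex.Gamma (P - x) * Complex.Gamma (P + A + x))⁻¹ with hv
  have hvs : Summable v := by
    have := (isBigO_ofReal_left (wpCore_isBigO hA hB)).mul (inv_Gamma_pair_isBigO P (P + A))
    refine summable_of_isBigO_nat (g := fun n : ℕ => (n : ℝ) ^ (2 * B - A - 2 * P.re))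
      (Real.summable_nat_rpow.2 (by linarith)) (this.trans (EventuallyEq.isBigO ?_))
    filter_upwards [eventually_gt_atTop 0] with n hn
    have hn' : (0 : ℝ) < n := Nat.cast_pos.2 hn
    rw [← Real.rpow_add hn']
    simp only [Complex.add_re, Complex.ofReal_re]
    ring_nf
  have T1 : ∀ Q : ℂ, 1 ≤ Q.re → Tendsto (fun M : ℕ => Complex.Gamma (Q + M) *
      Complex.Gamma (Q + M + A) * ∑' x, wpTerm A B P (Q + M) x) atTop (𝓝 (∑' x, v x)) := by
    intro Q hQ
    have h := tendsto_tsum_of_dominated_convergence (𝓕 := atTop)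
      (f := fun (M : ℕ) x => v x * gammaQuot A (Q + M) x) (g := v) hvs.norm
      (fun x => by simpa using (gammaQuot_tendsto hA (show 0 < Q.re by linarith) x).const_mul (v x))
      (.of_forall fun M x => by
        rw [norm_mul]
        exact mul_le_of_le_one_right (norm_nonneg _)
          (norm_gammaQuot_le hA (by have := re_ge_add_nat hQ M; linarith) x))
    refine h.congr fun M => ?_
    rw [← tsum_mul_left]
    refine tsum_congr fun x => ?_
    simp only [hv, gammaQuot, wpTerm, mul_inv]
    ring
  set ρ : ℂ := 1 / 2 * Complex.Gamma B * (Complex.Gamma P * Complex.Gamma (A - B + P))⁻¹ with hρ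
  have hρ0 : ρ ≠ 0 := by
    refine mul_ne_zero (mul_ne_zero (by norm_num) hBG) (inv_ne_zero (mul_ne_zero hPG hAP))
  have T2 : ∀ Q : ℂ, 1 ≤ Q.re → Tendsto (fun M : ℕ => Complex.Gamma (Q + M) *
      Complex.Gamma (Q + M + A) * wpSum A B P (Q + M)) atTop (𝓝 ρ) := by
    intro Q hQ
    have h := (Gamma_quot_tendsto (c₁ := A - 1 - B + P + Q) (c₂ := Q + A) (d₁ := A - B + Q)
      (d₂ := A - 1 + P + Q) (by ring) (by simp; linarith) (by simp; linarith) (by simp; linarith)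
      (by simp; linarith)).const_mul ρ
    rw [mul_one] at h
    refine h.congr fun M => ?_
    have hQM : Complex.Gamma (Q + M) ≠ 0 :=
      Complex.Gamma_ne_zero_of_re_pos (by have := re_ge_add_nat hQ M; linarith)
    rw [hρ, wpSum, show (M + (A - 1 - B + P + Q) : ℂ) = A - 1 - B + P + (Q + M) by ring,
      show (M + (Q + A) : ℂ) = Q + M + A by ring, show (M + (A - B + Q) : ℂ) = A - B + (Q + M) by ring,
      show (M + (A - 1 + P + Q) : ℂ) = A - 1 + P + (Q + M) by ring]
    simp only [mul_inv]
    field_simp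
  -- Cross-multiplied form of the statement that the ratio of series and closed form is invariant
  -- under Q ↦ Q + M; no division by the closed form is needed.
  have cross : ∀ Q : ℂ, 1 ≤ Q.re → ∀ M : ℕ, (∑' x, wpTerm A B P (Q + M) x) * wpSum A B P Q =
      wpSum A B P (Q + M) * ∑' x, wpTerm A B P Q x := by
    intro Q hQ M
    induction M with
    | zero => simp [mul_comm]
    | succ M ih =>
      have hQM := re_ge_add_nat hQ M
      have hne : ∀ c : ℂ, 0 < c.re → c ≠ 0 := fun c hc h => by simp [h] at hc
      have h1 := wpTerm_tsum_contiguous hA hB (hpos _ hQM)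
      have h2 := wpSum_contiguous (A := A) (B := B) (P := P) (Q := Q + M)
        (hne _ (by simpa using hpos _ hQM))
      have h3 : (Q + M) * (A - B + (Q + M)) * (A - 1 + P + (Q + M)) ≠ 0 := by
        refine mul_ne_zero (mul_ne_zero (hne _ (by linarith)) (hne _ ?_)) (hne _ ?_)
        · rw [Complex.add_re, Complex.sub_re, Complex.ofReal_re, Complex.ofReal_re]; linarith
        · rw [Complex.add_re, Complex.add_re, Complex.sub_re, Complex.ofReal_re, Complex.one_re]
          linarith
      rw [Nat.cast_succ, ← add_assoc]
      apply mul_left_cancel₀ h3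
      rw [← mul_assoc, h1, ← mul_assoc, h2]
      linear_combination (A - 1 - B + P + (Q + M)) * ih
  have lim : ∀ Q : ℂ, 1 ≤ Q.re →
      (∑' x, v x) * wpSum A B P Q = ρ * ∑' x, wpTerm A B P Q x := by
    intro Q hQ
    refine tendsto_nhds_unique ((T1 Q hQ).mul_const (wpSum A B P Q))
      (((T2 Q hQ).mul_const _).congr fun M => ?_)
    rw [mul_assoc _ (∑' x, wpTerm A B P (Q + M) x), cross Q hQ M, mul_assoc _ (wpSum A B P (Q + M))]
  have h1 : wpSum A B P 1 ≠ 0 := by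
    unfold wpSum
    have e1 : (A - 1 - B + P + 1 : ℂ) = A - B + P := by ring
    rw [e1]
    refine mul_ne_zero (mul_ne_zero (mul_ne_zero (by norm_num) hBG) hAP) (inv_ne_zero ?_)
    refine mul_ne_zero (mul_ne_zero (mul_ne_zero (mul_ne_zero hPG (by simp)) hAP) ?_) ?_
    · exact Complex.Gamma_ne_zero_of_re_pos (by simp; linarith)
    · exact Complex.Gamma_ne_zero_of_re_pos (by simp; linarith)
  -- The specialization Q = 1, where the sum is known, identifies the limiting series with ρ.
  have hV : ∑' x, v x = ρ := by
    have := lim 1 (by simp)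
    rw [tsum_wpTerm_one A B hA hAP] at this
    exact mul_right_cancel₀ h1 this
  have := lim Q hQ
  rw [hV] at this
  exact (mul_left_cancel₀ hρ0 this).symm

lemma wp_tsum_step {A B : ℝ} (hA : 0 ≤ A) (hB : 0 < B) {P Q : ℂ}
    (hs : 0 < A - 1 - B + P.re + Q.re)
    (h : ∑' x, wpTerm A B P (Q + 1) x = wpSum A B P (Q + 1)) :
    ∑' x, wpTerm A B P Q x = wpSum A B P Q := by
  have hne : (A - 1 - B + P + Q : ℂ) ≠ 0 := fun h => by
    have := congrArg Complex.re h
    simp only [Complex.add_re, Complex.sub_re, Complex.ofReal_re, Complex.one_re,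
      Complex.zero_re] at this
    linarith
  apply mul_left_cancel₀ hne
  rw [← wpTerm_tsum_contiguous hA hB hs, ← wpSum_contiguous hne, h]

/-- **Dougall's `₅F₄` summation theorem**. -/
theorem wpTerm_hasSum {A B : ℝ} (hA : 0 ≤ A) (hB : 0 < B) (hAB : B < 1 + A) {P Q : ℂ}
    (hs : 0 < A - 1 - B + P.re + Q.re) : HasSum (wpTerm A B P Q) (wpSum A B P Q) := by
  -- The contiguous relation is used backwards, once in Q and, by the symmetry in P and Q, once in
  -- P, to descend from large parameters. The coefficient divided by is s, which stays nonzero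
  -- because Re s > 0.
  have key : ∀ (M : ℕ) (P Q : ℂ), 0 < A - 1 - B + P.re + Q.re →
      ∑' x, wpTerm A B (P + M) (Q + M) x = wpSum A B (P + M) (Q + M) →
      ∑' x, wpTerm A B P Q x = wpSum A B P Q := by
    intro M
    induction M with
    | zero => intro P Q _ h; simpa using h
    | succ M ih =>
      intro P Q hs h
      refine wp_tsum_step hA hB hs ?_
      simp_rw [wpTerm_comm A B P, wpSum_comm A B P]
      refine wp_tsum_step hA hB (by simp; linarith) ?_
      simp_rw [wpTerm_comm A B (Q + 1), wpSum_comm A B (Q + 1)]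
      refine ih (P + 1) (Q + 1) (by simp; linarith) ?_
      have e : ∀ P : ℂ, P + 1 + M = P + (M + 1 : ℕ) := fun P => by push_cast; ring
      rw [e, e]
      exact h
  obtain ⟨M, hM⟩ := exists_nat_gt (|P.re| + |Q.re| + 2 * |B| + |A| + 1)
  have := neg_abs_le P.re
  have := neg_abs_le Q.re
  have := neg_abs_le A
  have := le_abs_self B
  have := abs_nonneg P.re
  have := abs_nonneg Q.re
  have := abs_nonneg A
  have := abs_nonneg B
  have h := key M P Q hs (wp_tsum_of_large hA hB hAB
    (by simp only [Complex.add_re, Complex.natCast_re]; linarith)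
    (by simp only [Complex.add_re, Complex.natCast_re]; linarith)
    (by simp only [Complex.add_re, Complex.natCast_re]; linarith))
  rw [← h]
  exact (wpTerm_summable hA hB hs).hasSum

end ZMeas

namespace ZMeas

/-! ### Newton-type polynomial bases and their pairings -/

/-- The polynomial `∏_{j < k} (f j - u)` in `u`. -/
noncomputable def nodePoly (f : ℕ → ℂ) (k : ℕ) : ℂ[X] := ∏ j ∈ Finset.range k, (C (f j) - X)

lemma nodePoly_succ (f : ℕ → ℂ) (k : ℕ) : nodePoly f (k + 1) = nodePoly f k * (C (f k) - X) := by
  rw [nodePoly, Finset.prod_range_succ, nodePoly]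

lemma nodePoly_eq (f : ℕ → ℂ) (k : ℕ) :
    nodePoly f k = C ((-1) ^ k) * ∏ j ∈ Finset.range k, (X - C (f j)) := by
  induction k with
  | zero => simp [nodePoly]
  | succ k ih =>
    rw [nodePoly_succ, ih, Finset.prod_range_succ, pow_succ, C_mul, C_neg, C_1]
    ring

lemma degree_nodePoly (f : ℕ → ℂ) (k : ℕ) : (nodePoly f k).degree = k := by
  rw [nodePoly_eq, degree_C_mul (by simp), degree_prod]
  simp [degree_X_sub_C]

lemma natDegree_nodePoly (f : ℕ → ℂ) (k : ℕ) : (nodePoly f k).natDegree = k :=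
  natDegree_eq_of_degree_eq_some (degree_nodePoly f k)

lemma coeff_nodePoly_self (f : ℕ → ℂ) (k : ℕ) : (nodePoly f k).coeff k = (-1) ^ k := by
  have h : (nodePoly f k).leadingCoeff = (-1) ^ k := by
    rw [nodePoly_eq, leadingCoeff_mul, leadingCoeff_C,
      (monic_prod_of_monic _ _ fun j _ => monic_X_sub_C (f j)).leadingCoeff, mul_one]
  rwa [leadingCoeff, natDegree_nodePoly] at h

/-- Each factor splits: (c + i - e)² - (x + e)² = (x + c + i)(c - 2e - x + i). -/
lemma nodePoly_eval_poch (c e : ℂ) (j : ℕ) (x : ℂ) :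
    (nodePoly (fun i => (c + i - e) ^ 2) j).eval ((x + e) ^ 2) =
      poch (x + c) j * poch (c - 2 * e - x) j := by
  induction j with
  | zero => simp [nodePoly, poch]
  | succ j ih =>
    rw [nodePoly_succ, eval_mul, ih, poch_succ, poch_succ]
    simp only [eval_sub, eval_C, eval_X]
    ring

lemma degree_sum_nodePoly_lt (f : ℕ → ℂ) (c : ℕ → ℂ) (n : ℕ) :
    (∑ k ∈ Finset.range n, C (c k) * nodePoly f k).degree < n := by
  refine (degree_sum_le _ _).trans_lt ((Finset.sup_lt_iff (by simp)).2 fun k hk => ?_)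
  rw [C_mul']
  refine (degree_smul_le _ _).trans_lt ?_
  rw [degree_nodePoly]
  exact_mod_cast Finset.mem_range.1 hk

/-- The factors are f_j - X, so the basis polynomial of degree n has leading coefficient (-1)^n,
which `c n` compensates. -/
lemma monic_sum_nodePoly (f : ℕ → ℂ) (c : ℕ → ℂ) (n : ℕ) (hc : c n = (-1) ^ n) :
    (∑ k ∈ Finset.range (n + 1), C (c k) * nodePoly f k).Monic ∧
      (∑ k ∈ Finset.range (n + 1), C (c k) * nodePoly f k).natDegree = n := by
  have h1 := degree_sum_nodePoly_lt f c n
  have h2 : (C (c n) * nodePoly f n).degree = n := by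
    rw [hc, degree_C_mul (by simp), degree_nodePoly]
  have h3 : (C (c n) * nodePoly f n).coeff n = 1 := by
    rw [coeff_C_mul, coeff_nodePoly_self, hc, ← mul_pow]
    simp
  have h4 : (∑ k ∈ Finset.range (n + 1), C (c k) * nodePoly f k).degree = n := by
    rw [Finset.sum_range_succ, degree_add_eq_right_of_degree_lt (by rwa [h2]), h2]
  have h5 := natDegree_eq_of_degree_eq_some h4
  refine ⟨?_, h5⟩
  rw [Monic, leadingCoeff, h5, Finset.sum_range_succ, coeff_add, coeff_eq_zero_of_degree_lt h1, h3,
    zero_add]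

/-- A functional vanishing on a basis of Newton type vanishes on the polynomials it spans. -/
lemma hasSum_zero_of_nodePoly {u w : ℕ → ℂ} {f : ℕ → ℂ} {n : ℕ}
    (h : ∀ j < n, HasSum (fun x => w x * (nodePoly f j).eval (u x)) 0) (q : ℂ[X])
    (hq : q.degree < n) : HasSum (fun x => w x * q.eval (u x)) 0 := by
  induction n generalizing q with
  | zero =>
    have : q = 0 := by simpa using hq
    simp [this, hasSum_zero]
  | succ n ih =>
    -- Multiplying by (-1)^n inverts the leading coefficient of the basis polynomial, so subtracting
    -- `c` times it lowers the degree.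
    set c := q.coeff n * (-1) ^ n with hc
    have hr : (q - C c * nodePoly f n).degree < n := by
      rw [degree_lt_iff_coeff_zero]
      intro m hm
      rcases hm.eq_or_lt with rfl | hm
      · rw [coeff_sub, coeff_C_mul, coeff_nodePoly_self, hc, mul_assoc, ← mul_pow]
        simp
      · refine coeff_eq_zero_of_degree_lt ((degree_sub_le _ _).trans_lt (max_lt ?_ ?_))
        · exact hq.trans_le (by exact_mod_cast hm)
        · rw [C_mul']
          refine (degree_smul_le _ _).trans_lt ?_
          rw [degree_nodePoly]
          exact_mod_cast hm
    have h1 := ih (fun j hj => h j (by omega)) _ hr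
    have h2 := (h n (by omega)).mul_left c
    have h3 := h1.add h2
    rw [mul_zero, add_zero] at h3
    refine h3.congr_fun fun x => ?_
    simp only [eval_sub, eval_mul, eval_C]
    ring

/-! ### Absorbing basis polynomials into the summand -/

lemma wpLead_shift {A : ℝ} (hA : 0 ≤ A) (k y : ℕ) :
    (wpLead A (y + k) : ℂ) * poch ((y + k : ℕ) + A) k = wpLead (A + 2 * k) y := by
  rcases Nat.eq_zero_or_pos k with rfl | hk
  · simp [poch]
  have hk' : (0 : ℝ) < k := Nat.cast_pos.2 hk
  have hy : (0 : ℝ) ≤ y := y.cast_nonneg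
  have hpos : 0 < ((y + k : ℕ) : ℝ) + A := by push_cast; positivity
  have h1 : wpLead (A + 2 * k) y = (y + k + A / 2) * Real.Gamma (y + 2 * k + A) := by
    unfold wpLead
    split_ifs with h
    · subst h
      rw [Real.Gamma_add_one (by positivity)]
      push_cast
      ring_nf
    · ring_nf
  have h2 : wpLead A (y + k) = (y + k + A / 2) * Real.Gamma ((y + k : ℕ) + A) := by
    rw [wpLead, if_neg (by omega)]
    push_cast
    ring
  have hc : ∀ m : ℕ, ((y + k : ℕ) : ℂ) + A ≠ -m := by
    have := ne_neg_of_pos hpos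
    push_cast at this ⊢
    exact this
  rw [h1, h2, poch_eq_Gamma_div _ _ hc]
  push_cast
  rw [← Complex.Gamma_ofReal, ← Complex.Gamma_ofReal]
  have := Complex.Gamma_ne_zero hc
  push_cast at this ⊢
  rw [show (y + k + A + k : ℂ) = y + 2 * k + A by ring]
  field_simp

lemma poch_neg_shift (k y : ℕ) :
    poch (-((y + k : ℕ) : ℂ)) k * ((y + k).factorial : ℂ)⁻¹ = (-1) ^ k * (y.factorial : ℂ)⁻¹ := by
  have h := poch_reflect k (y + 1)
  rw [show (1 - (y + 1) - k : ℂ) = -((y + k : ℕ) : ℂ) by push_cast; ring] at h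
  have h2 := poch_eq_Gamma_div ((y : ℂ) + 1) k (fun m hm => by
    have : ((y + 1 + m : ℕ) : ℂ) = 0 := by push_cast; rw [hm]; ring
    rw [Nat.cast_eq_zero] at this
    omega)
  rw [show ((y : ℂ) + 1 + k) = ((y + k : ℕ) : ℂ) + 1 by push_cast; ring,
    Complex.Gamma_nat_eq_factorial, Complex.Gamma_nat_eq_factorial] at h2
  have := (Nat.cast_ne_zero (R := ℂ)).2 (y + k).factorial_ne_zero
  rw [h, h2]
  field_simp

/-- With x = y + k, the factor (x + A)_k raises the argument of the leading Gamma, (-x)_k/x! becomes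
(-1)^k/y!, and the two symbols of length j lower Q by j in 1/Γ(Q - x) and 1/Γ(Q + A + x). The result
is again a very well-poised summand. -/
lemma wpTerm_shift {A B : ℝ} (hA : 0 ≤ A) (P Q : ℂ) (k j y : ℕ) :
    poch ((y + k : ℕ) + A) k * poch (-((y + k : ℕ) : ℂ)) k *
      (poch ((y + k : ℕ) + (1 - Q)) j * poch (1 - Q - A - (y + k : ℕ)) j) *
        wpTerm A B P Q (y + k) =
      (-1) ^ k * wpTerm (A + 2 * k) (B + k) (P - k) (Q - k - j) y := by
  have h1 := wpLead_shift hA k y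
  have h2 := poch_neg_shift k y
  have h3 : (Complex.Gamma (Q - k - j - y))⁻¹ =
      (-1) ^ j * poch ((y + k : ℕ) + (1 - Q)) j * (Complex.Gamma (Q - (y + k : ℕ)))⁻¹ := by
    rw [← poch_reflect, inv_Gamma_eq_poch_mul (Q - k - j - y) j]
    push_cast
    ring_nf
  have h4 : (Complex.Gamma (Q - k - j + (A + 2 * k : ℝ) + y))⁻¹ =
      (-1) ^ j * poch (1 - Q - A - (y + k : ℕ)) j * (Complex.Gamma (Q + A + (y + k : ℕ)))⁻¹ := by
    rw [← poch_reflect, inv_Gamma_eq_poch_mul (Q - k - j + (A + 2 * k : ℝ) + y) j]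
    push_cast
    ring_nf
  have hj : ((-1 : ℂ) ^ j) * (-1) ^ j = 1 := by rw [← mul_pow]; simp
  have g1 : (Real.Gamma (((y + k : ℕ) : ℝ) + B)) = Real.Gamma (y + (B + k)) := by
    push_cast; ring_nf
  have g2 : (Real.Gamma (((y + k : ℕ) : ℝ) + 1 + A - B)) =
      Real.Gamma (y + 1 + (A + 2 * k) - (B + k)) := by
    push_cast; ring_nf
  have g3 : Complex.Gamma (P - (y + k : ℕ)) = Complex.Gamma (P - k - y) := by push_cast; ring_nf
  have g4 : Complex.Gamma (P + A + (y + k : ℕ)) =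
    Complex.Gamma (P - k + (A + 2 * k : ℝ) + y) := by push_cast; ring_nf
  unfold wpTerm wpCore
  simp only [mul_inv, h3, h4, g1, g2, g3, g4, Real.Gamma_nat_eq_factorial, div_eq_mul_inv,
    Complex.ofReal_mul, Complex.ofReal_inv, Complex.ofReal_natCast]
  rw [← h1]
  set G1 := ((Real.Gamma (y + (B + k)) : ℝ) : ℂ)
  set G2 := ((Real.Gamma (y + 1 + (A + 2 * k) - (B + k)) : ℝ) : ℂ)⁻¹
  set G3 := (Complex.Gamma (P - k - y))⁻¹
  set G4 := (Complex.Gamma (P - k + (A + 2 * k : ℝ) + y))⁻¹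
  set G5 := (Complex.Gamma (Q - (y + k : ℕ)))⁻¹
  set G6 := (Complex.Gamma (Q + A + (y + k : ℕ)))⁻¹
  set L := (wpLead A (y + k) : ℂ)
  set p1 := poch ((y + k : ℕ) + A) k
  set p2 := poch ((y + k : ℕ) + (1 - Q)) j
  set p3 := poch (1 - Q - A - (y + k : ℕ)) j
  linear_combination (p1 * p2 * p3 * L * G1 * G2 * G3 * G4 * G5 * G6) * h2 -
    (-1) ^ k * (y.factorial : ℂ)⁻¹ * (p1 * p2 * p3 * L * G1 * G2 * G3 * G4 * G5 * G6) * hj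

/-- The sum of `wpTerm` against the Newton-type polynomials at the nodes of the lattice and at the
nodes attached to the parameter `Q`. -/
lemma wpTerm_pairing {A B : ℝ} (hA : 0 ≤ A) (hB : 0 < B) (hAB : B < 1 + A) {P Q : ℂ} (k j : ℕ)
    (hs : (k + j : ℝ) < A - 1 - B + P.re + Q.re) :
    HasSum (fun x : ℕ => poch (x + A) k * poch (-(x : ℂ)) k *
      (poch (x + (1 - Q)) j * poch (1 - Q - A - x) j) * wpTerm A B P Q x)
      ((-1) ^ k * wpSum (A + 2 * k) (B + k) (P - k) (Q - k - j)) := by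
  have hk : (0 : ℝ) ≤ k := k.cast_nonneg
  have h := (wpTerm_hasSum (A := A + 2 * k) (B := B + k) (P := P - k) (Q := Q - k - j)
    (by positivity) (by positivity) (by linarith) (by simp; linarith)).mul_left ((-1) ^ k)
  -- The terms with x < k vanish because (-x)_k = 0, so the sum may start at x = k. The shifted
  -- summand has convergence parameter s - k - j.
  rw [← hasSum_nat_add_iff' k, Finset.sum_eq_zero, sub_zero]
  · exact h.congr_fun fun y => wpTerm_shift hA P Q k j y
  · intro x hx
    rw [poch_neg_nat (Finset.mem_range.1 hx)]
    ring

end ZMeas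

namespace ZMeas

/-! ### Finite differences -/

lemma poch_neg_div_factorial {n k : ℕ} (h : k ≤ n) :
    poch (-(n : ℂ)) k / (k.factorial : ℂ) = (-1) ^ k * (n.choose k : ℂ) := by
  have h1 := poch_neg_shift k (n - k)
  rw [Nat.sub_add_cancel h] at h1
  have f1 := (Nat.cast_ne_zero (R := ℂ)).2 n.factorial_ne_zero
  have f2 := (Nat.cast_ne_zero (R := ℂ)).2 k.factorial_ne_zero
  have f3 := (Nat.cast_ne_zero (R := ℂ)).2 (n - k).factorial_ne_zero
  rw [Nat.cast_choose ℂ h]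
  field_simp at h1 ⊢
  linear_combination h1

lemma sum_poch_neg_eq_fwdDiff (f : ℂ → ℂ) (n : ℕ) :
    ∑ k ∈ Finset.range (n + 1), poch (-(n : ℂ)) k / (k.factorial : ℂ) * f k =
      (-1) ^ n * (fwdDiff 1)^[n] f 0 := by
  rw [fwdDiff_iter_eq_sum_shift, Finset.mul_sum]
  refine Finset.sum_congr rfl fun k hk => ?_
  have hk' : k ≤ n := Nat.lt_succ_iff.1 (Finset.mem_range.1 hk)
  rw [poch_neg_div_factorial hk', zsmul_eq_mul]
  have : ((-1 : ℂ)) ^ n * (-1) ^ (n - k) = (-1) ^ k := by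
    obtain ⟨m, rfl⟩ := Nat.exists_eq_add_of_le hk'
    rw [Nat.add_sub_cancel_left, pow_add, mul_assoc, ← mul_pow]
    simp
  push_cast
  rw [zero_add, nsmul_one, ← mul_assoc, ← mul_assoc, this]

/-- The weights (-n)_k/k! are signed binomial coefficients, and an n-th finite difference kills
polynomials of degree below n. All the orthogonality relations come from this. -/
lemma sum_poch_neg_mul_eval {n : ℕ} {R : ℂ[X]} (hR : R.natDegree < n) :
    ∑ k ∈ Finset.range (n + 1), poch (-(n : ℂ)) k / (k.factorial : ℂ) * R.eval (k : ℂ) = 0 := by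
  rw [sum_poch_neg_eq_fwdDiff (fun x => R.eval x), Polynomial.fwdDiff_iter_eq_zero_of_degree_lt hR]
  simp

lemma fwdDiff_iter_inv (c : ℂ) (n : ℕ) : ∀ x : ℂ, (∀ i ≤ n, c - x - i ≠ 0) →
    (fwdDiff 1)^[n] (fun y => (c - y)⁻¹) x =
      n.factorial * (∏ i ∈ Finset.range (n + 1), (c - x - i))⁻¹ := by
  induction n with
  | zero => intro x _; simp
  | succ n ih =>
    intro x hx
    rw [Function.iterate_succ_apply', fwdDiff, ih x fun i hi => hx i (by omega),
      ih (x + 1) fun i hi => by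
        have := hx (i + 1) (by omega)
        push_cast at this
        rwa [sub_sub, add_assoc, add_comm 1, ← sub_sub]]
    have e : ∀ i : ℕ, c - (x + 1) - i = c - x - (i + 1 : ℕ) := fun i => by push_cast; ring
    simp_rw [e]
    have h1 := Finset.prod_range_succ (fun i : ℕ => c - x - i) (n + 1)
    have h2 := Finset.prod_range_succ' (fun i : ℕ => c - x - i) (n + 1)
    have n1 : ∏ i ∈ Finset.range (n + 1), (c - x - (i : ℕ)) ≠ 0 :=
      Finset.prod_ne_zero_iff.2 fun i hi => hx i (by have := Finset.mem_range.1 hi; omega)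
    have n2 : ∏ i ∈ Finset.range (n + 1), (c - x - (i + 1 : ℕ)) ≠ 0 :=
      Finset.prod_ne_zero_iff.2 fun i hi => hx (i + 1) (by have := Finset.mem_range.1 hi; omega)
    have n3 := hx (n + 1) le_rfl
    have n4 := hx 0 (by omega)
    rw [h1] at h2 ⊢
    set p := ∏ i ∈ Finset.range (n + 1), (c - x - (i : ℕ))
    set q := ∏ i ∈ Finset.range (n + 1), (c - x - (i + 1 : ℕ))
    rw [Nat.factorial_succ]
    push_cast at *
    field_simp
    linear_combination (n.factorial : ℂ) * h2

/-- Write R = R(c) + (X - c)S. The quotient S has degree below n, or is zero when n = 0, and is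
annihilated, so only R(c) times the n-th difference of 1/(c - x) remains. -/
lemma sum_poch_neg_mul_eval_div {n : ℕ} {R : ℂ[X]} (hR : R.natDegree ≤ n) {c : ℂ}
    (hc : ∀ i ≤ n, c - i ≠ 0) :
    ∑ k ∈ Finset.range (n + 1), poch (-(n : ℂ)) k / (k.factorial : ℂ) *
      (R.eval (k : ℂ) * (c - k)⁻¹) =
    R.eval c * ((-1) ^ n * n.factorial * (∏ i ∈ Finset.range (n + 1), (c - i))⁻¹) := by
  have h1 : ∑ k ∈ Finset.range (n + 1), poch (-(n : ℂ)) k / (k.factorial : ℂ) * (c - k)⁻¹ =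
      (-1) ^ n * n.factorial * (∏ i ∈ Finset.range (n + 1), (c - i))⁻¹ := by
    rw [sum_poch_neg_eq_fwdDiff (fun x => (c - x)⁻¹),
      fwdDiff_iter_inv c n 0 (by simpa using hc)]
    simp [mul_assoc]
  have h2 : R = C (R.eval c) + (X - C c) * (R /ₘ (X - C c)) := by
    conv_lhs => rw [← modByMonic_add_div R (X - C c), modByMonic_X_sub_C_eq_C_eval]
  set S := R /ₘ (X - C c) with hS
  have h3 : ∀ k ∈ Finset.range (n + 1), poch (-(n : ℂ)) k / (k.factorial : ℂ) *
      (R.eval (k : ℂ) * (c - k)⁻¹) =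
      R.eval c * (poch (-(n : ℂ)) k / (k.factorial : ℂ) * (c - k)⁻¹) -
        poch (-(n : ℂ)) k / (k.factorial : ℂ) * S.eval (k : ℂ) := fun k hk => by
    have hk0 := hc k (Nat.lt_succ_iff.1 (Finset.mem_range.1 hk))
    have : R.eval (k : ℂ) = R.eval c + (k - c) * S.eval (k : ℂ) := by
      conv_lhs => rw [h2]
      simp
    rw [this]
    field_simp
    ring
  rw [Finset.sum_congr rfl h3, Finset.sum_sub_distrib, ← Finset.mul_sum, h1]
  have h4 : ∑ k ∈ Finset.range (n + 1), poch (-(n : ℂ)) k / (k.factorial : ℂ) * S.eval (k : ℂ)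
      = 0 := by
    rcases Nat.eq_zero_or_pos n with rfl | hn
    · have : S = 0 := by
        rw [hS, eq_C_of_natDegree_le_zero hR]
        exact divByMonic_eq_zero_iff (monic_X_sub_C c) |>.2 (by
          rw [degree_X_sub_C]; exact degree_C_le.trans_lt (by norm_num))
      simp [this]
    · refine sum_poch_neg_mul_eval ?_
      rw [hS, natDegree_divByMonic _ (monic_X_sub_C c), natDegree_X_sub_C]
      omega
  rw [h4, sub_zero]

lemma natDegree_ascPochhammer_comp_le (m : ℕ) {R : ℂ[X]} (hR : R.natDegree ≤ 1) :
    ((ascPochhammer ℂ m).comp R).natDegree ≤ m := by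
  refine natDegree_comp_le.trans ?_
  rw [ascPochhammer_natDegree]
  nlinarith

/-! ### The closed form of the pairings -/

/-- Separates the dependence on k: some Pochhammer symbols, which the coefficients of 𝔭_n will
cancel, and the single Gamma value Γ(s - k - j). -/
lemma wpSum_shift {A B : ℝ} (hB : 0 < B) (P Q : ℂ) (k j : ℕ) :
    (-1) ^ k * wpSum (A + 2 * k) (B + k) (P - k) (Q - k - j) =
      (-1) ^ (k + j) * (1 / 2 * Complex.Gamma B * (Complex.Gamma P * Complex.Gamma Q *
        Complex.Gamma (A - B + P) * Complex.Gamma (A - B + Q - j) *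
          Complex.Gamma (A - 1 + P + Q - j))⁻¹) *
      (poch B k * poch (1 - P) k * (poch (1 - Q) k * poch (1 - Q + k) j)) *
        Complex.Gamma (A - 1 - B + P + Q - k - j) := by
  have h1 := inv_Gamma_sub_nat P k
  have h2 := inv_Gamma_sub_nat Q (k + j)
  have h3 := poch_eq_Gamma_div B k (ne_neg_of_pos hB)
  have h4 : Complex.Gamma B ≠ 0 := Complex.Gamma_ne_zero (ne_neg_of_pos hB)
  rw [eq_div_iff h4] at h3
  rw [poch_add] at h2
  have e1 : (Complex.Gamma (Q - k - j))⁻¹ = (Complex.Gamma (Q - (k + j : ℕ)))⁻¹ := by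
    push_cast; ring_nf
  unfold wpSum
  simp only [mul_inv]
  rw [e1, h1, h2]
  push_cast
  rw [← h3, show (A + 2 * k - 1 - (B + k) + (P - k) + (Q - k - j) : ℂ) =
    A - 1 - B + P + Q - k - j by ring, show (A + 2 * k - (B + k) + (P - k) : ℂ) = A - B + P by ring,
    show (A + 2 * k - (B + k) + (Q - k - j) : ℂ) = A - B + Q - j by ring,
    show (A + 2 * k - 1 + (P - k) + (Q - k - j) : ℂ) = A - 1 + P + Q - j by ring, pow_add]
  have hj : ((-1 : ℂ) ^ k) * (-1) ^ k = 1 := by rw [← mul_pow]; simp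
  linear_combination (1 / 2 * (-1) ^ k * (-1) ^ j * (poch B k * Complex.Gamma B) *
    Complex.Gamma (A - 1 - B + P + Q - k - j) * poch (1 - P) k * (Complex.Gamma P)⁻¹ *
    (poch (1 - Q) k * poch (1 - Q + k) j) * (Complex.Gamma Q)⁻¹ * (Complex.Gamma (A - B + P))⁻¹ *
    (Complex.Gamma (A - B + Q - j))⁻¹ * (Complex.Gamma (A - 1 + P + Q - j))⁻¹) * hj

/-- For j < n the product is, up to a factor free of k, a polynomial in k of degree n - 1 - j. With
s = Σ + 2N - 1, the excluded values of s - 2n + 1 are those of Σ + 2 for n = N - 1 and of Σ itself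
for n = N; the latter is the source of the condition Σ ≠ 0. -/
lemma poch_mul_Gamma_of_lt {n k j : ℕ} (hj : j < n) (hk : k ≤ n) {s : ℂ}
    (hs : ∀ m : ℕ, s - 2 * n + 1 ≠ -m) :
    (-1) ^ k * poch (n - s) k * Complex.Gamma (s - k - j) =
      Complex.Gamma (s - n + 1) * poch (s - n - k + 1) (n - 1 - j) := by
  have hc : ∀ m : ℕ, s - n - k + 1 ≠ -m := fun m h => hs (n - k + m) (by
    push_cast [hk]; linear_combination h)
  have h1 := poch_reflect k (s - n - k + 1)
  rw [show (1 - (s - n - k + 1) - k) = n - s by ring] at h1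
  have h0 := Complex.Gamma_ne_zero hc
  have h2 := poch_eq_Gamma_div _ k hc
  have h3 := poch_eq_Gamma_div _ (n - 1 - j) hc
  have hn : ((n - 1 - j : ℕ) : ℂ) = n - 1 - j := by
    rw [Nat.sub_sub, Nat.cast_sub (by omega)]; push_cast; ring
  rw [show s - n - k + 1 + k = s - n + 1 by ring] at h2
  rw [hn, show s - n - k + 1 + (n - 1 - j) = s - k - j by ring] at h3
  rw [h1, h2, h3, ← mul_assoc, ← mul_pow]
  field_simp
  simp

/-- The borderline case j = n of the preceding reduction: the polynomial of degree n - 1 - j is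
replaced by a simple fraction. -/
lemma poch_mul_Gamma_self {n k : ℕ} {s : ℂ} (hs : ∀ m : ℕ, s - n - k ≠ -m) :
    (-1) ^ k * poch (n - s) k * Complex.Gamma (s - k - n) =
      Complex.Gamma (s - n + 1) * (s - n - k)⁻¹ := by
  have h00 : s - n - k ≠ 0 := by simpa using hs 0
  have hc : ∀ m : ℕ, s - n - k + 1 ≠ -m := fun m h => hs (m + 1) (by
    push_cast; linear_combination h)
  have h1 := poch_reflect k (s - n - k + 1)
  rw [show (1 - (s - n - k + 1) - k) = n - s by ring] at h1
  have h0 := Complex.Gamma_ne_zero hs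
  have h2 := poch_eq_Gamma_div _ k hc
  rw [show s - n - k + 1 + k = s - n + 1 by ring, Complex.Gamma_add_one _ h00] at h2
  rw [h1, h2, show s - k - n = s - n - k by ring, ← mul_assoc, ← mul_pow]
  field_simp
  simp

end ZMeas

namespace ZMeas

/-! ### Orthogonality of the Wilson–Neretin polynomials -/

lemma hasSum_of_eq {f : ℕ → ℂ} {u v : ℂ} (h : HasSum f u) (e : u = v) : HasSum f v := e ▸ h

lemma two_mul_eps (a b : ℝ) : 2 * eps a b = a + b + 1 := by
  unfold eps
  ring

lemma latticePoly_eq_nodePoly (a b : ℝ) (k : ℕ) :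
    latticePoly a b k = nodePoly (fun j => ((j : ℂ) + (eps a b : ℂ)) ^ 2) k := rfl

lemma hat_cast (a b : ℝ) (x : ℕ) : (hat a b x : ℂ) = ((x : ℂ) + (eps a b : ℂ)) ^ 2 := by
  simp [hat]

/-- The dictionary A = 2ε, B = a + 1, P = z + N, Q = z' + N; then 1 + A - B = b + 1. -/
lemma weightC_eq_wpTerm (z z' : ℂ) (a b : ℝ) (N x : ℕ) :
    weightC z z' a b N x = wpTerm (2 * eps a b) (a + 1) (z + N) (z' + N) x := by
  have h1 : leadFactor a b x = wpLead (2 * eps a b) x := by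
    unfold leadFactor wpLead
    rw [mul_div_cancel_left₀ _ (two_ne_zero' ℝ)]
  have h2 : (x : ℝ) + 1 + 2 * eps a b - (a + 1) = x + b + 1 := by rw [two_mul_eps]; ring
  unfold weightC wpTerm wpCore
  rw [h1, h2]
  push_cast
  ring_nf

/-- Newton-type basis whose members multiply the weight into a weight with shifted `z'`. -/
noncomputable def dualPoly (a b : ℝ) (z' : ℂ) (N j : ℕ) : ℂ[X] :=
  nodePoly (fun i => (1 - (z' + N) + i - (eps a b : ℂ)) ^ 2) j

/-- The parameter `Σ + 2N - 1` governing the decay of the weight. -/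
noncomputable def decay (z z' : ℂ) (b : ℝ) (N : ℕ) : ℂ := sig z z' b + 2 * N - 1

/-- The pairing of `latticePoly a b k` with `dualPoly a b z' N j`, up to the factor depending on
`j` only that is `pairConst`. -/
noncomputable def pairConst (z z' : ℂ) (a b : ℝ) (N j : ℕ) : ℂ :=
  (-1) ^ j * (1 / 2 * Complex.Gamma (a + 1) * (Complex.Gamma (z + N) * Complex.Gamma (z' + N) *
    Complex.Gamma (b + z + N) * Complex.Gamma (b + z' + N - j) *
      Complex.Gamma (a + sig z z' b + 2 * N - j))⁻¹)

lemma latticePoly_pairing {z z' : ℂ} {a b : ℝ} (hab : b ≤ a) (hb : -1 / 2 ≤ b) (N k j : ℕ)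
    (hs : (k + j : ℝ) < (decay z z' b N).re) :
    HasSum (fun x : ℕ => (latticePoly a b k).eval (hat a b x : ℂ) *
      (dualPoly a b z' N j).eval (hat a b x : ℂ) * weightC z z' a b N x)
      (pairConst z z' a b N j * ((-1) ^ k * (poch (1 + a) k * poch (1 - z - N) k *
        poch (1 - z' - N) k) * poch (1 - z' - N + k) j *
          Complex.Gamma (decay z z' b N - k - j))) := by
  have hA : 0 ≤ 2 * eps a b := by rw [two_mul_eps]; linarith
  have hre : (decay z z' b N).re =
      2 * eps a b - 1 - (a + 1) + (z + N).re + (z' + N).re := by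
    rw [two_mul_eps]
    simp [decay, sig]
    ring
  have h := wpTerm_pairing (A := 2 * eps a b) (B := a + 1) (P := z + N) (Q := z' + N) hA
    (by linarith) (by rw [two_mul_eps]; linarith) k j (by rw [← hre]; exact hs)
  rw [wpSum_shift (by linarith)] at h
  have hA2 : ((2 * eps a b : ℝ) : ℂ) = a + b + 1 := by rw [two_mul_eps]; push_cast; ring
  have hd : ((2 * eps a b : ℝ) : ℂ) - 1 - (a + 1 : ℝ) + (z + N) + (z' + N) - k - j =
      decay z z' b N - k - j := by
    rw [hA2, decay, sig]; push_cast; ring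
  have hfun := h.congr_fun (g := fun x : ℕ => (latticePoly a b k).eval (hat a b x : ℂ) *
      (dualPoly a b z' N j).eval (hat a b x : ℂ) * weightC z z' a b N x) fun x => by
    rw [weightC_eq_wpTerm, hat_cast, latticePoly_eval, dualPoly, nodePoly_eval_poch]
    push_cast
    ring_nf
  refine hasSum_of_eq hfun ?_
  symm
  rw [hd, hA2, pairConst, pow_add]
  rw [show (a + b + 1 - (a + 1 : ℝ) + (z + N) : ℂ) = b + z + N by push_cast; ring,
    show (a + b + 1 - (a + 1 : ℝ) + (z' + N) - j : ℂ) = b + z' + N - j by push_cast; ring,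
    show (a + b + 1 - 1 + (z + N) + (z' + N) - j : ℂ) = a + sig z z' b + 2 * N - j by
      rw [sig]; ring]
  push_cast
  rw [add_comm (a : ℂ) 1, sub_sub 1 z, sub_sub 1 z']
  ring

/-- The denominators (1 + a)_k (1 - z - N)_k (1 - z' - N)_k of the hypergeometric coefficients
cancel the same factors in the pairing of `latticePoly`, leaving a binomial sum. -/
lemma neretin_pairing {z z' : ℂ} {a b : ℝ} (hab : b ≤ a) (hb : -1 / 2 ≤ b) (N n j : ℕ)
    (hP : ∀ k ≤ n, poch (1 - z - N) k ≠ 0) (hQ : ∀ k ≤ n, poch (1 - z' - N) k ≠ 0)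
    (hs : (n + j : ℝ) < (decay z z' b N).re) :
    HasSum (fun x : ℕ => (neretin z z' a b N n).eval (hat a b x : ℂ) *
      (dualPoly a b z' N j).eval (hat a b x : ℂ) * weightC z z' a b N x)
      (poch (1 + a) n * poch (1 - z - N) n * poch (1 - z' - N) n /
        poch (n - decay z z' b N) n * pairConst z z' a b N j *
        ∑ k ∈ Finset.range (n + 1), poch (-(n : ℂ)) k / (k.factorial : ℂ) *
          (poch (1 - z' - N + k) j *
            ((-1) ^ k * poch (n - decay z z' b N) k * Complex.Gamma (decay z z' b N - k - j)))) := by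
  have hB : ∀ k, poch (1 + a) k ≠ 0 := fun k => by
    have := poch_ne_zero _ k (ne_neg_of_pos (show 0 < 1 + a by linarith))
    push_cast at this
    exact this
  have hd : ((n : ℂ) + 1 - 2 * N - sig z z' b) = n - decay z z' b N := by rw [decay]; ring
  have h := hasSum_sum (s := Finset.range (n + 1)) fun k hk =>
    (latticePoly_pairing (z := z) (z' := z') hab hb N k j (by
      have : (k : ℝ) ≤ n := by exact_mod_cast Nat.lt_succ_iff.1 (Finset.mem_range.1 hk)
      linarith)).mul_left
      (poch (-(n : ℂ)) k * poch (n - decay z z' b N) k /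
        (poch (1 + a) k * poch (1 - z - N) k * poch (1 - z' - N) k * (k.factorial : ℂ)))
  have h2 := (h.mul_left (poch (1 + a) n * poch (1 - z - N) n * poch (1 - z' - N) n /
        poch (n - decay z z' b N) n)).congr_fun (g := fun x : ℕ =>
      (neretin z z' a b N n).eval (hat a b x : ℂ) *
      (dualPoly a b z' N j).eval (hat a b x : ℂ) * weightC z z' a b N x) fun x => by
    rw [neretin, hd, eval_mul, eval_C, eval_finsetSum, mul_assoc, mul_assoc, Finset.sum_mul]
    congr 1
    refine Finset.sum_congr rfl fun k _ => ?_
    rw [eval_mul, eval_C]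
    ring
  refine hasSum_of_eq h2 ?_
  symm
  rw [mul_assoc, Finset.mul_sum]
  congr 1
  refine Finset.sum_congr rfl fun k hk => ?_
  have hk' := Nat.lt_succ_iff.1 (Finset.mem_range.1 hk)
  have h1 := hB k
  have h2 := hP k hk'
  have h3 := hQ k hk'
  have h4 := (Nat.cast_ne_zero (R := ℂ)).2 k.factorial_ne_zero
  field_simp

/-- What multiplies (-n)_k/k! is a constant times a polynomial in k of degree at most j + (n - 1 -
j) = n - 1, so an n-th difference kills it. -/
lemma neretin_pairing_zero {z z' : ℂ} {a b : ℝ} (hab : b ≤ a) (hb : -1 / 2 ≤ b) {N n j : ℕ}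
    (hj : j < n) (hP : ∀ k ≤ n, poch (1 - z - N) k ≠ 0) (hQ : ∀ k ≤ n, poch (1 - z' - N) k ≠ 0)
    (hpole : ∀ m : ℕ, decay z z' b N - 2 * n + 1 ≠ -m)
    (hs : (n + j : ℝ) < (decay z z' b N).re) :
    HasSum (fun x : ℕ => (neretin z z' a b N n).eval (hat a b x : ℂ) *
      (dualPoly a b z' N j).eval (hat a b x : ℂ) * weightC z z' a b N x) 0 := by
  have h := neretin_pairing hab hb N n j hP hQ hs
  set R : ℂ[X] := (ascPochhammer ℂ j).comp (C (1 - z' - N) + X) *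
    (ascPochhammer ℂ (n - 1 - j)).comp (C (decay z z' b N - n + 1) - X) with hR
  have hdeg : R.natDegree < n := by
    have h1 := natDegree_ascPochhammer_comp_le j
      (show (C (1 - z' - N) + X : ℂ[X]).natDegree ≤ 1 by compute_degree)
    have h2 := natDegree_ascPochhammer_comp_le (n - 1 - j)
      (show (C (decay z z' b N - n + 1) - X : ℂ[X]).natDegree ≤ 1 by compute_degree)
    have h3 := natDegree_mul_le (p := (ascPochhammer ℂ j).comp (C (1 - z' - N) + X))
      (q := (ascPochhammer ℂ (n - 1 - j)).comp (C (decay z z' b N - n + 1) - X))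
    rw [hR]
    omega
  have hsum : ∑ k ∈ Finset.range (n + 1), poch (-(n : ℂ)) k / (k.factorial : ℂ) *
          (poch (1 - z' - N + k) j *
            ((-1) ^ k * poch (n - decay z z' b N) k * Complex.Gamma (decay z z' b N - k - j))) =
      Complex.Gamma (decay z z' b N - n + 1) *
        ∑ k ∈ Finset.range (n + 1), poch (-(n : ℂ)) k / (k.factorial : ℂ) * R.eval (k : ℂ) := by
    rw [Finset.mul_sum]
    refine Finset.sum_congr rfl fun k hk => ?_
    rw [poch_mul_Gamma_of_lt hj (Nat.lt_succ_iff.1 (Finset.mem_range.1 hk)) hpole]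
    simp only [hR, eval_mul, eval_comp, eval_add, eval_sub, eval_C, eval_X, poch]
    ring_nf
  rwa [hsum, sum_poch_neg_mul_eval hdeg, mul_zero, mul_zero] at h

/-- Here the polynomial has degree at most n and is divided by s - n - k; the difference formula
with a simple pole evaluates it at k = s - n, where 1 - z' - N + k becomes z + b + N - n. -/
lemma neretin_pairing_self {z z' : ℂ} {a b : ℝ} (hab : b ≤ a) (hb : -1 / 2 ≤ b) {N n : ℕ}
    (hP : ∀ k ≤ n, poch (1 - z - N) k ≠ 0) (hQ : ∀ k ≤ n, poch (1 - z' - N) k ≠ 0)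
    (hs : (n + n : ℝ) < (decay z z' b N).re) :
    HasSum (fun x : ℕ => (neretin z z' a b N n).eval (hat a b x : ℂ) *
      (dualPoly a b z' N n).eval (hat a b x : ℂ) * weightC z z' a b N x)
      (poch (1 + a) n * poch (1 - z - N) n * poch (1 - z' - N) n /
        poch (n - decay z z' b N) n * pairConst z z' a b N n *
        (Complex.Gamma (decay z z' b N - n + 1) * (poch (z + b + N - n) n *
          ((-1) ^ n * n.factorial *
            (∏ i ∈ Finset.range (n + 1), (decay z z' b N - n - i))⁻¹)))) := by
  have h := neretin_pairing hab hb N n n hP hQ hs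
  have hpole : ∀ k ≤ n, ∀ m : ℕ, decay z z' b N - n - k ≠ -m := fun k hk m h => by
    have := congrArg Complex.re h
    have hk' : (k : ℝ) ≤ n := by exact_mod_cast hk
    have h0 : (0 : ℝ) ≤ m := m.cast_nonneg
    simp only [Complex.sub_re, Complex.neg_re, Complex.natCast_re] at this
    linarith
  set R : ℂ[X] := (ascPochhammer ℂ n).comp (C (1 - z' - N) + X) with hR
  have hdeg : R.natDegree ≤ n := natDegree_ascPochhammer_comp_le n
      (show (C (1 - z' - N) + X : ℂ[X]).natDegree ≤ 1 by compute_degree)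
  have hsum : ∑ k ∈ Finset.range (n + 1), poch (-(n : ℂ)) k / (k.factorial : ℂ) *
          (poch (1 - z' - N + k) n *
            ((-1) ^ k * poch (n - decay z z' b N) k * Complex.Gamma (decay z z' b N - k - n))) =
      Complex.Gamma (decay z z' b N - n + 1) *
        ∑ k ∈ Finset.range (n + 1), poch (-(n : ℂ)) k / (k.factorial : ℂ) *
          (R.eval (k : ℂ) * (decay z z' b N - n - k)⁻¹) := by
    rw [Finset.mul_sum]
    refine Finset.sum_congr rfl fun k hk => ?_
    rw [poch_mul_Gamma_self (hpole k (Nat.lt_succ_iff.1 (Finset.mem_range.1 hk)))]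
    simp only [hR, eval_comp, eval_add, eval_C, eval_X, poch]
    ring
  rw [hsum, sum_poch_neg_mul_eval_div hdeg fun i hi => by simpa using hpole i hi 0] at h
  have e : R.eval (decay z z' b N - n) = poch (z + b + N - n) n := by
    simp only [hR, eval_comp, eval_add, eval_C, eval_X, poch, decay, sig]
    ring_nf
  rwa [e] at h

/-- After the index reversal k ↦ N - k, the Pochhammer symbols of 𝔭̃_N complete those of the pairing
to full length N. What remains is free of k except for a polynomial in k of degree N - 2, and no
Gamma value at Σ occurs. -/
lemma tilde_term {z z' : ℂ} {a b : ℝ} {N k j : ℕ}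
    (hk : k ≤ N) (hj : j + 2 ≤ N) (hsig : -1 < (sig z z' b).re) :
    poch (-(N : ℂ) - a) k * poch z k * poch z' k / poch (sig z z' b + 1) k *
      ((-1) ^ (N - k) * (poch (1 + a) (N - k) * poch (1 - z - N) (N - k) *
        poch (1 - z' - N) (N - k)) * poch (1 - z' - N + (N - k : ℕ)) j *
          Complex.Gamma (decay z z' b N - (N - k : ℕ) - j)) =
    (-1) ^ (N + j) * poch (1 + a) N * poch z N * poch z' N * Complex.Gamma (sig z z' b + 1) *
      (poch (z' + k - j) j * poch (sig z z' b + 1 + k) (N - 2 - j)) := by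
  obtain ⟨m, rfl⟩ := Nat.exists_eq_add_of_le hk
  rw [Nat.add_sub_cancel_left]
  have hpole : ∀ l : ℕ, sig z z' b + 1 ≠ -l := fun l h => by
    have := congrArg Complex.re h
    have h0 : (0 : ℝ) ≤ l := l.cast_nonneg
    simp only [Complex.add_re, Complex.one_re, Complex.neg_re, Complex.natCast_re] at this
    linarith
  have e1 := poch_reflect k (1 + a + m)
  rw [show (1 - (1 + a + m) - k : ℂ) = -((k + m : ℕ) : ℂ) - a by push_cast; ring] at e1
  have e2 : ∀ z : ℂ, poch (1 - z - (k + m : ℕ)) m = (-1) ^ m * poch (z + k) m := fun z => by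
    rw [← poch_reflect m (z + k)]; push_cast; ring_nf
  have e3 := poch_reflect j (z' + k - j)
  rw [show 1 - (z' + k - j) - j = 1 - z' - (k + m : ℕ) + m by push_cast; ring] at e3
  have e4 : poch (1 + a : ℂ) (k + m) = _ := (add_comm k m ▸ poch_add (1 + a : ℂ) m k :)
  have e5 : ∀ z : ℂ, poch z (k + m) = poch z k * poch (z + k) m := fun z => poch_add z k m
  have e6 := poch_eq_Gamma_div _ k hpole
  have hpole2 : ∀ l : ℕ, sig z z' b + 1 + k ≠ -l := fun l h => hpole (k + l) (by
    push_cast; linear_combination h)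
  have e7 := poch_eq_Gamma_div _ (k + m - 2 - j) hpole2
  have hc : ((k + m - 2 - j : ℕ) : ℂ) = k + m - 2 - j := by
    rw [Nat.sub_sub, Nat.cast_sub (by omega)]; push_cast; ring
  rw [hc, show sig z z' b + 1 + k + (k + m - 2 - j : ℂ) = decay z z' b (k + m) - m - j by
    rw [decay]; push_cast; ring] at e7
  have g1 := Complex.Gamma_ne_zero hpole
  have g2 := Complex.Gamma_ne_zero hpole2
  rw [e1, e2, e2, e3, e4, e5, e5, e6, e7]
  have s1 : ((-1 : ℂ) ^ k) * (-1) ^ k = 1 := by rw [← mul_pow]; simp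
  have s2 : ((-1 : ℂ) ^ m) * (-1) ^ m = 1 := by rw [← mul_pow]; simp
  rw [pow_add, pow_add]
  generalize Complex.Gamma (sig z z' b + 1) = G1 at *
  generalize Complex.Gamma (sig z z' b + 1 + k) = G2 at *
  generalize (-1 : ℂ) ^ m = e at *
  generalize (-1 : ℂ) ^ k = f at *
  field_simp
  linear_combination (f * e * poch (1 + a + m) k * poch z k * poch z' k * poch (1 + a) m *
    poch (z + k) m * poch (z' + k) m * poch (z' + k - j) j *
      Complex.Gamma (decay z z' b (k + m) - m - j)) * s2

end ZMeas

namespace ZMeas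

/-! ### Orthogonality of 𝔭̃_N, monicity, and the squared norm -/

/-- A polynomial in k of degree N - 2 has zero N-th difference. All pairings converge for Σ > -1,
because N + j ≤ 2N - 2 < Σ + 2N - 1. -/
lemma neretinTilde_pairing_zero {z z' : ℂ} {a b : ℝ} (hab : b ≤ a) (hb : -1 / 2 ≤ b) {N j : ℕ}
    (hj : j + 2 ≤ N) (hsig : -1 < (sig z z' b).re) :
    HasSum (fun x : ℕ => (neretinTilde z z' a b N).eval (hat a b x : ℂ) *
      (dualPoly a b z' N j).eval (hat a b x : ℂ) * weightC z z' a b N x) 0 := by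
  have hjN : (j + 2 : ℝ) ≤ N := by exact_mod_cast hj
  have hre : (decay z z' b N).re = (sig z z' b).re + 2 * N - 1 := by simp [decay]
  have h := hasSum_sum (s := Finset.range (N + 1)) fun k hk =>
    (latticePoly_pairing (z := z) (z' := z') hab hb N (N - k) j (by
      have : ((N - k : ℕ) : ℝ) ≤ N := by exact_mod_cast Nat.sub_le N k
      linarith)).mul_left
      (poch (-(N : ℂ)) k * poch (-(N : ℂ) - a) k * poch z k * poch z' k /
        (poch (sig z z' b + 1) k * (k.factorial : ℂ)) * (-1) ^ N)
  have h2 := h.congr_fun (g := fun x : ℕ => (neretinTilde z z' a b N).eval (hat a b x : ℂ) *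
      (dualPoly a b z' N j).eval (hat a b x : ℂ) * weightC z z' a b N x) fun x => by
    rw [neretinTilde, eval_finsetSum, mul_assoc, Finset.sum_mul]
    refine Finset.sum_congr rfl fun k _ => ?_
    rw [eval_mul, eval_C]
    ring
  refine hasSum_of_eq h2 ?_
  set R : ℂ[X] := (ascPochhammer ℂ j).comp (C (z' - j) + X) *
    (ascPochhammer ℂ (N - 2 - j)).comp (C (sig z z' b + 1) + X) with hR
  have hdeg : R.natDegree < N := by
    have h1 := natDegree_ascPochhammer_comp_le j
      (show (C (z' - j) + X : ℂ[X]).natDegree ≤ 1 by compute_degree)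
    have h2 := natDegree_ascPochhammer_comp_le (N - 2 - j)
      (show (C (sig z z' b + 1) + X : ℂ[X]).natDegree ≤ 1 by compute_degree)
    have h3 := natDegree_mul_le (p := (ascPochhammer ℂ j).comp (C (z' - j) + X))
      (q := (ascPochhammer ℂ (N - 2 - j)).comp (C (sig z z' b + 1) + X))
    rw [hR]
    omega
  set c : ℂ := (-1) ^ N * pairConst z z' a b N j * ((-1) ^ (N + j) * poch (1 + a) N * poch z N *
    poch z' N * Complex.Gamma (sig z z' b + 1)) with hc
  have h0 := sum_poch_neg_mul_eval hdeg
  rw [← mul_zero c, ← h0, Finset.mul_sum]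
  refine Finset.sum_congr rfl fun k hk => ?_
  have ht := tilde_term (z := z) (z' := z') (a := a)
    (Nat.lt_succ_iff.1 (Finset.mem_range.1 hk)) hj hsig
  have hev : R.eval (k : ℂ) = poch (z' + k - j) j * poch (sig z z' b + 1 + k) (N - 2 - j) := by
    simp only [hR, eval_mul, eval_comp, eval_add, eval_C, eval_X, poch]
    ring_nf
  rw [hev, hc]
  simp only [div_eq_mul_inv, mul_inv] at ht ⊢
  linear_combination ((-1) ^ N * pairConst z z' a b N j * poch (-(N : ℂ)) k *
    (k.factorial : ℂ)⁻¹) * ht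

lemma neretin_monic {z z' : ℂ} {a b : ℝ} (ha : -1 < a) {N n : ℕ}
    (hP : poch (1 - z - N) n ≠ 0) (hQ : poch (1 - z' - N) n ≠ 0)
    (hpole : ∀ m : ℕ, decay z z' b N - 2 * n + 1 ≠ -m) :
    (neretin z z' a b N n).Monic ∧ (neretin z z' a b N n).natDegree = n := by
  have hB : poch (1 + a) n ≠ 0 := by
    have := poch_ne_zero _ n (ne_neg_of_pos (show 0 < 1 + a by linarith))
    push_cast at this
    exact this
  have hd : ((n : ℂ) + 1 - 2 * N - sig z z' b) = n - decay z z' b N := by rw [decay]; ring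
  have hD : poch (n - decay z z' b N) n ≠ 0 := by
    have h := poch_reflect n (decay z z' b N - 2 * n + 1)
    rw [show 1 - (decay z z' b N - 2 * n + 1) - n = n - decay z z' b N by ring] at h
    rw [h]
    exact mul_ne_zero (by simp) (poch_ne_zero _ _ hpole)
  have e : neretin z z' a b N n = ∑ k ∈ Finset.range (n + 1),
      C (poch (1 + a) n * poch (1 - z - N) n * poch (1 - z' - N) n /
        poch (n - decay z z' b N) n * (poch (-(n : ℂ)) k * poch (n - decay z z' b N) k /
        (poch (1 + a) k * poch (1 - z - N) k * poch (1 - z' - N) k * (k.factorial : ℂ)))) *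
      nodePoly (fun j => ((j : ℂ) + (eps a b : ℂ)) ^ 2) k := by
    rw [neretin, hd, Finset.mul_sum]
    refine Finset.sum_congr rfl fun k _ => ?_
    rw [latticePoly_eq_nodePoly, C_mul, mul_assoc (C _) (C _)]
  rw [e]
  refine monic_sum_nodePoly _ _ n ?_
  have h1 := poch_neg_div_factorial (le_refl n)
  have hf := (Nat.cast_ne_zero (R := ℂ)).2 n.factorial_ne_zero
  rw [Nat.choose_self, Nat.cast_one, mul_one, div_eq_iff hf] at h1
  rw [h1]
  field_simp

/-- The top degree comes from the term k = 0 alone, and its factor (-1)^N offsets the sign of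
`latticePoly`. -/
lemma neretinTilde_monic (z z' : ℂ) (a b : ℝ) (N : ℕ) :
    (neretinTilde z z' a b N).Monic ∧ (neretinTilde z z' a b N).natDegree = N := by
  have e : neretinTilde z z' a b N = ∑ k ∈ Finset.range (N + 1),
      C (poch (-(N : ℂ)) (N - k) * poch (-(N : ℂ) - a) (N - k) * poch z (N - k) *
        poch z' (N - k) / (poch (sig z z' b + 1) (N - k) * ((N - k).factorial : ℂ)) * (-1) ^ N) *
      nodePoly (fun j => ((j : ℂ) + (eps a b : ℂ)) ^ 2) k := by
    rw [neretinTilde, ← Finset.sum_flip]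
    refine Finset.sum_congr rfl fun k hk => ?_
    rw [Nat.sub_sub_self (Nat.lt_succ_iff.1 (Finset.mem_range.1 hk))]
    rfl
  rw [e]
  refine monic_sum_nodePoly _ _ N ?_
  simp [poch]

/-- Gamma bookkeeping: (-1)^n times the value in `neretin_pairing_self` at level n + 1, with
Pochhammer symbols turned into Gamma quotients. -/
lemma normTop_eq {z z' : ℂ} {a b : ℝ} (ha : -1 < a) {n : ℕ} (hsig : -1 < (sig z z' b).re) :
    (-1) ^ n * (poch (1 + a) n * poch (1 - z - (n + 1 : ℕ)) n * poch (1 - z' - (n + 1 : ℕ)) n /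
      poch (n - decay z z' b (n + 1)) n * pairConst z z' a b (n + 1) n *
        (Complex.Gamma (decay z z' b (n + 1) - n + 1) * (poch (z + b + (n + 1 : ℕ) - n) n *
          ((-1) ^ n * n.factorial *
            (∏ i ∈ Finset.range (n + 1), (decay z z' b (n + 1) - n - i))⁻¹)))) =
      normTop z z' a b (n + 1) := by
  have hdec : decay z z' b (n + 1) = sig z z' b + 2 * n + 1 := by rw [decay]; push_cast; ring
  have hpole1 : ∀ m : ℕ, sig z z' b + 1 ≠ -m := fun m h => by
    have := congrArg Complex.re h
    have h0 : (0 : ℝ) ≤ m := m.cast_nonneg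
    simp only [Complex.add_re, Complex.neg_re, Complex.natCast_re, Complex.one_re] at this
    linarith
  have hpole2 : ∀ m : ℕ, sig z z' b + 2 ≠ -m := fun m h => hpole1 (m + 1) (by
    push_cast; linear_combination h)
  have hprod : ∏ i ∈ Finset.range (n + 1), (decay z z' b (n + 1) - n - i) =
      Complex.Gamma (sig z z' b + 1 + (n + 1)) / Complex.Gamma (sig z z' b + 1) := by
    have h := poch_eq_Gamma_div _ (n + 1) hpole1
    push_cast at h
    rw [← h, poch_eq_prod, ← Finset.prod_range_reflect]
    refine Finset.prod_congr rfl fun i hi => ?_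
    have : i ≤ n := Nat.lt_succ_iff.1 (Finset.mem_range.1 hi)
    rw [hdec, show n + 1 - 1 - i = n - i by omega]
    push_cast [this]
    ring
  have hD : poch (n - decay z z' b (n + 1)) n = (-1) ^ n *
      (Complex.Gamma (sig z z' b + 1 + (n + 1)) / Complex.Gamma (sig z z' b + 2)) := by
    have h := poch_eq_Gamma_div _ n hpole2
    rw [show sig z z' b + 2 + n = sig z z' b + 1 + (n + 1) by ring] at h
    rw [← h, ← poch_reflect, hdec]
    ring_nf
  have hA := poch_eq_Gamma_div _ n (ne_neg_of_pos (show 0 < 1 + a by linarith))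
  have hA0 := Complex.Gamma_ne_zero (ne_neg_of_pos (show 0 < 1 + a by linarith))
  push_cast at hA hA0
  have hPi := inv_Gamma_sub_nat (z + (n + 1 : ℕ)) n
  have hQi := inv_Gamma_sub_nat (z' + (n + 1 : ℕ)) n
  have hzb := inv_Gamma_eq_poch_mul (1 + z + b) n
  rw [show z + ((n + 1 : ℕ) : ℂ) - n = 1 + z by push_cast; ring, ← sub_sub] at hPi
  rw [show z' + ((n + 1 : ℕ) : ℂ) - n = 1 + z' by push_cast; ring, ← sub_sub] at hQi
  have g1 := Complex.Gamma_ne_zero hpole1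
  have g2 := Complex.Gamma_ne_zero hpole2
  have g3 : Complex.Gamma (sig z z' b + 1 + (n + 1)) ≠ 0 :=
    Complex.Gamma_ne_zero fun m h => hpole1 (n + 1 + m) (by push_cast; linear_combination h)
  have s1 : ((-1 : ℂ) ^ n) * (-1) ^ n = 1 := by rw [← mul_pow]; simp
  rw [hprod, hD, hA, pairConst, normTop]
  simp only [mul_inv, hPi, hQi, hzb, hdec, div_eq_mul_inv]
  rw [show z + b + ((n + 1 : ℕ) : ℂ) - n = 1 + z + b by push_cast; ring,
    show b + z' + ((n + 1 : ℕ) : ℂ) - n = 1 + z' + b by push_cast; ring,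
    show b + z + ((n + 1 : ℕ) : ℂ) = 1 + z + b + n by push_cast; ring,
    show a + sig z z' b + 2 * ((n + 1 : ℕ) : ℂ) - n = ((n + 1 : ℕ) : ℂ) + sig z z' b + a + 1 by
      push_cast; ring,
    show sig z z' b + 2 * n + 1 - n + 1 = sig z z' b + 1 + (n + 1) by ring,
    show ((n + 1 : ℕ) : ℂ) + sig z z' b + 1 = sig z z' b + 1 + (n + 1) by push_cast; ring,
    show 1 + a + n = ((n + 1 : ℕ) : ℂ) + a by push_cast; ring,
    show ((n + 1 : ℕ) : ℂ) = n + 1 by push_cast; ring, Complex.Gamma_nat_eq_factorial,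
    add_comm (a : ℂ) 1]
  generalize Complex.Gamma (sig z z' b + 1 + (n + 1)) = T at *
  generalize Complex.Gamma (sig z z' b + 1) = S1 at *
  generalize Complex.Gamma (sig z z' b + 2) = S2 at *
  generalize Complex.Gamma (1 + a) = G at *
  generalize (-1 : ℂ) ^ n = e at *
  generalize (Complex.Gamma (z + (n + 1)))⁻¹ = X1
  generalize (Complex.Gamma (z' + (n + 1)))⁻¹ = X2
  generalize (Complex.Gamma (1 + z + b + n))⁻¹ = X3
  generalize (Complex.Gamma (1 + z' + b))⁻¹ = X4
  generalize (Complex.Gamma ((n : ℂ) + 1 + sig z z' b + a + 1))⁻¹ = X5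
  have he : e⁻¹ = e := inv_eq_of_mul_eq_one_right s1
  have hT : T * T⁻¹ = 1 := mul_inv_cancel₀ g3
  have hG : G * G⁻¹ = 1 := mul_inv_cancel₀ hA0
  rw [he, inv_inv, inv_inv]
  generalize T⁻¹ = T' at *
  generalize G⁻¹ = G' at *
  generalize Complex.Gamma ((n : ℂ) + 1 + a) = H
  generalize poch (1 - z - (n + 1)) n = p
  generalize poch (1 - z' - (n + 1)) n = q
  generalize poch (1 + z + b) n = r
  linear_combination (1 / 2 * H * p * q * S1 * S2 * r * n.factorial * X1 * X2 * X3 * X4 * X5 *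
    e ^ 2 * T') * (G * G' * T * T' * s1 + T * T' * hG + hT)


/-- The squared norm of `𝔭_{N-1}`. -/
lemma neretin_norm {z z' : ℂ} {a b : ℝ} (hab : b ≤ a) (hb : -1 / 2 ≤ b) {N : ℕ} (hN : 1 ≤ N)
    (hP : ∀ k ≤ N, poch (1 - z - N) k ≠ 0) (hQ : ∀ k ≤ N, poch (1 - z' - N) k ≠ 0)
    (hsig : -1 < (sig z z' b).re) :
    HasSum (fun x : ℕ => (neretin z z' a b N (N - 1)).eval (hat a b x : ℂ) ^ 2 *
      weightC z z' a b N x) (normTop z z' a b N) := by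
  obtain ⟨n, rfl⟩ : ∃ n, N = n + 1 := ⟨N - 1, by omega⟩
  rw [Nat.add_sub_cancel]
  have hre : (decay z z' b (n + 1)).re = (sig z z' b).re + 2 * n + 1 := by
    simp [decay]; ring
  have hdec : decay z z' b (n + 1) = sig z z' b + 2 * n + 1 := by rw [decay]; push_cast; ring
  have hpole1 : ∀ m : ℕ, sig z z' b + 1 ≠ -m := fun m h => by
    have := congrArg Complex.re h
    have h0 : (0 : ℝ) ≤ m := m.cast_nonneg
    simp only [Complex.add_re, Complex.neg_re, Complex.natCast_re, Complex.one_re] at this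
    linarith
  have hpole2 : ∀ m : ℕ, sig z z' b + 2 ≠ -m := fun m h => hpole1 (m + 1) (by
    push_cast; linear_combination h)
  have hpole : ∀ m : ℕ, decay z z' b (n + 1) - 2 * n + 1 ≠ -m := fun m h => hpole2 m (by
    rw [← h, hdec]; ring)
  have hmon := neretin_monic (z := z) (z' := z') (a := a) (b := b) (show -1 < a by linarith)
    (hP n (by omega)) (hQ n (by omega)) hpole
  set p := neretin z z' a b (n + 1) n with hp
  set ψ := dualPoly a b z' (n + 1) n with hψ
  -- Both polynomials are monic of degree n, so their difference is orthogonal to 𝔭_n and the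
  -- squared norm equals (-1)^n ⟨𝔭_n, ψ_n⟩.
  have hlow : (p - C ((-1) ^ n) * ψ).degree < (n : WithBot ℕ) := by
    have h1 : p.degree = n := by rw [degree_eq_natDegree hmon.1.ne_zero, hmon.2]
    have h2 : (C ((-1 : ℂ) ^ n) * ψ).degree = n := by
      rw [degree_C_mul (by simp), hψ, dualPoly, degree_nodePoly]
    rw [← h1]
    refine degree_sub_lt_left (by rw [h1, h2]) hmon.1.ne_zero ?_
    rw [hmon.1.leadingCoeff, leadingCoeff, natDegree_eq_of_degree_eq_some h2, coeff_C_mul, hψ,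
      dualPoly, coeff_nodePoly_self, ← mul_pow]
    simp
  have h1 := hasSum_zero_of_nodePoly (u := fun x => (hat a b x : ℂ))
    (w := fun x => p.eval (hat a b x : ℂ) * weightC z z' a b (n + 1) x) (n := n)
    (fun j hj => (neretin_pairing_zero hab hb hj (fun k hk => hP k (by omega))
      (fun k hk => hQ k (by omega)) hpole (by
        have : (j + 1 : ℝ) ≤ n := by exact_mod_cast hj
        rw [hre]; linarith)).congr_fun fun x => mul_right_comm _ _ _) _ hlow
  have h2 := (neretin_pairing_self (z := z) (z' := z') (N := n + 1) (n := n) hab hb (fun k hk => hP k (by omega))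
    (fun k hk => hQ k (by omega)) (by rw [hre]; linarith)).mul_left ((-1) ^ n)
  have h3 := (h1.add h2).congr_fun (g := fun x : ℕ => p.eval (hat a b x : ℂ) ^ 2 *
      weightC z z' a b (n + 1) x) fun x => by
    simp only [eval_sub, eval_mul, eval_C]
    ring
  exact hasSum_of_eq h3 (by rw [zero_add, normTop_eq (by linarith) hsig])

end ZMeas

namespace ZMeas

/-! ### Determinantal point processes with a projection kernel -/

/-- Integrating out one variable in the determinant of a projection kernel of rank `r`. -/
lemma hasSum_det_cons {K : ℕ → ℕ → ℂ} {r : ℂ}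
    (hR : ∀ x x', HasSum (fun y => K x y * K y x') (K x x'))
    (hT : HasSum (fun y => K y y) r) {m : ℕ} (x : Fin m → ℕ) :
    HasSum (fun y => Matrix.det (Matrix.of fun i j : Fin (m + 1) =>
        K ((Fin.cons y x : Fin (m + 1) → ℕ) i) ((Fin.cons y x : Fin (m + 1) → ℕ) j)))
      ((r - m) * Matrix.det (Matrix.of fun i j : Fin m => K (x i) (x j))) := by
  classical
  set v : Equiv.Perm (Fin m) → ℂ := fun e =>
    ((Equiv.Perm.sign e : ℤ) : ℂ) * ∏ i, K (x (e i)) (x i) with hv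
  -- Permutations of m + 1 letters are split by the image p of 0. If p = 0, the new variable enters
  -- through K(y, y) and yields r; each of the other m choices inserts y into a cycle, contributes a
  -- sign, and is contracted by the reproducing property. Altogether r - m.
  have hterm : ∀ (p : Fin (m + 1)) (e : Equiv.Perm (Fin m)),
      HasSum (fun y => ((Equiv.Perm.sign (Equiv.Perm.decomposeFin.symm (p, e)) : ℤ) : ℂ) *
        ∏ i, K ((Fin.cons y x : Fin (m + 1) → ℕ) (Equiv.Perm.decomposeFin.symm (p, e) i))
          ((Fin.cons y x : Fin (m + 1) → ℕ) i)) ((if p = 0 then r else -1) * v e) := by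
    intro p e
    rw [Equiv.Perm.decomposeFin.symm_sign]
    simp only [Fin.prod_univ_succ, Equiv.Perm.decomposeFin_symm_apply_zero,
      Equiv.Perm.decomposeFin_symm_apply_succ, Fin.cons_zero, Fin.cons_succ]
    rcases Fin.eq_zero_or_eq_succ p with rfl | ⟨j, rfl⟩
    · simp only [if_true, Equiv.swap_self, Equiv.refl_apply, Fin.cons_zero, Fin.cons_succ]
      refine (hT.mul_right (v e)).congr_fun fun y => ?_
      simp only [hv, one_mul]
      ring
    · set i₀ := e.symm j with hi₀
      have hj : j = e i₀ := by simp [hi₀]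
      have hprod : ∀ y, ∏ i, K ((Fin.cons y x : Fin (m + 1) → ℕ)
          (Equiv.swap 0 j.succ (e i).succ)) (x i) =
          K y (x i₀) * ∏ i ∈ Finset.univ.erase i₀, K (x (e i)) (x i) := fun y => by
        rw [← Finset.mul_prod_erase _ _ (Finset.mem_univ i₀)]
        congr 1
        · rw [← hj, Equiv.swap_apply_right, Fin.cons_zero]
        · refine Finset.prod_congr rfl fun i hi => ?_
          rw [Equiv.swap_apply_of_ne_of_ne (Fin.succ_ne_zero _), Fin.cons_succ]
          rw [hj]
          exact fun h => (Finset.mem_erase.1 hi).1 (e.injective (Fin.succ_injective _ h))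
      simp only [hprod, Fin.succ_ne_zero, if_false, Fin.cons_succ]
      have h := ((hR (x j) (x i₀)).mul_right
        (-((Equiv.Perm.sign e : ℤ) : ℂ) * ∏ i ∈ Finset.univ.erase i₀, K (x (e i)) (x i)))
      have hval : K (x j) (x i₀) * (-((Equiv.Perm.sign e : ℤ) : ℂ) *
          ∏ i ∈ Finset.univ.erase i₀, K (x (e i)) (x i)) = -1 * v e := by
        simp only [hv]
        rw [← Finset.mul_prod_erase _ (fun i => K (x (e i)) (x i)) (Finset.mem_univ i₀), ← hj]
        ring
      rw [hval] at h
      refine h.congr_fun fun y => ?_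
      push_cast
      ring
  have hsum := hasSum_sum (s := Finset.univ) fun (q : Fin (m + 1) × Equiv.Perm (Fin m)) _ =>
    hterm q.1 q.2
  have hval : ∑ q : Fin (m + 1) × Equiv.Perm (Fin m), (if q.1 = 0 then r else -1) * v q.2 =
      (r - m) * Matrix.det (Matrix.of fun i j : Fin m => K (x i) (x j)) := by
    rw [Fintype.sum_prod_type, Fin.sum_univ_succ]
    simp only [if_true, Fin.succ_ne_zero, if_false, ← Finset.mul_sum, Finset.sum_const,
      Finset.card_univ, Fintype.card_fin, Matrix.det_apply', Matrix.of_apply, hv]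
    rw [nsmul_eq_mul]
    ring
  rw [← hval]
  refine hsum.congr_fun fun y => ?_
  rw [Matrix.det_apply', ← Equiv.sum_comp Equiv.Perm.decomposeFin.symm]
  rfl

lemma measurableSet_forall_mem (a b : ℝ) {m : ℕ} (x : Fin m → ℕ) :
    MeasurableSet {X : Conf a b | ∀ i, pt a b (x i) ∈ X} := by
  have : {X : Conf a b | ∀ i, pt a b (x i) ∈ X} = ⋂ i, {X | pt a b (x i) ∈ X} := by ext; simp
  rw [this]
  exact MeasurableSet.iInter fun i => measurableSet_mem_finset _

lemma tsum_indicator_mem {a b : ℝ} (h : 0 ≤ eps a b) (X : Conf a b) :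
    ∑' y, Set.indicator {X : Conf a b | pt a b y ∈ X} (1 : Conf a b → ENNReal) X =
      (X.card : ENNReal) := by
  have h1 := (Equiv.ofBijective _ (pt_bijective h)).tsum_eq
    (fun p => Set.indicator (X : Set (HalfLattice a b)) (1 : HalfLattice a b → ENNReal) p)
  have h2 : ∑' y, Set.indicator {X : Conf a b | pt a b y ∈ X} (1 : Conf a b → ENNReal) X =
      ∑' p, Set.indicator (X : Set (HalfLattice a b)) (1 : HalfLattice a b → ENNReal) p := by
    rw [← h1]
    rfl
  rw [h2, tsum_eq_sum (s := X) fun p hp => by simp [hp],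
    Finset.sum_congr rfl fun p hp => show _ = (1 : ENNReal) by simp [hp]]
  simp

/-- Summing the correlation functions of a simple `N`-point process over one variable. -/
lemma hasSum_correlation {a b : ℝ} (h : 0 ≤ eps a b) {N : ℕ} (μ : Measure (Conf a b))
    [IsFiniteMeasure μ] (hcard : ∀ᵐ X ∂μ, X.card = N) {m : ℕ} (x : Fin m → ℕ) :
    HasSum (fun y => μ.real {X | ∀ i, pt a b ((Fin.cons y x : Fin (m + 1) → ℕ) i) ∈ X})
      (N * μ.real {X | ∀ i, pt a b (x i) ∈ X}) := by
  set E := {X : Conf a b | ∀ i, pt a b (x i) ∈ X} with hE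
  have hEm : MeasurableSet E := measurableSet_forall_mem a b x
  have hset : ∀ y, {X : Conf a b | ∀ i, pt a b ((Fin.cons y x : Fin (m + 1) → ℕ) i) ∈ X} =
      {X | pt a b y ∈ X} ∩ E := fun y => by
    ext X
    simp [Fin.forall_fin_succ, hE]
  -- Summing the indicators of y ∈ X over y counts the points of X, of which there are almost surely
  -- N.
  have hsum : ∑' y, μ ({X | pt a b y ∈ X} ∩ E) = N * μ E := by
    have h1 : ∀ y, μ ({X | pt a b y ∈ X} ∩ E) =
        ∫⁻ X in E, Set.indicator {X : Conf a b | pt a b y ∈ X} 1 X ∂μ := fun y => by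
      rw [lintegral_indicator_one (measurableSet_mem_finset _),
        Measure.restrict_apply (measurableSet_mem_finset _)]
    simp_rw [h1]
    rw [← lintegral_tsum fun y => (measurable_one.indicator
      (measurableSet_mem_finset _)).aemeasurable]
    simp_rw [tsum_indicator_mem h]
    rw [lintegral_congr_ae (g := fun _ => (N : ENNReal)), lintegral_const,
      Measure.restrict_apply_univ]
    filter_upwards [ae_restrict_of_ae hcard] with X hX
    rw [hX]
  have hne : ∑' y, μ ({X | pt a b y ∈ X} ∩ E) ≠ ⊤ := by
    rw [hsum]
    exact ENNReal.mul_ne_top (ENNReal.natCast_ne_top N) (measure_ne_top μ E)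
  have h2 := ENNReal.hasSum_toReal hne
  rw [← ENNReal.tsum_toReal_eq fun y => measure_ne_top μ _, hsum, ENNReal.toReal_mul,
    ENNReal.toReal_natCast] at h2
  simp_rw [hset]
  exact h2

/-- A simple `N`-point process whose `N`-point probabilities are proportional to the determinants
of a projection kernel of rank `N` has this kernel as a correlation kernel. -/
theorem isCorrelationKernel_of_projection {a b : ℝ} (h : 0 ≤ eps a b) {N : ℕ}
    (μ : Measure (Conf a b)) [IsProbabilityMeasure μ] (hcard : ∀ᵐ X ∂μ, X.card = N)
    {K : ℕ → ℕ → ℂ} (hR : ∀ x x', HasSum (fun y => K x y * K y x') (K x x'))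
    (hT : HasSum (fun y => K y y) (N : ℂ))
    (hrank : ∀ m, N < m → ∀ x : Fin m → ℕ, Matrix.det (Matrix.of fun i j => K (x i) (x j)) = 0)
    {κ : ℂ} (hN : ∀ x : Fin N → ℕ, Function.Injective x →
      ((μ.real {X | ∀ i, pt a b (x i) ∈ X} : ℝ) : ℂ) =
        κ * Matrix.det (Matrix.of fun i j => K (x i) (x j))) :
    IsCorrelationKernel a b K μ := by
  have hpt := (pt_bijective h).injective
  -- Downward induction on the number of points, from N to N - k.
  have key : ∀ k ≤ N, ∀ x : Fin (N - k) → ℕ, Function.Injective x →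
      ((μ.real {X | ∀ i, pt a b (x i) ∈ X} : ℝ) : ℂ) =
        κ * Matrix.det (Matrix.of fun i j => K (x i) (x j)) := by
    intro k
    induction k with
    | zero => intro _ x hx; exact hN x hx
    | succ k ih =>
      intro hk
      have hm : N - k = (N - (k + 1)) + 1 := by omega
      have ih' := ih (by omega)
      rw [hm] at ih'
      have hmN : ((N - (k + 1) : ℕ) : ℂ) = N - (k + 1) := by push_cast [hk]; ring
      generalize N - (k + 1) = m at *
      intro x hx
      have h1 := (hasSum_correlation h μ hcard x).mapL Complex.ofRealCLM
      have h2 := (hasSum_det_cons hR hT x).mul_left κ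
      set s : Finset ℕ := Finset.univ.image x with hs
      set f : ℕ → ℂ := fun y => Complex.ofRealCLM
        (μ.real {X | ∀ i, pt a b ((Fin.cons y x : Fin (m + 1) → ℕ) i) ∈ X}) with hf
      set g : ℕ → ℂ := fun y => κ * Matrix.det (Matrix.of fun i j : Fin (m + 1) =>
        K ((Fin.cons y x : Fin (m + 1) → ℕ) i) ((Fin.cons y x : Fin (m + 1) → ℕ) j)) with hg
      have hgs : ∀ y ∈ s, g y = 0 := fun y hy => by
        obtain ⟨i, -, rfl⟩ := Finset.mem_image.1 hy
        have : Matrix.det (Matrix.of fun i' j : Fin (m + 1) =>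
            K ((Fin.cons (x i) x : Fin (m + 1) → ℕ) i') ((Fin.cons (x i) x : Fin (m + 1) → ℕ) j))
            = 0 := Matrix.det_zero_of_row_eq (Fin.succ_ne_zero i).symm (by ext j; simp)
        simp only [hg, this, mul_zero]
      have hfs : ∀ y ∈ s, f y = ((μ.real {X | ∀ i, pt a b (x i) ∈ X} : ℝ) : ℂ) := fun y hy => by
        obtain ⟨i, -, rfl⟩ := Finset.mem_image.1 hy
        have : {X : Conf a b | ∀ i', pt a b ((Fin.cons (x i) x : Fin (m + 1) → ℕ) i') ∈ X} =
            {X | ∀ i, pt a b (x i) ∈ X} := by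
          ext X
          simp only [Set.mem_ofPred_eq, Fin.forall_fin_succ, Fin.cons_zero, Fin.cons_succ]
          exact ⟨fun H => H.2, fun H => ⟨H i, H⟩⟩
        simp only [hf, this]
        rfl
      have hfg : ∀ y ∉ s, f y = g y := fun y hy => by
        refine ih' _ (Fin.cons_injective_iff.2 ⟨fun ⟨i, hi⟩ => hy ?_, hx⟩)
        exact Finset.mem_image.2 ⟨i, Finset.mem_univ i, hi⟩
      -- The two families agree except at the m points of `x`. There the determinant has two equal
      -- rows and vanishes, while the event reduces to containing `x`. Comparing totals, N ρ - (N -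
      -- m) κ det = m ρ, where ρ is the probability for `x`.
      have h3 := h1.sub h2
      have h4 : HasSum (fun y => f y - g y) (∑ y ∈ s, (f y - g y)) :=
        hasSum_sum_of_ne_finset_zero fun y hy => sub_eq_zero.2 (hfg y hy)
      have h5 := h3.unique h4
      rw [Finset.sum_congr rfl fun y hy => by rw [hfs y hy, hgs y hy, sub_zero],
        Finset.sum_const, hs, Finset.card_image_of_injective _ hx, Finset.card_univ,
        Fintype.card_fin, nsmul_eq_mul] at h5
      have h6 : ((N : ℂ) - m) ≠ 0 := by
        rw [hmN, sub_sub_cancel]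
        exact_mod_cast Nat.succ_ne_zero k
      apply mul_left_cancel₀ h6
      simp only [Complex.ofRealCLM_apply] at h5
      push_cast at h5
      linear_combination h5
  -- With no points, both the probability and the empty determinant are 1.
  have hκ : κ = 1 := by
    have := key N le_rfl
    rw [Nat.sub_self] at this
    have h0 := this Fin.elim0 (fun i => i.elim0)
    simpa using h0.symm
  intro m x hx
  rcases le_or_gt m N with hm | hm
  · have := key (N - m) (Nat.sub_le _ _)
    rw [Nat.sub_sub_self hm, hκ] at this
    simpa using this x hx
  · rw [hrank m hm x]
    have : μ {X | ∀ i, pt a b (x i) ∈ X} = 0 := by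
      refine measure_mono_null (fun X hX => ?_) hcard
      intro hc
      have hle : (Finset.univ.image fun i => pt a b (x i)).card ≤ X.card := by
        refine Finset.card_le_card fun p hp => ?_
        obtain ⟨i, -, rfl⟩ := Finset.mem_image.1 hp
        exact hX i
      rw [Finset.card_image_of_injective (f := fun i => pt a b (x i)) _ (hpt.comp hx),
        Finset.card_univ, Fintype.card_fin] at hle
      change X.card = N at hc
      omega
    rw [measureReal_def, this]
    simp

end ZMeas

namespace ZMeas

/-! ### Moments and the Christoffel–Darboux kernel -/

section Moments

variable {u : ℕ → ℝ} {W : ℕ → ℝ} {N : ℕ}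

/-- The matrix of moments of the weight `W` at the nodes `u`. -/
noncomputable def momentMatrix (u W : ℕ → ℝ) (N : ℕ) : Matrix (Fin N) (Fin N) ℂ :=
  Matrix.of fun i j => ∑' x, (u x : ℂ) ^ ((i : ℕ) + j) * (W x : ℂ)

lemma momentMatrix_hasSum (hW : ∀ k < 2 * N - 1, Summable fun x => (u x : ℂ) ^ k * (W x : ℂ))
    (i j : Fin N) :
    HasSum (fun x => (u x : ℂ) ^ (i : ℕ) * (u x : ℂ) ^ (j : ℕ) * (W x : ℂ))
      (momentMatrix u W N i j) := by
  have := (hW (i + j) (by omega)).hasSum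
  simpa only [pow_add, momentMatrix, Matrix.of_apply] using this

lemma hasSum_bilin (hW : ∀ k < 2 * N - 1, Summable fun x => (u x : ℂ) ^ k * (W x : ℂ))
    (c d : Fin N → ℂ) :
    HasSum (fun x => (∑ i, c i * (u x : ℂ) ^ (i : ℕ)) * (∑ j, d j * (u x : ℂ) ^ (j : ℕ)) *
      (W x : ℂ)) (∑ i, ∑ j, c i * d j * momentMatrix u W N i j) := by
  have h := hasSum_sum (s := Finset.univ) fun (i : Fin N) _ =>
    hasSum_sum (s := Finset.univ) fun (j : Fin N) _ =>
      (momentMatrix_hasSum hW i j).mul_left (c i * d j)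
  refine h.congr_fun fun x => ?_
  rw [Finset.sum_mul_sum, Finset.sum_mul]
  refine Finset.sum_congr rfl fun i _ => ?_
  rw [Finset.sum_mul]
  refine Finset.sum_congr rfl fun j _ => ?_
  ring

/-- A null vector v is a polynomial of degree below N whose squared modulus sums to 0 against W. It
vanishes wherever W > 0, in particular at the N distinct nodes with x < N, so v = 0. -/
lemma isUnit_det_momentMatrix (hu : Function.Injective u) (hW0 : ∀ x, 0 ≤ W x)
    (hWpos : ∀ x < N, 0 < W x)
    (hW : ∀ k < 2 * N - 1, Summable fun x => (u x : ℂ) ^ k * (W x : ℂ)) :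
    IsUnit (momentMatrix u W N).det := by
  rw [isUnit_iff_ne_zero]
  intro hdet
  obtain ⟨v, hv0, hv⟩ := Matrix.exists_mulVec_eq_zero_iff.2 hdet
  have h := hasSum_bilin hW (fun i => starRingEnd ℂ (v i)) v
  have hval : ∑ i, ∑ j, starRingEnd ℂ (v i) * v j * momentMatrix u W N i j = 0 := by
    refine Finset.sum_eq_zero fun i _ => ?_
    have := congrFun hv i
    simp only [Matrix.mulVec, dotProduct, Pi.zero_apply] at this
    calc _ = starRingEnd ℂ (v i) * ∑ j, momentMatrix u W N i j * v j := by
          rw [Finset.mul_sum]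
          exact Finset.sum_congr rfl fun j _ => by ring
      _ = 0 := by rw [this, mul_zero]
  rw [hval] at h
  have hterm : ∀ x, (∑ i, starRingEnd ℂ (v i) * (u x : ℂ) ^ (i : ℕ)) *
      (∑ j, v j * (u x : ℂ) ^ (j : ℕ)) * (W x : ℂ) =
      ((Complex.normSq (∑ j, v j * (u x : ℂ) ^ (j : ℕ)) * W x : ℝ) : ℂ) := fun x => by
    have : ∑ i, starRingEnd ℂ (v i) * (u x : ℂ) ^ (i : ℕ) =
        starRingEnd ℂ (∑ j, v j * (u x : ℂ) ^ (j : ℕ)) := by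
      simp [map_sum]
    rw [this, ← Complex.normSq_eq_conj_mul_self]
    push_cast
    rfl
  simp_rw [hterm] at h
  rw [← Complex.ofReal_zero, Complex.hasSum_ofReal] at h
  rw [hasSum_zero_iff_of_nonneg fun x => mul_nonneg (Complex.normSq_nonneg _) (hW0 x)] at h
  have h3 : (Matrix.vandermonde fun i : Fin N => (u i : ℂ)).mulVec v = 0 := by
    ext i
    have := congrFun h i
    simp only [Pi.zero_apply, mul_eq_zero, (hWpos i i.2).ne', or_false,
      Complex.normSq_eq_zero] at this
    simp only [Matrix.mulVec, dotProduct, Matrix.vandermonde_apply, Pi.zero_apply]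
    rw [← this]
    exact Finset.sum_congr rfl fun j _ => mul_comm _ _
  refine hv0 (Matrix.eq_zero_of_mulVec_eq_zero (Matrix.det_vandermonde_ne_zero_iff.2 ?_) h3)
  intro i j hij
  exact Fin.ext (hu (Complex.ofReal_injective hij))

/-- The Christoffel–Darboux quotient `(p(t) q(v) - q(t) p(v)) / (t - v)` is a polynomial in `v`
with the reproducing property, as soon as `q` is the monic orthogonal polynomial of degree `N - 1`
and `p` is monic of degree `N` and orthogonal to the polynomials of degree less than `N - 1`. -/
lemma cdQuotient_reproducing (hN : 1 ≤ N) {p q : ℂ[X]} {h : ℂ} (hpm : p.Monic)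
    (hpd : p.natDegree = N) (hqm : q.Monic) (hqd : q.natDegree = N - 1)
    (hp : ∀ r : ℂ[X], r.degree < (N - 1 : ℕ) →
      HasSum (fun x => p.eval (u x : ℂ) * r.eval (u x : ℂ) * (W x : ℂ)) 0)
    (hq : ∀ r : ℂ[X], r.degree < (N - 1 : ℕ) →
      HasSum (fun x => q.eval (u x : ℂ) * r.eval (u x : ℂ) * (W x : ℂ)) 0)
    (hh : HasSum (fun x => q.eval (u x : ℂ) ^ 2 * (W x : ℂ)) h) (t : ℂ) :
    ∃ B : ℂ[X], B.degree < N ∧ (∀ v, B.eval v = cdQuotient p q t v) ∧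
      ∀ r : ℂ[X], r.degree < N →
        HasSum (fun x => B.eval (u x : ℂ) * r.eval (u x : ℂ) * (W x : ℂ)) (h * r.eval t) := by
  have hdiv : ∀ r : ℂ[X], r = C (r.eval t) + (X - C t) * (r /ₘ (X - C t)) := fun r => by
    conv_lhs => rw [← modByMonic_add_div r (X - C t), modByMonic_X_sub_C_eq_C_eval]
  have hdeg : ∀ r : ℂ[X], r.degree < N → (r /ₘ (X - C t)).degree < (N - 1 : ℕ) := fun r hr => by
    by_cases h0 : r /ₘ (X - C t) = 0
    · rw [h0, degree_zero]; exact WithBot.bot_lt_coe _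
    · have hr0 : r ≠ 0 := fun h => h0 (by rw [h, zero_divByMonic])
      have h1 := natDegree_divByMonic r (monic_X_sub_C t)
      rw [natDegree_X_sub_C] at h1
      have h2 : r.natDegree < N := (natDegree_lt_iff_degree_lt hr0).2 hr
      have h3 : r.natDegree ≠ 0 := fun h3 => h0 <| by
        rw [eq_C_of_natDegree_eq_zero h3]
        exact (divByMonic_eq_zero_iff (monic_X_sub_C t)).2 (by
          rw [degree_X_sub_C]; exact degree_C_le.trans_lt (by norm_num))
      rw [← natDegree_lt_iff_degree_lt h0, h1]
      omega
  have hqdeg : q.degree = (N - 1 : ℕ) := by rw [degree_eq_natDegree hqm.ne_zero, hqd]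
  have hpdeg : p.degree = N := by rw [degree_eq_natDegree hpm.ne_zero, hpd]
  set Gp := p /ₘ (X - C t) with hGp
  set Gq := q /ₘ (X - C t) with hGq
  have ep : p = C (p.eval t) + (X - C t) * Gp := hdiv p
  have eq : q = C (q.eval t) + (X - C t) * Gq := hdiv q
  have hGqd : Gq.degree < (N - 1 : ℕ) := hdeg q (by
    rw [hqdeg]; exact_mod_cast Nat.sub_lt hN one_pos)
  have hGpd : Gp.degree = (N - 1 : ℕ) := by
    have h0 : Gp ≠ 0 := fun h0 => by
      rw [h0, mul_zero, add_zero] at ep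
      have := congrArg natDegree ep
      rw [hpd, natDegree_C] at this
      omega
    rw [degree_eq_natDegree h0, hGp, natDegree_divByMonic p (monic_X_sub_C t), natDegree_X_sub_C,
      hpd]
  have hGpm : Gp.Monic := by
    rw [Monic, hGp, leadingCoeff_divByMonic_X_sub_C p (by
      rw [hpdeg]; exact_mod_cast (by omega : N ≠ 0)) t]
    exact hpm
  set B := Gp * q - Gq * p with hB
  -- The constants p(t) and q(t) drop out of p/(X - t) and q/(X - t) crosswise, so the quotient is
  -- the explicit polynomial `B`.
  have hBF : (X - C t) * B = C (q.eval t) * p - C (p.eval t) * q := by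
    have h1 : (X - C t) * Gp = p - C (p.eval t) := eq_sub_of_add_eq' ep.symm
    have h2 : (X - C t) * Gq = q - C (q.eval t) := eq_sub_of_add_eq' eq.symm
    rw [hB]
    linear_combination q * h1 - p * h2
  have hBd : B.degree < N := by
    have h1 : (C (q.eval t) * p - C (p.eval t) * q).degree ≤ N := by
      rw [C_mul', C_mul']
      refine (degree_sub_le _ _).trans (max_le ((degree_smul_le _ _).trans hpdeg.le)
        ((degree_smul_le _ _).trans ?_))
      rw [hqdeg]
      exact_mod_cast Nat.sub_le N 1
    rw [← hBF, degree_mul, degree_X_sub_C] at h1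
    by_cases hB0 : B = 0
    · rw [hB0, degree_zero]; exact WithBot.bot_lt_coe _
    · rw [degree_eq_natDegree hB0] at h1 ⊢
      have : 1 + B.natDegree ≤ N := by exact_mod_cast h1
      exact_mod_cast (by omega : B.natDegree < N)
  have hder : ∀ r : ℂ[X], r.derivative.eval t = (r /ₘ (X - C t)).eval t := fun r => by
    have h := congrArg (fun s => eval t (derivative s)) (hdiv r)
    simp only [derivative_add, derivative_C, derivative_mul, derivative_sub, derivative_X, eval_add,
      eval_mul, eval_sub, eval_X, eval_C, sub_self, zero_mul, sub_zero,
      one_mul, zero_add, add_zero] at h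
    exact h
  -- `Gp` is monic of the same degree as q, so ⟨Gp, q⟩ = ⟨q, q⟩ = h, while ⟨Gq, p⟩ = 0 because `Gq`
  -- has degree below N - 1. Orthogonality of p to q is never used.
  have hBW : HasSum (fun x => B.eval (u x : ℂ) * (W x : ℂ)) h := by
    have hlow : (Gp - q).degree < (N - 1 : ℕ) := by
      rw [← hGpd]
      exact degree_sub_lt_left (by rw [hGpd, hqdeg]) hGpm.ne_zero
        (by rw [hGpm.leadingCoeff, hqm.leadingCoeff])
    have h1 := ((hq _ hlow).add hh).sub (hp _ hGqd)
    rw [zero_add, sub_zero] at h1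
    refine h1.congr_fun fun x => ?_
    rw [hB]
    simp only [eval_sub, eval_mul]
    ring
  refine ⟨B, hBd, fun v => ?_, fun r hr => ?_⟩
  · unfold cdQuotient
    split_ifs with htv
    · subst htv
      rw [hder p, hder q, hB]
      simp only [eval_sub, eval_mul]
      rfl
    · have h1 := congrArg (eval v) hBF
      simp only [eval_mul, eval_sub, eval_X, eval_C] at h1
      rw [eq_div_iff (sub_ne_zero.2 htv)]
      linear_combination -h1
  -- In r = r(t) + (X - t)S the first part gives h r(t). The second pairs S, of degree below N - 1,
  -- with a combination of p and q and gives 0.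
  · set S := r /ₘ (X - C t) with hS
    have h1 := ((hBW.mul_left (r.eval t)).add ((hp S (hdeg r hr)).mul_left (q.eval t))).sub
      ((hq S (hdeg r hr)).mul_left (p.eval t))
    rw [mul_zero, mul_zero, add_zero, sub_zero, mul_comm] at h1
    refine h1.congr_fun fun x => ?_
    have e1 : r.eval (u x : ℂ) = r.eval t + (u x - t) * S.eval (u x : ℂ) := by
      conv_lhs => rw [hdiv r]
      simp [hS]
    have e2 := congrArg (eval (u x : ℂ)) hBF
    simp only [eval_mul, eval_sub, eval_X, eval_C] at e2
    rw [e1]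
    linear_combination S.eval (u x : ℂ) * W x * e2

/-- The Christoffel–Darboux formula in terms of the inverse moment matrix. -/
lemma cdQuotient_eq (hN : 1 ≤ N) {p q : ℂ[X]} {h : ℂ} (hpm : p.Monic)
    (hpd : p.natDegree = N) (hqm : q.Monic) (hqd : q.natDegree = N - 1)
    (hp : ∀ r : ℂ[X], r.degree < (N - 1 : ℕ) →
      HasSum (fun x => p.eval (u x : ℂ) * r.eval (u x : ℂ) * (W x : ℂ)) 0)
    (hq : ∀ r : ℂ[X], r.degree < (N - 1 : ℕ) →
      HasSum (fun x => q.eval (u x : ℂ) * r.eval (u x : ℂ) * (W x : ℂ)) 0)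
    (hh : HasSum (fun x => q.eval (u x : ℂ) ^ 2 * (W x : ℂ)) h)
    (hW : ∀ k < 2 * N - 1, Summable fun x => (u x : ℂ) ^ k * (W x : ℂ))
    (hM : IsUnit (momentMatrix u W N).det) (t v : ℂ) :
    cdQuotient p q t v =
      h * ∑ i : Fin N, ∑ j : Fin N, t ^ (i : ℕ) * (momentMatrix u W N)⁻¹ i j * v ^ (j : ℕ) := by
  obtain ⟨B, hBd, hBe, hBr⟩ := cdQuotient_reproducing hN hpm hpd hqm hqd hp hq hh t
  have hev : ∀ v, B.eval v = ∑ j : Fin N, B.coeff j * v ^ (j : ℕ) := fun v => by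
    have hlt : B.natDegree < N := by
      by_cases hB0 : B = 0
      · rw [hB0, natDegree_zero]
        exact hN
      · exact (natDegree_lt_iff_degree_lt hB0).2 hBd
    rw [eval_eq_sum_range' hlt v, Finset.sum_range]
  set β : Fin N → ℂ := fun j => B.coeff j with hβ
  set τ : Fin N → ℂ := fun i => t ^ (i : ℕ) with hτ
  -- Testing the reproducing property on the monomials gives a linear system for the coefficients of
  -- B, which the inverse moment matrix solves.
  have hvec : Matrix.vecMul β (momentMatrix u W N) = h • τ := by
    ext l
    have h1 := hBr (X ^ (l : ℕ)) (by rw [degree_X_pow]; exact_mod_cast l.2)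
    have h2 := hasSum_sum (s := Finset.univ) fun (j : Fin N) _ =>
      (momentMatrix_hasSum hW j l).mul_left (β j)
    have h3 := h1.unique (h2.congr_fun fun x => by
      rw [hev, eval_pow, eval_X, Finset.sum_mul, Finset.sum_mul]
      exact Finset.sum_congr rfl fun j _ => by rw [hβ]; ring)
    rw [eval_pow, eval_X] at h3
    simp only [Matrix.vecMul, dotProduct, Pi.smul_apply, smul_eq_mul, hτ]
    exact h3.symm
  have hβ2 : β = h • Matrix.vecMul τ (momentMatrix u W N)⁻¹ := by
    rw [← Matrix.smul_vecMul, ← hvec, Matrix.vecMul_vecMul, Matrix.mul_nonsing_inv _ hM,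
      Matrix.vecMul_one]
  rw [← hBe, hev, Finset.sum_comm, Finset.mul_sum]
  refine Finset.sum_congr rfl fun j _ => ?_
  have := congrFun hβ2 j
  simp only [hβ, hτ, Pi.smul_apply, Matrix.vecMul, dotProduct, smul_eq_mul] at this
  rw [this, mul_assoc, Finset.sum_mul]

/-- The reproducing kernel of the weight `W`, symmetrized by square roots of the weight. -/
noncomputable def reproKernel (u W : ℕ → ℝ) (N x y : ℕ) : ℂ :=
  (Real.sqrt (W x * W y) : ℂ) * ∑ i : Fin N, ∑ j : Fin N,
    (u x : ℂ) ^ (i : ℕ) * (momentMatrix u W N)⁻¹ i j * (u y : ℂ) ^ (j : ℕ)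

/-- The factorization K = Φ M⁻¹ Φᵀ with Φ of width N gives both the rank bound and the N-point
determinant. -/
lemma reproKernel_matrix (hW0 : ∀ x, 0 ≤ W x) {m : ℕ} (x : Fin m → ℕ) :
    Matrix.of (fun i j => reproKernel u W N (x i) (x j)) =
      (Matrix.of fun (i : Fin m) (k : Fin N) => (Real.sqrt (W (x i)) : ℂ) * (u (x i) : ℂ) ^ (k : ℕ)) *
        ((momentMatrix u W N)⁻¹ * (Matrix.of fun (i : Fin m) (k : Fin N) =>
          (Real.sqrt (W (x i)) : ℂ) * (u (x i) : ℂ) ^ (k : ℕ)).transpose) := by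
  ext i j
  simp only [reproKernel, Matrix.mul_apply, Matrix.of_apply, Matrix.transpose_apply]
  rw [Real.sqrt_mul (hW0 _), Finset.mul_sum]
  refine Finset.sum_congr rfl fun k _ => ?_
  rw [Finset.mul_sum, Finset.mul_sum]
  refine Finset.sum_congr rfl fun l _ => ?_
  push_cast
  ring

lemma det_reproKernel_eq_zero (hW0 : ∀ x, 0 ≤ W x) {m : ℕ} (hm : N < m) (x : Fin m → ℕ) :
    Matrix.det (Matrix.of fun i j => reproKernel u W N (x i) (x j)) = 0 := by
  by_contra hne
  rw [reproKernel_matrix hW0] at hne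
  have h1 := Matrix.rank_of_isUnit _ ((Matrix.isUnit_iff_isUnit_det _).2 (isUnit_iff_ne_zero.2 hne))
  have h2 := (Matrix.rank_mul_le_left (Matrix.of fun (i : Fin m) (k : Fin N) =>
    (Real.sqrt (W (x i)) : ℂ) * (u (x i) : ℂ) ^ (k : ℕ)) ((momentMatrix u W N)⁻¹ *
      (Matrix.of fun (i : Fin m) (k : Fin N) =>
        (Real.sqrt (W (x i)) : ℂ) * (u (x i) : ℂ) ^ (k : ℕ)).transpose)).trans
    (Matrix.rank_le_width _)
  rw [h1, Fintype.card_fin] at h2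
  omega

lemma det_reproKernel (hW0 : ∀ x, 0 ≤ W x) (x : Fin N → ℕ) :
    Matrix.det (Matrix.of fun i j => reproKernel u W N (x i) (x j)) =
      (momentMatrix u W N)⁻¹.det * (((Matrix.vandermonde fun i => u (x i)).det ^ 2 *
        ∏ i, W (x i) : ℝ) : ℂ) := by
  have h : (Matrix.of fun (i : Fin N) (k : Fin N) =>
      (Real.sqrt (W (x i)) : ℂ) * (u (x i) : ℂ) ^ (k : ℕ)) =
      Matrix.diagonal (fun i => (Real.sqrt (W (x i)) : ℂ)) *
        Matrix.vandermonde (fun i => (u (x i) : ℂ)) := by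
    ext i k
    simp [Matrix.diagonal_mul, Matrix.vandermonde_apply]
  have hv : Matrix.det (Matrix.vandermonde fun i => (u (x i) : ℂ)) =
      ((Matrix.vandermonde fun i => u (x i)).det : ℂ) := by
    rw [Matrix.det_vandermonde, Matrix.det_vandermonde]
    push_cast
    rfl
  have hs : (∏ i, (Real.sqrt (W (x i)) : ℂ)) * ∏ i, (Real.sqrt (W (x i)) : ℂ) =
      ((∏ i, W (x i) : ℝ) : ℂ) := by
    rw [← Finset.prod_mul_distrib]
    push_cast
    refine Finset.prod_congr rfl fun i _ => ?_
    rw [← Complex.ofReal_mul, Real.mul_self_sqrt (hW0 _)]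
  rw [reproKernel_matrix hW0, Matrix.det_mul, Matrix.det_mul, Matrix.det_transpose, h,
    Matrix.det_mul, Matrix.det_diagonal, hv]
  push_cast at hs ⊢
  linear_combination ((Matrix.vandermonde fun i => u (x i)).det : ℂ) ^ 2 *
    (momentMatrix u W N)⁻¹.det * hs

/-- Summing over y inserts M between two copies of its inverse, and M⁻¹ M M⁻¹ = M⁻¹. -/
lemma reproKernel_hasSum (hW0 : ∀ x, 0 ≤ W x)
    (hW : ∀ k < 2 * N - 1, Summable fun x => (u x : ℂ) ^ k * (W x : ℂ))
    (hM : IsUnit (momentMatrix u W N).det) (x x' : ℕ) :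
    HasSum (fun y => reproKernel u W N x y * reproKernel u W N y x') (reproKernel u W N x x') := by
  set M := momentMatrix u W N with hMdef
  have h := (hasSum_bilin hW (fun j => ∑ i : Fin N, (u x : ℂ) ^ (i : ℕ) * M⁻¹ i j)
    (fun i => ∑ j : Fin N, M⁻¹ i j * (u x' : ℂ) ^ (j : ℕ))).mul_left
      (Real.sqrt (W x * W x') : ℂ)
  have hval : ∑ j, ∑ k, (∑ i : Fin N, (u x : ℂ) ^ (i : ℕ) * M⁻¹ i j) *
      (∑ l : Fin N, M⁻¹ k l * (u x' : ℂ) ^ (l : ℕ)) * M j k =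
      ∑ i : Fin N, ∑ l : Fin N, (u x : ℂ) ^ (i : ℕ) * M⁻¹ i l * (u x' : ℂ) ^ (l : ℕ) := by
    have h1 : ∀ k l, ∑ j, M⁻¹ k j * M j l = (1 : Matrix (Fin N) (Fin N) ℂ) k l := fun k l => by
      rw [← Matrix.mul_apply, Matrix.nonsing_inv_mul _ hM]
    calc _ = Matrix.vecMul (fun i : Fin N => (u x : ℂ) ^ (i : ℕ)) M⁻¹ ⬝ᵥ
          M.mulVec (M⁻¹.mulVec fun l : Fin N => (u x' : ℂ) ^ (l : ℕ)) := by
          simp only [dotProduct, Matrix.mulVec, Matrix.vecMul, Finset.mul_sum]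
          refine Finset.sum_congr rfl fun j _ => Finset.sum_congr rfl fun k _ => ?_
          rw [Finset.sum_mul]
          exact Finset.sum_congr rfl fun l _ => by ring
      _ = _ := by
          rw [Matrix.mulVec_mulVec, Matrix.mul_nonsing_inv _ hM, Matrix.one_mulVec]
          simp only [dotProduct, Matrix.vecMul, Finset.sum_mul]
          exact Finset.sum_comm
  rw [hval] at h
  refine h.congr_fun fun y => ?_
  have hs : (Real.sqrt (W x * W y) : ℂ) * (Real.sqrt (W y * W x') : ℂ) =
      (Real.sqrt (W x * W x') : ℂ) * W y := by
    rw [Real.sqrt_mul (hW0 _), Real.sqrt_mul (hW0 _), Real.sqrt_mul (hW0 _)]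
    have := Real.mul_self_sqrt (hW0 y)
    norm_cast
    linear_combination Real.sqrt (W x) * Real.sqrt (W x') * this
  have e1 : ∑ i : Fin N, ∑ j : Fin N, (u x : ℂ) ^ (i : ℕ) * M⁻¹ i j * (u y : ℂ) ^ (j : ℕ) =
      ∑ j : Fin N, (∑ i : Fin N, (u x : ℂ) ^ (i : ℕ) * M⁻¹ i j) * (u y : ℂ) ^ (j : ℕ) := by
    rw [Finset.sum_comm]
    exact Finset.sum_congr rfl fun j _ => (Finset.sum_mul _ _ _).symm
  have e2 : ∑ i : Fin N, ∑ j : Fin N, (u y : ℂ) ^ (i : ℕ) * M⁻¹ i j * (u x' : ℂ) ^ (j : ℕ) =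
      ∑ i : Fin N, (∑ j : Fin N, M⁻¹ i j * (u x' : ℂ) ^ (j : ℕ)) * (u y : ℂ) ^ (i : ℕ) := by
    refine Finset.sum_congr rfl fun i _ => ?_
    rw [Finset.sum_mul]
    exact Finset.sum_congr rfl fun j _ => by ring
  unfold reproKernel
  rw [← hMdef, e1, e2]
  linear_combination (∑ j : Fin N, (∑ i : Fin N, (u x : ℂ) ^ (i : ℕ) * M⁻¹ i j) *
    (u y : ℂ) ^ (j : ℕ)) * (∑ i : Fin N, (∑ j : Fin N, M⁻¹ i j * (u x' : ℂ) ^ (j : ℕ)) *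
      (u y : ℂ) ^ (i : ℕ)) * hs

lemma reproKernel_trace (hW0 : ∀ x, 0 ≤ W x)
    (hW : ∀ k < 2 * N - 1, Summable fun x => (u x : ℂ) ^ k * (W x : ℂ))
    (hM : IsUnit (momentMatrix u W N).det) :
    HasSum (fun y => reproKernel u W N y y) (N : ℂ) := by
  set M := momentMatrix u W N with hMdef
  have h := hasSum_sum (s := Finset.univ) fun (i : Fin N) _ =>
    hasSum_sum (s := Finset.univ) fun (j : Fin N) _ =>
      (momentMatrix_hasSum hW j i).mul_left (M⁻¹ i j)
  have hval : ∑ i, ∑ j, M⁻¹ i j * M j i = (N : ℂ) := by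
    have : ∀ i, ∑ j, M⁻¹ i j * M j i = 1 := fun i => by
      rw [← Matrix.mul_apply, Matrix.nonsing_inv_mul _ hM, Matrix.one_apply_eq]
    simp [this]
  rw [← hMdef, hval] at h
  refine h.congr_fun fun y => ?_
  unfold reproKernel
  rw [Real.sqrt_mul_self (hW0 y), Finset.mul_sum]
  refine Finset.sum_congr rfl fun i _ => ?_
  rw [Finset.mul_sum]
  refine Finset.sum_congr rfl fun j _ => ?_
  ring

end Moments

end ZMeas

namespace ZMeas

/-! ### Signatures and `N`-point subsets -/

lemma shifted_strictAnti {N : ℕ} (lam : Signature N) : StrictAnti (shifted lam) := by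
  intro i j hij
  have h1 := lam.2 hij.le
  have h2 : (i : ℕ) < j := hij
  have := j.2
  unfold shifted
  omega

lemma strictMono_add_sub_le {N : ℕ} {e : Fin N → ℕ} (he : StrictMono e) {i j : Fin N}
    (hij : i ≤ j) : e i + (j - i : ℕ) ≤ e j := by
  obtain ⟨j, hj⟩ := j
  induction j with
  | zero =>
    have : i = ⟨0, hj⟩ := le_antisymm hij (Fin.mk_le_of_le_val (Nat.zero_le _))
    subst this
    simp
  | succ j ih =>
    rcases hij.eq_or_lt with rfl | hlt
    · simp
    · have h1 : (i : ℕ) < j + 1 := hlt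
      have h2 := ih (by omega) (show (i : ℕ) ≤ j by omega)
      have h3 : e ⟨j, by omega⟩ < e ⟨j + 1, hj⟩ := he (Nat.lt_succ_self j)
      simp only at h2 ⊢
      omega

/-- Sort the N numbers decreasingly and subtract the staircase N - 1, …, 0. The bound `hge` ensures
that the truncated subtraction is exact. -/
lemma exists_signature {N : ℕ} {x : Fin N → ℕ} (hx : Function.Injective x) :
    ∃ lam : Signature N, Set.range (shifted lam) = Set.range x := by
  have hcard : (Finset.univ.image x).card = N := by
    rw [Finset.card_image_of_injective _ hx, Finset.card_univ, Fintype.card_fin]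
  set e := (Finset.univ.image x).orderEmbOfFin hcard with he
  have hmono : StrictMono e := e.strictMono
  have hge : ∀ i : Fin N, N - 1 - (i : ℕ) ≤ e i.rev := fun i => by
    have := strictMono_add_sub_le hmono (i := ⟨0, by have := i.2; omega⟩) (j := i.rev)
      (Fin.mk_le_of_le_val (Nat.zero_le _))
    simp only [Fin.val_rev] at this
    omega
  have hlam : Antitone fun i : Fin N => e i.rev - (N - 1 - (i : ℕ)) := by
    intro i j hij
    have h1 := strictMono_add_sub_le hmono (i := j.rev) (j := i.rev) (Fin.rev_le_rev.2 hij)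
    have h2 : (i : ℕ) ≤ j := hij
    have := hge i
    have := hge j
    have := j.2
    simp only [Fin.val_rev] at h1 ⊢
    omega
  refine ⟨⟨_, hlam⟩, ?_⟩
  have hsh : shifted ⟨_, hlam⟩ = e ∘ Fin.rev := by
    ext i
    simp only [shifted, Function.comp]
    have := hge i
    omega
  rw [hsh, Fin.rev_surjective.range_comp, he, Finset.range_orderEmbOfFin]
  simp

lemma shifted_range_injective {N : ℕ} {lam mu : Signature N}
    (h : Set.range (shifted lam) = Set.range (shifted mu)) : lam = mu := by
  have hm : ∀ lam : Signature N, StrictMono (shifted lam ∘ Fin.rev) := fun lam i j hij =>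
    shifted_strictAnti lam (Fin.rev_lt_rev.2 hij)
  have h2 : shifted lam ∘ Fin.rev = shifted mu ∘ Fin.rev := by
    rw [← StrictMono.range_inj (hm lam) (hm mu), Fin.rev_surjective.range_comp,
      Fin.rev_surjective.range_comp, h]
  apply Subtype.ext
  ext i
  have := congrFun h2 i.rev
  simp only [Function.comp, Fin.rev_rev, shifted] at this
  omega

lemma coe_configO (a b : ℝ) {N : ℕ} (lam : Signature N) :
    (configO a b lam : Set (HalfLattice a b)) = Set.range fun i => pt a b (shifted lam i) := by
  simp [configO]

lemma card_configO {a b : ℝ} (h : 0 ≤ eps a b) {N : ℕ} (lam : Signature N) :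
    (configO a b lam).card = N := by
  rw [← Set.ncard_coe_finset, coe_configO, Set.ncard_range_of_injective, Nat.card_fin]
  exact (pt_bijective h).injective.comp (shifted_strictAnti lam).injective

lemma coe_configO_eq_iff {a b : ℝ} (h : 0 ≤ eps a b) {N : ℕ} (lam : Signature N)
    (x : Fin N → ℕ) :
    (configO a b lam : Set (HalfLattice a b)) = Set.range (fun i => pt a b (x i)) ↔
      Set.range (shifted lam) = Set.range x := by
  rw [coe_configO]
  have e : ∀ y : Fin N → ℕ, Set.range (fun i => pt a b (y i)) = pt a b '' Set.range y :=
    fun y => Set.range_comp (pt a b) y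
  rw [e, e]
  exact (pt_bijective h).injective.image_injective.eq_iff

lemma forall_mem_configO_iff {a b : ℝ} (h : 0 ≤ eps a b) {N : ℕ} (lam : Signature N)
    {x : Fin N → ℕ} (hx : Function.Injective x) :
    (∀ i, pt a b (x i) ∈ configO a b lam) ↔ Set.range (shifted lam) = Set.range x := by
  rw [← coe_configO_eq_iff h]
  constructor
  · intro H
    refine (Set.eq_of_subset_of_ncard_le (Set.range_subset_iff.2 H) ?_ (Finset.finite_toSet _)).symm
    rw [Set.ncard_coe_finset, card_configO h, Set.ncard_range_of_injective, Nat.card_fin]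
    exact (pt_bijective h).injective.comp hx
  · intro H i
    have : pt a b (x i) ∈ (configO a b lam : Set (HalfLattice a b)) := H ▸ ⟨i, rfl⟩
    exact this

lemma vandermonde_sq {N : ℕ} (v : Fin N → ℝ) :
    vandermonde v ^ 2 = (Matrix.vandermonde v).det ^ 2 := by
  rw [vandermonde, Matrix.det_vandermonde, ← Finset.prod_pow, ← Finset.prod_pow]
  refine Finset.prod_congr rfl fun i _ => ?_
  rw [← Finset.prod_pow, ← Finset.prod_pow]
  exact Finset.prod_congr rfl fun j _ => by ring

/-- The squared Vandermonde product and the product of weights are symmetric, so any enumeration of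
the set may replace the decreasing one. -/
lemma zWeight_eq (z z' : ℂ) (a b : ℝ) {N : ℕ} {lam : Signature N} {x : Fin N → ℕ}
    (hx : Function.Injective x) (h : Set.range (shifted lam) = Set.range x) :
    zWeight z z' a b N lam =
      (Matrix.vandermonde fun i => hat a b (x i)).det ^ 2 * ∏ i, weight z z' a b N (x i) := by
  set σ : Equiv.Perm (Fin N) := (Equiv.ofInjective _ (shifted_strictAnti lam).injective).trans
    ((Equiv.setCongr h).trans (Equiv.ofInjective x hx).symm) with hσ
  have hs : ∀ i, shifted lam i = x (σ i) := fun i => by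
    have : (Equiv.ofInjective x hx) (σ i) =
        Equiv.setCongr h (Equiv.ofInjective _ (shifted_strictAnti lam).injective i) := by
      simp [hσ]
    have := congrArg Subtype.val this
    simpa using this.symm
  rw [zWeight, vandermonde_sq]
  simp_rw [hs]
  rw [Equiv.prod_comp σ fun i => weight z z' a b N (x i)]
  congr 1
  have hd : Matrix.vandermonde (fun i => hat a b (x (σ i))) =
      (Matrix.vandermonde fun i => hat a b (x i)).submatrix σ id := by
    ext i j
    simp [Matrix.vandermonde_apply]
  rw [hd, Matrix.det_permute, mul_pow]
  rcases Int.units_eq_one_or (Equiv.Perm.sign σ) with h1 | h1 <;> simp [h1]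

/-! ### Convergence of the partition function -/

lemma summable_pi_prod {g : ℕ → ℝ} (hg : Summable g) (hg0 : ∀ x, 0 ≤ g x) (n : ℕ) :
    Summable fun x : Fin n → ℕ => ∏ i, g (x i) := by
  induction n with
  | zero => exact Summable.of_finite
  | succ n ih =>
    have h := hg.mul_of_nonneg ih hg0 fun x => Finset.prod_nonneg fun i _ => hg0 (x i)
    rw [← (Fin.consEquiv fun _ : Fin (n + 1) => ℕ).summable_iff]
    refine h.congr fun x => ?_
    simp [Fin.prod_univ_succ, Fin.consEquiv]

/-- For nonnegative entries |v_i - v_j| ≤ (1 + v_i)(1 + v_j), and every index lies in N - 1 pairs.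
-/
lemma vandermonde_sq_le {N : ℕ} {v : Fin N → ℝ} (hv : ∀ i, 0 ≤ v i) :
    vandermonde v ^ 2 ≤ ∏ i, (1 + v i) ^ (2 * N - 2) := by
  have h1 : |vandermonde v| ≤ ∏ i, ∏ j ∈ Finset.Ioi i, ((1 + v i) * (1 + v j)) := by
    rw [vandermonde, Finset.abs_prod]
    refine Finset.prod_le_prod (fun i _ => abs_nonneg _) fun i _ => ?_
    rw [Finset.abs_prod]
    refine Finset.prod_le_prod (fun j _ => abs_nonneg _) fun j _ => ?_
    have := hv i
    have := hv j
    rw [abs_le]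
    constructor <;> nlinarith
  have h2 : ∏ i, ∏ j ∈ Finset.Ioi i, ((1 + v i) * (1 + v j)) = ∏ i, (1 + v i) ^ (N - 1) := by
    simp_rw [Finset.prod_mul_distrib]
    have hc : ∏ i, ∏ j ∈ Finset.Ioi i, (1 + v j) = ∏ j, ∏ i ∈ Finset.Iio j, (1 + v j) :=
      Finset.prod_comm' (by simp)
    rw [hc, ← Finset.prod_mul_distrib]
    refine Finset.prod_congr rfl fun i _ => ?_
    rw [Finset.prod_const, Finset.prod_const, Fin.card_Ioi, Fin.card_Iio, ← pow_add]
    congr 1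
    have := i.2
    omega
  calc vandermonde v ^ 2 = |vandermonde v| ^ 2 := (sq_abs _).symm
    _ ≤ (∏ i, (1 + v i) ^ (N - 1)) ^ 2 := by rw [← h2]; gcongr
    _ = _ := by
      rw [← Finset.prod_pow]
      refine Finset.prod_congr rfl fun i _ => ?_
      rw [← pow_mul]
      congr 1
      omega

/-! ### The normalized measure and its point process -/

section Ensemble

variable {z z' : ℂ} {a b : ℝ} {N : ℕ}

lemma zWeight_nonneg (hW0 : ∀ x, 0 ≤ weight z z' a b N x) (lam : Signature N) :
    0 ≤ zWeight z z' a b N lam :=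
  mul_nonneg (sq_nonneg _) (Finset.prod_nonneg fun _ _ => hW0 _)

/-- Bounding the Vandermonde factor by a product dominates the partition function by the N-th power
of a one-point sum, with moments of order at most 2N - 2. -/
lemma zWeight_summable (hW0 : ∀ x, 0 ≤ weight z z' a b N x)
    (hW : Summable fun x => (1 + hat a b x) ^ (2 * N - 2) * weight z z' a b N x) :
    Summable (zWeight z z' a b N) := by
  have hat0 : ∀ x, 0 ≤ hat a b x := fun x => sq_nonneg _
  have hg0 : ∀ x, 0 ≤ (1 + hat a b x) ^ (2 * N - 2) * weight z z' a b N x := fun x =>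
    mul_nonneg (pow_nonneg (by have := hat0 x; linarith) _) (hW0 x)
  have hinj : Function.Injective (shifted (N := N)) := fun lam mu h =>
    shifted_range_injective (by rw [h])
  refine Summable.of_nonneg_of_le (zWeight_nonneg hW0) (fun lam => ?_)
    ((summable_pi_prod hW hg0 N).comp_injective hinj)
  simp only [Function.comp]
  rw [Finset.prod_mul_distrib]
  exact mul_le_mul_of_nonneg_right (vandermonde_sq_le fun i => hat0 _)
    (Finset.prod_nonneg fun _ _ => hW0 _)

lemma zWeight_tsum_pos (h : 0 ≤ eps a b) (hW0 : ∀ x, 0 ≤ weight z z' a b N x)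
    (hWpos : ∀ x < N, 0 < weight z z' a b N x) (hs : Summable (zWeight z z' a b N)) :
    0 < ∑' mu, zWeight z z' a b N mu := by
  obtain ⟨lam, hlam⟩ := exists_signature (Fin.val_injective (n := N))
  refine hs.tsum_pos (zWeight_nonneg hW0) lam ?_
  rw [zWeight_eq z z' a b Fin.val_injective hlam]
  refine mul_pos (sq_pos_of_ne_zero ?_) (Finset.prod_pos fun i _ => hWpos i i.2)
  refine Matrix.det_vandermonde_ne_zero_iff.2 fun i j hij => ?_
  exact Fin.val_injective ((pt_bijective h).injective (Subtype.ext hij))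

lemma isProbabilityMeasure_zMeasure (h : 0 ≤ eps a b) (hW0 : ∀ x, 0 ≤ weight z z' a b N x)
    (hWpos : ∀ x < N, 0 < weight z z' a b N x) (hs : Summable (zWeight z z' a b N)) :
    IsProbabilityMeasure (zMeasure z z' a b N) := by
  have hZ := zWeight_tsum_pos h hW0 hWpos hs
  constructor
  rw [zMeasure, Measure.sum_apply _ MeasurableSet.univ]
  simp only [Measure.smul_apply, measure_univ, smul_eq_mul, mul_one]
  rw [← ENNReal.ofReal_tsum_of_nonneg (fun lam => div_nonneg (zWeight_nonneg hW0 lam) hZ.le)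
    (hs.div_const _), tsum_div_const, div_self hZ.ne', ENNReal.ofReal_one]

lemma zMeasure_singleton (lam : Signature N) : zMeasure z z' a b N {lam} =
    ENNReal.ofReal (zWeight z z' a b N lam / ∑' mu, zWeight z z' a b N mu) := by
  rw [zMeasure, Measure.sum_apply _ (MeasurableSet.singleton lam), tsum_eq_single lam]
  · simp
  · intro mu hmu
    simp [hmu]

lemma measurable_configO : Measurable (configO a b (N := N)) := measurable_of_countable _

lemma measurableSet_conf (h : 0 ≤ eps a b) (S : Set (Conf a b)) : MeasurableSet S := by
  have : Countable (HalfLattice a b) := (pt_bijective h).surjective.countable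
  exact S.to_countable.measurableSet

/-- Such an event is the image of exactly one signature; it serves both for equality with a given
N-point set and for containing it. -/
lemma processO_real_of_range (h : 0 ≤ eps a b) (hW0 : ∀ x, 0 ≤ weight z z' a b N x)
    {S : Set (Conf a b)} {x : Fin N → ℕ} (hx : Function.Injective x)
    (hS : ∀ lam : Signature N, configO a b lam ∈ S ↔ Set.range (shifted lam) = Set.range x) :
    (processO z z' a b N).real S = (∑' mu, zWeight z z' a b N mu)⁻¹ *
      ((Matrix.vandermonde fun i => hat a b (x i)).det ^ 2 * ∏ i, weight z z' a b N (x i)) := by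
  obtain ⟨lam, hlam⟩ := exists_signature hx
  have hpre : configO a b ⁻¹' S = {lam} := by
    ext mu
    rw [Set.mem_preimage, hS, Set.mem_singleton_iff]
    exact ⟨fun H => shifted_range_injective (H.trans hlam.symm), fun H => H ▸ hlam⟩
  rw [measureReal_def, processO, Measure.map_apply measurable_configO (measurableSet_conf h S), hpre,
    zMeasure_singleton, ENNReal.toReal_ofReal, zWeight_eq z z' a b hx hlam, div_eq_inv_mul]
  exact div_nonneg (zWeight_nonneg hW0 lam) (tsum_nonneg (zWeight_nonneg hW0))

lemma card_ae_processO (h : 0 ≤ eps a b) : ∀ᵐ X ∂(processO z z' a b N), X.card = N := by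
  rw [processO, ae_map_iff measurable_configO.aemeasurable (measurableSet_conf h _)]
  exact .of_forall fun lam => card_configO h lam

lemma isProbabilityMeasure_processO (h : 0 ≤ eps a b) (hW0 : ∀ x, 0 ≤ weight z z' a b N x)
    (hWpos : ∀ x < N, 0 < weight z z' a b N x) (hs : Summable (zWeight z z' a b N)) :
    IsProbabilityMeasure (processO z z' a b N) := by
  have := isProbabilityMeasure_zMeasure h hW0 hWpos hs
  exact Measure.isProbabilityMeasure_map measurable_configO.aemeasurable

lemma isOrthPolyEnsemble_processO (h : 0 ≤ eps a b) (hW0 : ∀ x, 0 ≤ weight z z' a b N x)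
    (hWpos : ∀ x < N, 0 < weight z z' a b N x) (hs : Summable (zWeight z z' a b N)) :
    IsOrthPolyEnsemble a b N (weight z z' a b N) (processO z z' a b N) := by
  refine ⟨card_ae_processO h, _, inv_pos.2 (zWeight_tsum_pos h hW0 hWpos hs), fun x hx => ?_⟩
  rw [processO_real_of_range h hW0 hx fun lam => coe_configO_eq_iff h lam x, sq_abs,
    vandermonde_sq, mul_assoc]

/-- The N-point determinants carry the constant det M⁻¹ and the probabilities the inverse partition
function; `κ` is the ratio of the two. -/
lemma isCorrelationKernel_reproKernel (h : 0 ≤ eps a b) (hW0 : ∀ x, 0 ≤ weight z z' a b N x)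
    (hWpos : ∀ x < N, 0 < weight z z' a b N x) (hs : Summable (zWeight z z' a b N))
    (hW : ∀ k < 2 * N - 1, Summable fun x => (hat a b x : ℂ) ^ k * (weight z z' a b N x : ℂ))
    (hM : IsUnit (momentMatrix (hat a b) (weight z z' a b N) N).det) :
    IsCorrelationKernel a b (reproKernel (hat a b) (weight z z' a b N) N)
      (processO z z' a b N) := by
  have := isProbabilityMeasure_processO h hW0 hWpos hs
  set M := momentMatrix (hat a b) (weight z z' a b N) N with hMdef
  refine isCorrelationKernel_of_projection h _ (card_ae_processO h)
    (reproKernel_hasSum hW0 hW hM) (reproKernel_trace hW0 hW hM)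
    (fun m hm x => det_reproKernel_eq_zero hW0 hm x)
    (κ := ((∑' mu, zWeight z z' a b N mu)⁻¹ : ℝ) * (M⁻¹.det)⁻¹) fun x hx => ?_
  have hdet : M⁻¹.det ≠ 0 := by
    have := (Matrix.isUnit_nonsing_inv_det_iff (A := M)).2 hM
    exact this.ne_zero
  rw [processO_real_of_range (S := {X | ∀ i, pt a b (x i) ∈ X}) h hW0 hx
      fun lam => forall_mem_configO_iff h lam hx,
    det_reproKernel hW0, ← hMdef, Complex.ofReal_mul]
  field_simp

end Ensemble

end ZMeas

namespace ZMeas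

/-! ### Consequences of admissibility -/

/-- Γ has constant sign between consecutive integers. Going left by one unit divides the product by
u v, which is positive because both factors are negative. -/
lemma Gamma_mul_Gamma_pos {n : ℤ} {u v : ℝ} (hu : n < u) (hu' : u < n + 1) (hv : n < v)
    (hv' : v < n + 1) : 0 < Real.Gamma u * Real.Gamma v := by
  obtain h | ⟨k, hk⟩ : 0 ≤ n ∨ ∃ k : ℕ, n = -k := by
    rcases le_total 0 n with h | h
    · exact .inl h
    · exact .inr ⟨n.natAbs, by omega⟩
  · have : (0 : ℝ) ≤ n := by exact_mod_cast h
    exact mul_pos (Real.Gamma_pos_of_pos (by linarith)) (Real.Gamma_pos_of_pos (by linarith))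
  · subst hk
    push_cast at hu hu' hv hv'
    induction k generalizing u v with
    | zero =>
      push_cast at hu hv
      exact mul_pos (Real.Gamma_pos_of_pos (by linarith)) (Real.Gamma_pos_of_pos (by linarith))
    | succ k ih =>
      push_cast at hu hu' hv hv'
      have hk : (0 : ℝ) ≤ k := Nat.cast_nonneg k
      have hu0 : u < 0 := by linarith
      have hv0 : v < 0 := by linarith
      have h1 := ih (u := u + 1) (v := v + 1) (by linarith) (by linarith) (by linarith)
        (by linarith)
      rw [Real.Gamma_add_one hu0.ne, Real.Gamma_add_one hv0.ne] at h1
      have h2 : 0 < u * v := mul_pos_of_neg_of_neg hu0 hv0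
      have h3 : u * Real.Gamma u * (v * Real.Gamma v) =
        u * v * (Real.Gamma u * Real.Gamma v) := by ring
      rw [h3] at h1
      exact (mul_pos_iff_of_pos_left h2).1 h1

lemma ne_neg_of_mem_series {w w' : ℂ} (h : (w, w') ∈ Zprinc ∪ Zcompl ∪ Zdegen) (l : ℕ) :
    w ≠ -l ∧ w' ≠ -l := by
  have hre : ∀ {c : ℂ}, c = -l → c.re = -(l : ℝ) := fun hc => by simp [hc]
  have him : ∀ {c : ℂ}, c = -l → c.im = 0 := fun hc => by simp [hc]
  have hl : (0 : ℝ) ≤ l := Nat.cast_nonneg l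
  rcases h with (⟨h1, h2⟩ | ⟨-, -, n, h1, h2, h3, h4⟩) | ⟨-, -, n, hn, h⟩
  · simp only at h1 h2
    have hw : w'.im = -w.im := by rw [h2, Complex.conj_im]
    constructor <;> intro hc <;> have := him hc <;> exact h1 (by constructor <;> linarith)
  · have key : ∀ {r : ℝ}, (n : ℝ) < r → r < n + 1 → r ≠ -(l : ℝ) := by
      rintro r h1 h2 rfl
      have h1' : n < -(l : ℤ) := by exact_mod_cast h1
      have h2' : -(l : ℤ) < n + 1 := by exact_mod_cast h2
      omega
    exact ⟨fun hc => key h1 h2 (hre hc), fun hc => key h3 h4 (hre hc)⟩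
  · have hn' : (1 : ℝ) ≤ n := by exact_mod_cast hn
    simp only at h
    constructor <;> intro hc <;> have := hre hc <;> rcases h with ⟨h1, h2⟩ | ⟨h1, h2⟩ <;> linarith

lemma eq_ofReal_of_im {w : ℂ} (h : w.im = 0) : w = (w.re : ℂ) := by
  apply Complex.ext <;> simp [h]

/-- The reason for the three series. Conjugate arguments give |Γ|⁻²; arguments in a common interval
give equal signs; in the degenerate case either the integer argument has reached a pole, where 1/Γ =
0, or both arguments are positive. -/
lemma inv_Gamma_mul_of_mem_series {w w' : ℂ} (h : (w, w') ∈ Zprinc ∪ Zcompl ∪ Zdegen) (m : ℤ) :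
    ∃ r : ℝ, 0 ≤ r ∧ (Complex.Gamma (w + m) * Complex.Gamma (w' + m))⁻¹ = (r : ℂ) ∧
      (0 ≤ m → 0 < r) := by
  have hreal : w.im = 0 → w'.im = 0 →
      (Complex.Gamma (w + m) * Complex.Gamma (w' + m))⁻¹ =
        ((Real.Gamma (w.re + m) * Real.Gamma (w'.re + m))⁻¹ : ℝ) := by
    intro h1 h2
    conv_lhs => rw [eq_ofReal_of_im h1, eq_ofReal_of_im h2]
    rw [Complex.ofReal_inv, Complex.ofReal_mul, ← Complex.Gamma_ofReal, ← Complex.Gamma_ofReal]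
    push_cast
    rfl
  have hne := ne_neg_of_mem_series h
  rcases h with (⟨h1, h2⟩ | ⟨h1, h2, n, h3, h4, h5, h6⟩) | ⟨h1, h2, n, hn, h⟩
  · simp only at h1 h2
    refine ⟨(Complex.normSq (Complex.Gamma (w + m)))⁻¹, inv_nonneg.2 (Complex.normSq_nonneg _), ?_,
      fun hm => inv_pos.2 (Complex.normSq_pos.2 (Complex.Gamma_ne_zero fun l hl => ?_))⟩
    · have : w' + m = (starRingEnd ℂ) (w + m) := by rw [h2, map_add, map_intCast]
      rw [this, Complex.Gamma_conj, Complex.mul_conj, Complex.ofReal_inv]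
    · lift m to ℕ using hm
      refine (hne (l + m)).1 ?_
      push_cast at hl ⊢
      linear_combination hl
  · have := Gamma_mul_Gamma_pos (n := n + m) (u := w.re + m) (v := w'.re + m)
      (by push_cast; linarith) (by push_cast; linarith) (by push_cast; linarith)
      (by push_cast; linarith)
    exact ⟨_, (inv_pos.2 this).le, hreal h1 h2, fun _ => inv_pos.2 this⟩
  · refine ⟨_, ?_, hreal h1 h2, fun hm => ?_⟩
    · rcases le_or_gt (n + m) 0 with hk | hk
      · obtain ⟨k, hk⟩ : ∃ k : ℕ, (n : ℤ) + m = -k := ⟨(n + m).natAbs, by omega⟩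
        have hk' : (n : ℝ) + m = -k := by exact_mod_cast hk
        rcases h with ⟨h3, -⟩ | ⟨h3, -⟩ <;> simp only at h3 <;>
          rw [h3, hk', Real.Gamma_neg_nat_eq_zero] <;> simp
      · have hk' : (1 : ℝ) ≤ n + m := by exact_mod_cast hk
        refine inv_nonneg.2 (mul_pos (Real.Gamma_pos_of_pos ?_) (Real.Gamma_pos_of_pos ?_)).le <;>
          rcases h with ⟨h3, h4⟩ | ⟨h3, h4⟩ <;> simp only at h3 h4 <;> linarith
    · have hm' : (0 : ℝ) ≤ m := by exact_mod_cast hm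
      have hn' : (1 : ℝ) ≤ n := by exact_mod_cast hn
      refine inv_pos.2 (mul_pos (Real.Gamma_pos_of_pos ?_) (Real.Gamma_pos_of_pos ?_)) <;>
        rcases h with ⟨h3, h4⟩ | ⟨h3, h4⟩ <;> simp only at h3 h4 <;> linarith

lemma eps_nonneg {a b : ℝ} (hab : b ≤ a) (hb : -1 / 2 ≤ b) : 0 ≤ eps a b := by
  unfold eps
  linarith

lemma hat_injective {a b : ℝ} (h : 0 ≤ eps a b) : Function.Injective (hat a b) :=
  fun _ _ hxy => (pt_bijective h).injective (Subtype.ext hxy)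

lemma leadFactor_pos {a b : ℝ} (h : 0 ≤ eps a b) (x : ℕ) : 0 < leadFactor a b x := by
  unfold leadFactor
  split_ifs with hx
  · have := Real.Gamma_pos_of_pos (show 0 < 2 * eps a b + 1 by linarith)
    positivity
  · have hx' : (0 : ℝ) < x := by exact_mod_cast Nat.pos_of_ne_zero hx
    have := Real.Gamma_pos_of_pos (show 0 < x + 2 * eps a b by linarith)
    positivity

/-! ### Positivity of the weight, non-vanishing of the norm, and existence of moments -/

section Admissible

variable {z z' : ℂ} {a b : ℝ}

/-- Applies the sign rule to (z, z') shifted by N - x and to (z + 2ε, z' + 2ε) shifted by N + x. The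
first shift is nonnegative for x < N, whence strict positivity there. -/
lemma exists_weightC_eq (hab : b ≤ a) (hb : -1 / 2 ≤ b) (hz : Admissible z z' a b) (N x : ℕ) :
    ∃ r : ℝ, 0 ≤ r ∧ weightC z z' a b N x = r ∧ (x < N → 0 < r) := by
  obtain ⟨r₁, hr₁, h₁, p₁⟩ := inv_Gamma_mul_of_mem_series hz.2.1 ((N : ℤ) - x)
  obtain ⟨r₂, hr₂, h₂, p₂⟩ := inv_Gamma_mul_of_mem_series hz.2.2 ((N : ℤ) + x)
  have hx : (0 : ℝ) ≤ x := Nat.cast_nonneg x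
  have hpos : 0 < leadFactor a b x * Real.Gamma (x + a + 1) /
      (Real.Gamma (x + 1) * Real.Gamma (x + b + 1)) := by
    have := leadFactor_pos (eps_nonneg hab hb) x
    have := Real.Gamma_pos_of_pos (show 0 < (x : ℝ) + a + 1 by linarith)
    have := Real.Gamma_pos_of_pos (show 0 < (x : ℝ) + b + 1 by linarith)
    have := Real.Gamma_pos_of_pos (show 0 < (x : ℝ) + 1 by linarith)
    positivity
  refine ⟨_, mul_nonneg hpos.le (mul_nonneg hr₁ hr₂), ?_, fun hxN =>
    mul_pos hpos (mul_pos (p₁ (by omega)) (p₂ (by omega)))⟩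
  rw [weightC, Complex.ofReal_mul, Complex.ofReal_mul, ← h₁, ← h₂, ← mul_inv]
  congr 2
  push_cast
  rw [← mul_assoc]
  congr 1
  · congr 1
    · congr 2 <;> ring
    · congr 1
      ring
  · congr 1
    ring

lemma weightC_eq_weight (hab : b ≤ a) (hb : -1 / 2 ≤ b) (hz : Admissible z z' a b) (N x : ℕ) :
    weightC z z' a b N x = weight z z' a b N x := by
  obtain ⟨r, -, h, -⟩ := exists_weightC_eq hab hb hz N x
  rw [weight, h, Complex.ofReal_re]

lemma weight_nonneg (hab : b ≤ a) (hb : -1 / 2 ≤ b) (hz : Admissible z z' a b) (N x : ℕ) :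
    0 ≤ weight z z' a b N x := by
  obtain ⟨r, hr, h, -⟩ := exists_weightC_eq hab hb hz N x
  rwa [weight, h, Complex.ofReal_re]

lemma weight_pos (hab : b ≤ a) (hb : -1 / 2 ≤ b) (hz : Admissible z z' a b) {N x : ℕ}
    (hx : x < N) : 0 < weight z z' a b N x := by
  obtain ⟨r, -, h, hr⟩ := exists_weightC_eq hab hb hz N x
  rw [weight, h, Complex.ofReal_re]
  exact hr hx

lemma poch_one_sub_ne_zero {w : ℂ} (hw : ∀ l : ℕ, w ≠ -l) {N k : ℕ} (hk : k ≤ N) :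
    poch (1 - w - N) k ≠ 0 := by
  rw [poch_eq_prod, Finset.prod_ne_zero_iff]
  intro j hj h
  have hj := Finset.mem_range.1 hj
  obtain ⟨d, rfl⟩ := Nat.exists_eq_add_of_le (show j + 1 ≤ N by omega)
  refine hw d ?_
  push_cast at h
  linear_combination -h

/-- A pole makes w real with w = -1 - m - b < 0, and then Σ > -1 forces Re w' > m ≥ 0. No pair in
the series has a negative and a positive real entry, and a principal pair cannot have one real
entry. -/
lemma Gamma_one_add_ne_zero (hb : -1 / 2 ≤ b) {w w' : ℂ} (hs : -1 < (sig w w' b).re)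
    (h : (w, w') ∈ Zprinc ∪ Zcompl ∪ Zdegen ∨ (w', w) ∈ Zprinc ∪ Zcompl ∪ Zdegen) :
    Complex.Gamma (1 + w + b) ≠ 0 := by
  refine Complex.Gamma_ne_zero fun m hm => ?_
  have him : w.im = 0 := by simpa using congrArg Complex.im hm
  have hre : 1 + w.re + b = -(m : ℝ) := by simpa using congrArg Complex.re hm
  have hm0 : (0 : ℝ) ≤ m := Nat.cast_nonneg m
  have hs' : -1 < w.re + w'.re + b := by simpa [sig] using hs
  have key : ∀ {n : ℤ}, (n : ℝ) < w.re → w'.re < n + 1 → False := by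
    intro n h1 h2
    have h3 : (0 : ℝ) < (n + 1 : ℤ) := by push_cast; linarith
    have h4 : 0 < n + 1 := by exact_mod_cast h3
    have h5 : (0 : ℝ) ≤ n := by exact_mod_cast (by omega : 0 ≤ n)
    linarith
  rcases h with ((⟨h1, h2⟩ | ⟨-, -, n, h1, h2, h3, h4⟩) | ⟨-, -, n, hn, h⟩) |
      ((⟨h1, h2⟩ | ⟨-, -, n, h1, h2, h3, h4⟩) | ⟨-, -, n, hn, h⟩)
  · simp only at h1 h2
    exact h1 ⟨him, by rw [h2, Complex.conj_im, him, neg_zero]⟩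
  · exact key h1 h4
  · have hn' : (1 : ℝ) ≤ n := by exact_mod_cast hn
    simp only at h
    rcases h with ⟨h1, h2⟩ | ⟨h1, h2⟩ <;> linarith
  · simp only at h1 h2
    have : w.im = -w'.im := by rw [h2, Complex.conj_im]
    exact h1 ⟨by linarith, him⟩
  · exact key h3 h2
  · have hn' : (1 : ℝ) ≤ n := by exact_mod_cast hn
    simp only at h
    rcases h with ⟨h1, h2⟩ | ⟨h1, h2⟩ <;> linarith

lemma normTop_ne_zero (hab : b ≤ a) (hb : -1 / 2 ≤ b) (hz : Admissible z z' a b) {N : ℕ}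
    (hN : 1 ≤ N) : normTop z z' a b N ≠ 0 := by
  have hs := hz.1
  have hN' : (1 : ℝ) ≤ N := by exact_mod_cast hN
  have hs' : -1 < (sig z' z b).re := by
    have : sig z' z b = sig z z' b := by simp only [sig]; ring
    rwa [this]
  have hp : ∀ {c : ℂ}, 0 < c.re → Complex.Gamma c ≠ 0 := Complex.Gamma_ne_zero_of_re_pos
  have hne := ne_neg_of_mem_series hz.2.1
  have h1 : ∀ {w : ℂ}, (∀ l : ℕ, w ≠ -l) → Complex.Gamma (1 + w) ≠ 0 := fun hw =>
    Complex.Gamma_ne_zero fun m hm => hw (m + 1) (by push_cast; linear_combination hm)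
  rw [normTop]
  refine div_ne_zero (mul_ne_zero (by norm_num) ?_) ?_
  · refine mul_ne_zero (mul_ne_zero (mul_ne_zero (hp ?_) (hp ?_)) (hp ?_)) (hp ?_) <;> simp <;>
      linarith
  · refine mul_ne_zero (mul_ne_zero (mul_ne_zero (mul_ne_zero (mul_ne_zero (hp ?_) (hp ?_))
      (h1 fun l => (hne l).1)) (h1 fun l => (hne l).2))
      (Gamma_one_add_ne_zero hb hs (.inl hz.2.1))) (Gamma_one_add_ne_zero hb hs' (.inr hz.2.1)) <;>
      simp <;> linarith

lemma weightC_isBigO (hab : b ≤ a) (hb : -1 / 2 ≤ b) (z z' : ℂ) (N : ℕ) :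
    weightC z z' a b N =O[Filter.atTop]
      fun n : ℕ => (n : ℝ) ^ (-1 - 2 * ((sig z z' b).re + 2 * N - 1)) := by
  have h := wpTerm_isBigO (A := 2 * eps a b) (B := a + 1) (by linarith [eps_nonneg hab hb])
    (by linarith) (z + N) (z' + N)
  have e : weightC z z' a b N = wpTerm (2 * eps a b) (a + 1) (z + N) (z' + N) :=
    funext fun x => weightC_eq_wpTerm z z' a b N x
  rw [e]
  convert h using 4
  rw [two_mul_eps]
  simp [sig]
  ring

lemma one_add_hat_isBigO (a b : ℝ) :
    (fun x => 1 + hat a b x) =O[Filter.atTop] fun n : ℕ => (n : ℝ) ^ (2 : ℝ) := by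
  refine Asymptotics.IsBigO.of_bound (1 + (1 + |eps a b|) ^ 2) ?_
  filter_upwards [Filter.eventually_ge_atTop 1] with n hn
  have hn' : (1 : ℝ) ≤ n := by exact_mod_cast hn
  have h1 : 0 ≤ hat a b n := sq_nonneg _
  rw [Real.rpow_two, Real.norm_of_nonneg (by linarith), Real.norm_of_nonneg (by positivity), hat]
  have h2 : ((n : ℝ) + eps a b) ^ 2 ≤ (n * (1 + |eps a b|)) ^ 2 := by
    rw [sq_le_sq]
    calc |(n : ℝ) + eps a b| ≤ |(n : ℝ)| + |eps a b| := abs_add_le _ _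
      _ ≤ n * (1 + |eps a b|) := by
        rw [abs_of_nonneg (by linarith)]
        nlinarith [abs_nonneg (eps a b)]
      _ ≤ _ := le_abs_self _
  nlinarith

/-- The summand is O(n^(2k - 1 - 2(Σ + 2N - 1))), summable for k < Σ + 2N - 1. Thus Σ > -1 secures
exactly the orders up to 2N - 2 that are needed. -/
lemma summable_one_add_hat_pow (hab : b ≤ a) (hb : -1 / 2 ≤ b) (hz : Admissible z z' a b) {N k : ℕ}
    (hk : k + 2 ≤ 2 * N) :
    Summable fun x => (1 + hat a b x) ^ k * weight z z' a b N x := by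
  have h1 := (one_add_hat_isBigO a b).pow k
  have h2 : weight z z' a b N =O[Filter.atTop]
      fun n : ℕ => (n : ℝ) ^ (-1 - 2 * ((sig z z' b).re + 2 * N - 1)) :=
    (Asymptotics.IsBigO.of_norm_left ((weightC_isBigO hab hb z z' N).norm_left.congr_left fun x => by
      rw [weightC_eq_weight hab hb hz, Complex.norm_real]))
  have hk' : (k : ℝ) + 2 ≤ 2 * N := by exact_mod_cast hk
  have hs := hz.1
  refine summable_of_isBigO_nat (g := fun n : ℕ => (n : ℝ) ^
    (2 * (k : ℝ) + (-1 - 2 * ((sig z z' b).re + 2 * N - 1)))) (Real.summable_nat_rpow.2 (by linarith))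
    ((h1.mul h2).congr' .rfl ?_)
  filter_upwards [Filter.eventually_ge_atTop 1] with n hn
  have hn' : (0 : ℝ) < n := by exact_mod_cast hn
  rw [Real.rpow_add hn', Real.rpow_mul hn'.le, Real.rpow_natCast]

lemma summable_hat_pow (hab : b ≤ a) (hb : -1 / 2 ≤ b) (hz : Admissible z z' a b) {N k : ℕ}
    (hk : k < 2 * N - 1) :
    Summable fun x => (hat a b x : ℂ) ^ k * (weight z z' a b N x : ℂ) := by
  refine Summable.of_norm_bounded (summable_one_add_hat_pow hab hb hz (N := N) (k := k) (by omega))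
    fun x => ?_
  have h1 : 0 ≤ hat a b x := sq_nonneg _
  have h2 := weight_nonneg hab hb hz N x
  rw [norm_mul, norm_pow, Complex.norm_real, Complex.norm_real, Real.norm_of_nonneg h1,
    Real.norm_of_nonneg h2]
  gcongr
  linarith

end Admissible

end ZMeas

namespace ZMeas

/-! ### Orthogonality and the Christoffel–Darboux kernel -/

/-- M is both symmetric and Hermitian, hence so is its inverse, whose entries are therefore real. -/
lemma conj_inv_momentMatrix (u W : ℕ → ℝ) (N : ℕ) (i j : Fin N) :
    (starRingEnd ℂ) ((momentMatrix u W N)⁻¹ i j) = (momentMatrix u W N)⁻¹ i j := by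
  have ht : (momentMatrix u W N).transpose = momentMatrix u W N := by
    ext i j
    simp only [momentMatrix, Matrix.transpose_apply, Matrix.of_apply, add_comm (i : ℕ) (j : ℕ)]
  have hc : (momentMatrix u W N).conjTranspose = momentMatrix u W N := by
    ext i j
    simp only [momentMatrix, Matrix.conjTranspose_apply, Matrix.of_apply,
      add_comm (i : ℕ) (j : ℕ)]
    rw [← starRingEnd_apply, Complex.conj_tsum]
    simp
  have h1 : (starRingEnd ℂ) ((momentMatrix u W N)⁻¹ i j) =
      (momentMatrix u W N)⁻¹.conjTranspose j i := rfl
  rw [h1, Matrix.conjTranspose_nonsing_inv, hc, ← Matrix.transpose_apply (momentMatrix u W N)⁻¹,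
    Matrix.transpose_nonsing_inv, ht]

lemma reproKernel_im (u W : ℕ → ℝ) (N x y : ℕ) : (reproKernel u W N x y).im = 0 := by
  rw [← Complex.conj_eq_iff_im, reproKernel, map_mul, map_sum]
  simp_rw [map_sum, map_mul, map_pow, conj_inv_momentMatrix, Complex.conj_ofReal]

section Kernel

variable {z z' : ℂ} {a b : ℝ} {N : ℕ}

lemma hasSum_zero_of_dualPoly (hab : b ≤ a) (hb : -1 / 2 ≤ b) (hz : Admissible z z' a b) {n : ℕ}
    {p : ℂ[X]}
    (hp : ∀ j < n, HasSum (fun x => p.eval (hat a b x : ℂ) *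
      (dualPoly a b z' N j).eval (hat a b x : ℂ) * weightC z z' a b N x) 0)
    {q : ℂ[X]} (hq : q.degree < n) :
    HasSum (fun x => p.eval (hat a b x : ℂ) * q.eval (hat a b x : ℂ) *
      (weight z z' a b N x : ℂ)) 0 := by
  have h := hasSum_zero_of_nodePoly (u := fun x => (hat a b x : ℂ))
    (w := fun x => p.eval (hat a b x : ℂ) * weightC z z' a b N x) (fun j hj =>
      (hp j hj).congr_fun fun x => (mul_right_comm _ _ _)) q hq
  refine h.congr_fun fun x => ?_
  rw [weightC_eq_weight hab hb hz, mul_right_comm]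

lemma decay_re (z z' : ℂ) (b : ℝ) (N : ℕ) :
    (decay z z' b N).re = (sig z z' b).re + 2 * N - 1 := by simp [decay]

/-- The range m of orthogonality is kept apart from the degree n: for n = N the condition `hs` with
m = N requires Σ > 0, while m = N - 1 requires only Σ > -1. -/
lemma neretin_orthogonal (hab : b ≤ a) (hb : -1 / 2 ≤ b) (hz : Admissible z z' a b) {n m : ℕ}
    (hn : n ≤ N) (hm : m ≤ n) (hpole : ∀ m : ℕ, decay z z' b N - 2 * n + 1 ≠ -m)
    (hs : (n + m : ℝ) < (sig z z' b).re + 2 * N) {q : ℂ[X]} (hq : q.degree < m) :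
    HasSum (fun x => (neretin z z' a b N n).eval (hat a b x : ℂ) * q.eval (hat a b x : ℂ) *
      (weight z z' a b N x : ℂ)) 0 := by
  have hne := ne_neg_of_mem_series hz.2.1
  refine hasSum_zero_of_dualPoly hab hb hz (fun j hj => neretin_pairing_zero hab hb
    (hj.trans_le hm) (fun k hk => poch_one_sub_ne_zero (fun l => (hne l).1) (hk.trans hn))
    (fun k hk => poch_one_sub_ne_zero (fun l => (hne l).2) (hk.trans hn)) hpole ?_) hq
  have : (j : ℝ) + 1 ≤ m := by exact_mod_cast hj
  rw [decay_re]
  linarith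

lemma neretin_monic_of_admissible (hab : b ≤ a) (hb : -1 / 2 ≤ b) (hz : Admissible z z' a b)
    {n : ℕ} (hn : n ≤ N) (hpole : ∀ m : ℕ, decay z z' b N - 2 * n + 1 ≠ -m) :
    (neretin z z' a b N n).Monic ∧ (neretin z z' a b N n).natDegree = n := by
  have hne := ne_neg_of_mem_series hz.2.1
  exact neretin_monic (by linarith) (poch_one_sub_ne_zero (fun l => (hne l).1) hn)
    (poch_one_sub_ne_zero (fun l => (hne l).2) hn) hpole

lemma decay_ne_pole_pred (hN : 1 ≤ N) (hz : Admissible z z' a b) (m : ℕ) :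
    decay z z' b N - 2 * ((N - 1 : ℕ) : ℂ) + 1 ≠ -m := by
  intro h
  have h2 := congrArg Complex.re h
  have hm : (0 : ℝ) ≤ m := Nat.cast_nonneg m
  have hs := hz.1
  rw [Nat.cast_sub hN] at h2
  simp [decay] at h2
  linarith

/-- The expression equals Σ, and Σ > -1 leaves 0 as the only nonpositive integer to exclude. -/
lemma decay_ne_pole (hz : Admissible z z' a b) (h0 : sig z z' b ≠ 0) (m : ℕ) :
    decay z z' b N - 2 * (N : ℂ) + 1 ≠ -m := by
  intro h
  have h1 : sig z z' b = -m := by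
    rw [← h, decay]
    ring
  have hs := hz.1
  rcases Nat.eq_zero_or_pos m with rfl | hm
  · exact h0 (by simpa using h1)
  · have hm' : (1 : ℝ) ≤ m := by exact_mod_cast hm
    rw [h1] at hs
    simp at hs
    linarith

lemma neretin_pred_isMonicOrthPoly (hN : 1 ≤ N) (hab : b ≤ a) (hb : -1 / 2 ≤ b)
    (hz : Admissible z z' a b) :
    IsMonicOrthPoly a b (weight z z' a b N) (N - 1) (neretin z z' a b N (N - 1)) := by
  have hpole := decay_ne_pole_pred hN hz
  have h := neretin_monic_of_admissible hab hb hz (Nat.sub_le N 1) hpole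
  refine ⟨h.1, h.2, fun q hq => neretin_orthogonal hab hb hz (Nat.sub_le N 1) le_rfl hpole ?_ hq⟩
  have := hz.1
  rw [Nat.cast_sub hN]
  push_cast
  linarith

lemma neretin_pred_norm (hN : 1 ≤ N) (hab : b ≤ a) (hb : -1 / 2 ≤ b)
    (hz : Admissible z z' a b) :
    HasSum (fun x => (neretin z z' a b N (N - 1)).eval (hat a b x : ℂ) ^ 2 *
      (weight z z' a b N x : ℂ)) (normTop z z' a b N) := by
  have hne := ne_neg_of_mem_series hz.2.1
  refine (neretin_norm hab hb hN (fun k hk => poch_one_sub_ne_zero (fun l => (hne l).1) hk)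
    (fun k hk => poch_one_sub_ne_zero (fun l => (hne l).2) hk) hz.1).congr_fun fun x => ?_
  rw [weightC_eq_weight hab hb hz]

lemma isUnit_det_momentMatrix_weight (hab : b ≤ a) (hb : -1 / 2 ≤ b) (hz : Admissible z z' a b) :
    IsUnit (momentMatrix (hat a b) (weight z z' a b N) N).det :=
  isUnit_det_momentMatrix (hat_injective (eps_nonneg hab hb)) (weight_nonneg hab hb hz N)
    (fun _ hx => weight_pos hab hb hz hx) fun _ hk => summable_hat_pow hab hb hz hk

/-- The right side does not involve `p`. This is why different polynomials of degree N yield one and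
the same kernel. -/
lemma cdKernel_eq_reproKernel (hN : 1 ≤ N) (hab : b ≤ a) (hb : -1 / 2 ≤ b)
    (hz : Admissible z z' a b) {p : ℂ[X]} (hpm : p.Monic) (hpd : p.natDegree = N)
    (hp : ∀ q : ℂ[X], q.degree < (N - 1 : ℕ) → HasSum (fun x => p.eval (hat a b x : ℂ) *
      q.eval (hat a b x : ℂ) * (weight z z' a b N x : ℂ)) 0) :
    cdKernel z z' a b N p = reproKernel (hat a b) (weight z z' a b N) N := by
  have hq := neretin_pred_isMonicOrthPoly hN hab hb hz
  have h0 := normTop_ne_zero hab hb hz hN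
  ext x y
  rw [cdKernel, cdQuotient_eq hN hpm hpd hq.1 hq.2.1 hp hq.2.2 (neretin_pred_norm hN hab hb hz)
    (fun k hk => summable_hat_pow hab hb hz hk) (isUnit_det_momentMatrix_weight hab hb hz),
    reproKernel, ← mul_assoc, div_mul_cancel₀ _ h0]

lemma cdKernel_neretin (hN : 1 ≤ N) (hab : b ≤ a) (hb : -1 / 2 ≤ b)
    (hz : Admissible z z' a b) (h0 : sig z z' b ≠ 0) :
    cdKernel z z' a b N (neretin z z' a b N N) =
      reproKernel (hat a b) (weight z z' a b N) N := by
  have hpole := decay_ne_pole (N := N) hz h0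
  have h := neretin_monic_of_admissible hab hb hz le_rfl hpole
  refine cdKernel_eq_reproKernel hN hab hb hz h.1 h.2 fun q hq =>
    neretin_orthogonal hab hb hz le_rfl (Nat.sub_le N 1) hpole ?_ hq
  have := hz.1
  rw [Nat.cast_sub hN]
  push_cast
  linarith

lemma cdKernel_neretinTilde (hN : 1 ≤ N) (hab : b ≤ a) (hb : -1 / 2 ≤ b)
    (hz : Admissible z z' a b) :
    cdKernel z z' a b N (neretinTilde z z' a b N) =
      reproKernel (hat a b) (weight z z' a b N) N := by
  have h := neretinTilde_monic z z' a b N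
  exact cdKernel_eq_reproKernel hN hab hb hz h.1 h.2 fun q hq =>
    hasSum_zero_of_dualPoly hab hb hz
      (fun j hj => neretinTilde_pairing_zero hab hb (by omega) hz.1) hq

end Kernel

end ZMeas

theorem theorem4p3 (z z' : ℂ) (a b : ℝ) (N : ℕ) (hN : 1 ≤ N)
    (hab : b ≤ a) (hb : -1 / 2 ≤ b) (hz : ZMeas.Admissible z z' a b) :
    -- the weight is real and nonnegative on the half-lattice
    (∀ x : ℕ, ZMeas.weightC z z' a b N x = (ZMeas.weight z z' a b N x : ℂ) ∧
      0 ≤ ZMeas.weight z z' a b N x) ∧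
    -- the process is an orthogonal polynomial ensemble
    MeasureTheory.IsProbabilityMeasure (ZMeas.processO z z' a b N) ∧
    ZMeas.IsOrthPolyEnsemble a b N (ZMeas.weight z z' a b N) (ZMeas.processO z z' a b N) ∧
    -- the top polynomials and the squared norm
    ZMeas.normTop z z' a b N ≠ 0 ∧
    ZMeas.IsMonicOrthPoly a b (ZMeas.weight z z' a b N) (N - 1)
      (ZMeas.neretin z z' a b N (N - 1)) ∧
    HasSum (fun x : ℕ => (ZMeas.neretin z z' a b N (N - 1)).eval (ZMeas.hat a b x : ℂ) ^ 2 *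
      (ZMeas.weight z z' a b N x : ℂ)) (ZMeas.normTop z z' a b N) ∧
    (0 < (ZMeas.sig z z' b).re →
      ZMeas.IsMonicOrthPoly a b (ZMeas.weight z z' a b N) N (ZMeas.neretin z z' a b N N)) ∧
    -- the correlation kernel for `Σ ≠ 0`
    (ZMeas.sig z z' b ≠ 0 →
      ZMeas.IsCorrelationKernel a b (ZMeas.cdKernel z z' a b N (ZMeas.neretin z z' a b N N))
        (ZMeas.processO z z' a b N)) ∧
    -- the alternative formula, valid also for `Σ = 0`
    ZMeas.IsCorrelationKernel a b (ZMeas.cdKernel z z' a b N (ZMeas.neretinTilde z z' a b N))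
      (ZMeas.processO z z' a b N) ∧
    (ZMeas.sig z z' b ≠ 0 → ∀ x y : ℕ,
      ZMeas.cdKernel z z' a b N (ZMeas.neretin z z' a b N N) x y =
        ZMeas.cdKernel z z' a b N (ZMeas.neretinTilde z z' a b N) x y) ∧
    (∀ x y : ℕ, (ZMeas.cdKernel z z' a b N (ZMeas.neretinTilde z z' a b N) x y).im = 0) := by
  have hW0 := ZMeas.weight_nonneg hab hb hz N
  have heps := ZMeas.eps_nonneg hab hb
  have hWpos : ∀ x < N, 0 < ZMeas.weight z z' a b N x := fun _ hx => ZMeas.weight_pos hab hb hz hx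
  have hs : Summable (ZMeas.zWeight z z' a b N) := ZMeas.zWeight_summable hW0
    (ZMeas.summable_one_add_hat_pow hab hb hz (by omega))
  -- The correlation property is established once, for the reproducing kernel; both
  -- Christoffel–Darboux formulas are then rewritten to it.
  have hK := ZMeas.isCorrelationKernel_reproKernel heps hW0 hWpos hs
    (fun k hk => ZMeas.summable_hat_pow hab hb hz hk)
    (ZMeas.isUnit_det_momentMatrix_weight hab hb hz)
  have hT := ZMeas.cdKernel_neretinTilde hN hab hb hz
  refine ⟨fun x => ⟨ZMeas.weightC_eq_weight hab hb hz N x, hW0 x⟩,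
    ZMeas.isProbabilityMeasure_processO heps hW0 hWpos hs,
    ZMeas.isOrthPolyEnsemble_processO heps hW0 hWpos hs,
    ZMeas.normTop_ne_zero hab hb hz hN,
    ZMeas.neretin_pred_isMonicOrthPoly hN hab hb hz,
    ZMeas.neretin_pred_norm hN hab hb hz, fun h => ?_, fun h => ?_, ?_, fun h x y => ?_,
    fun x y => ?_⟩
  · have hpole := ZMeas.decay_ne_pole (N := N) hz fun h0 => by simp [h0] at h
    have hm := ZMeas.neretin_monic_of_admissible hab hb hz le_rfl hpole
    exact ⟨hm.1, hm.2, fun q hq =>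
      ZMeas.neretin_orthogonal hab hb hz le_rfl le_rfl hpole (by linarith) hq⟩
  · rw [ZMeas.cdKernel_neretin hN hab hb hz h]
    exact hK
  · rw [hT]
    exact hK
  · rw [ZMeas.cdKernel_neretin hN hab hb hz h, hT]
  · rw [hT]
    exact ZMeas.reproKernel_im _ _ _ _ _
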